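/- **Setting.** Let $m\in\{1,2\}$, $k\ge 1$, $T>0$. Let $\Gamma(t)\subset\mathbb R^{m+1}$, $0\le t\le T$, be a smooth evolving closed (compact, without boundary) hypersurface that moves with a given smooth velocity $v$: $\Gamma(t)=\{X(t;x): x\in\Gamma(0)\}$ with $X$ smooth, $\partial_tX(t;x)=v(X(t;x),t)$, $X(0;x)=x$. Let $p(\cdot,t)$ be the closest-point projection onto $\Gamma(t)$; near $\Gamma(t)$, $p=p(x,t)$ is determined by $p=x-d(x,t)\,\nu(p,t)$, with $d$ the oriented distance and $\nu$ the unit normal. *Discrete surface.* Take a conforming mesh of nondegenerate flat $m$-simplices with vertices on $\Gamma(0)$, shape regular with constant $\sigma$ (the diameter of each simplex is at most $\sigma$ times the radius of an inscribed ball). Its Lagrange nodes of order $k$ are projected to $\Gamma(0)$ by $p(\cdot,0)$ and then transported with velocity $v$, which gives the nodes $a_j(t)\in\Gamma(t)$. The curved element $E(t)$ is the image of the reference simplex under the polynomial map of degree $k$ that interpolates the nodes of the element, and $\Gamma_h(t)=\bigcup E(t)$. The triangulation is assumed admissible: for every $t\in[0,T]$ the piecewise polynomial map from the flat mesh to $\Gamma_h(t)$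 is injective, and $p(\cdot,t)\colon\Gamma_h(t)\to\Gamma(t)$ is a bijection. Let $h>0$ satisfy $\operatorname{diam}E(t)\le h$ for all elements and all $t\in[0,T]$. *Spaces, lifts, velocities.* $S_h^k(t)$ is the span of the nodal basis functions $\chi_j(\cdot,t)$, which are continuous on $\Gamma_h(t)$, are polynomials of degree $k$ on each element in the reference coordinates, and satisfy $\chi_j(a_i(t),t)=\delta_{ij}$. The lift $\eta^l$ of $\eta\colon\Gamma_h(t)\to\mathbb R$ is given by $\eta^l(p(x,t))=\eta(x)$, $x\in\Gamma_h(t)$. The discrete velocity is $V_h(\cdot,t)=\sum_j v(a_j(t),t)\chi_j(\cdot,t)$, and $v_h$ is the velocity of the lifted material points: $v_h(y,t)=\partial_tp(x,t)+V_h(x,t)\cdot\nabla p(x,t)$ for $y=p(x,t)$, $x\in\Gamma_h(t)$. *Forms.* With the tangential gradient $\nabla_{\Gamma}$, and $\mathcal B(w)_{ij}=\delta_{ij}\,(\nabla_{\Gamma}\cdot w)-\big((\nabla_{\Gamma})_iw_j+(\nabla_{\Gamma})_jw_i\big)$, put $$m(z,\varphi)=\int_{\Gamma(t)}z\varphi,\quad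 a(z,\varphi)=\int_{\Gamma(t)}\nabla_{\Gamma(t)}z\cdot\nabla_{\Gamma(t)}\varphi,\quad g(w;z,\varphi)=\int_{\Gamma(t)}(\nabla_{\Gamma(t)}\cdot w)\,z\varphi,\quad b(w;z,\varphi)=\int_{\Gamma(t)}\mathcal B(w)\nabla_{\Gamma(t)}z\cdot\nabla_{\Gamma(t)}\varphi,$$ and let $m_h,a_h,g_h,b_h$ be the same expressions on $\Gamma_h(t)$, with the tangential derivatives taken elementwise. **Lemma (geometric perturbation errors).** There are constants $c>0$ and $h_0>0$, which depend only on the evolving surface and its motion (including $T$), on $k$ and on $\sigma$, but not on the mesh, $h$ or $t$, such that for every triangulation as above with $h\le h_0$, every $t\in[0,T]$ and all $Z_h,\phi_h\in S_h^k(t)$: the lifts and their tangential gradients are square integrable on $\Gamma(t)$, and $$|m(Z_h^l,\phi_h^l)-m_h(Z_h,\phi_h)|\le c\,h^{k+1}\|Z_h^l\|_{L^2(\Gamma(t))}\|\phi_h^l\|_{L^2(\Gamma(t))},$$ $$|a(Z_h^l,\phi_h^l)-a_h(Z_h,\phi_h)|\le c\,h^{k+1}\|\nabla_{\Gamma(t)}Z_h^l\|_{L^2(\Gamma(t))}\|\nabla_{\Gamma(t)}\phi_h^l\|_{L^2(\Gamma(t))},$$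 $$|g(v_h;Z_h^l,\phi_h^l)-g_h(V_h;Z_h,\phi_h)|\le c\,h^{k+1}\|Z_h^l\|_{L^2(\Gamma(t))}\|\phi_h^l\|_{L^2(\Gamma(t))},$$ $$|b(v_h;Z_h^l,\phi_h^l)-b_h(V_h;Z_h,\phi_h)|\le c\,h^{k+1}\|\nabla_{\Gamma(t)}Z_h^l\|_{L^2(\Gamma(t))}\|\nabla_{\Gamma(t)}\phi_h^l\|_{L^2(\Gamma(t))}.$$ -/

import Mathlib

open Set MeasureTheory
open scoped ContDiff

noncomputable section

/-- The ambient Euclidean space `ℝⁿ`. -/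
abbrev Euc (n : ℕ) : Type := EuclideanSpace ℝ (Fin n)

namespace SurfaceFEM

/-! ### Calculus on embedded surfaces -/

/-- `S` is (locally the regular zero set of a smooth real function, i.e.) a smooth embedded
hypersurface without boundary. -/
def IsSmoothHypersurface {n : ℕ} (S : Set (Euc n)) : Prop :=
  ∀ x ∈ S, ∃ U : Set (Euc n), IsOpen U ∧ x ∈ U ∧ ∃ f : Euc n → ℝ, ContDiff ℝ ∞ f ∧
    (∀ y ∈ U, fderiv ℝ f y ≠ 0) ∧ S ∩ U = {y ∈ U | f y = 0}

/-- The tangent space of `S` at `x`: the linear span of the tangent cone. -/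
def tangentSpaceAt {n : ℕ} (S : Set (Euc n)) (x : Euc n) : Submodule ℝ (Euc n) :=
  Submodule.span ℝ (tangentConeAt ℝ S x)

/-- The tangential gradient `∇_S u (x)`: the orthogonal projection onto the tangent space of the
gradient of `u`. Only the values of `u` on `S` enter: any two derivatives of `u` within `S` agree on
the tangent cone, hence have the same projection, which is `∇ū - (∇ū · ν) ν` for every
differentiable extension `ū` of `u`. For a continuous, piecewise smooth function on a smooth closed
surface this is, almost everywhere, the weak tangential gradient. -/
def tgrad {n : ℕ} (S : Set (Euc n)) (u : Euc n → ℝ) (x : Euc n) : Euc n :=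
  (tangentSpaceAt S x).starProjection
    ((InnerProductSpace.toDual ℝ (Euc n)).symm (fderivWithin ℝ u S x))

/-- The tangential derivative `(∇_S)_i w_j` of a vector field `w`. -/
def tderiv {n : ℕ} (S : Set (Euc n)) (w : Euc n → Euc n) (x : Euc n) (i j : Fin n) : ℝ :=
  tgrad S (fun y => w y j) x i

/-- The tangential divergence `∇_S · w`. -/
def tdiv {n : ℕ} (S : Set (Euc n)) (w : Euc n → Euc n) (x : Euc n) : ℝ :=
  ∑ i, tderiv S w x i i

/-- The tensor `B(w)_{ij} = δ_{ij} (∇_S · w) - ((∇_S)_i w_j + (∇_S)_j w_i)`. -/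
def velocityTensor {n : ℕ} (S : Set (Euc n)) (w : Euc n → Euc n) (x : Euc n) :
    Matrix (Fin n) (Fin n) ℝ :=
  Matrix.of fun i j =>
    (if i = j then tdiv S w x else 0) - (tderiv S w x i j + tderiv S w x j i)

/-- The point of `S` closest to `x`. If `S` is a smooth closed hypersurface with unit normal `ν` and
oriented distance function `d`, and `x` is close to `S`, this is the unique `p ∈ S` with
`p = x - d(x) ν(p)`. -/
def closestPoint {n : ℕ} (S : Set (Euc n)) (x : Euc n) : Euc n :=
  Classical.epsilon fun p => p ∈ S ∧ dist x p = Metric.infDist x S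

/-! ### The bilinear forms on an `m`-dimensional set `S ⊆ ℝᵐ⁺¹`

The surface measure is the `m`-dimensional Hausdorff measure, with its Euclidean normalisation. -/

variable {m : ℕ}

/-- `∫_S z φ`. -/
def massForm (S : Set (Euc (m + 1))) (z φ : Euc (m + 1) → ℝ) : ℝ :=
  ∫ x in S, z x * φ x ∂μHE[m]

/-- `∫_S ∇_S z · ∇_S φ`. -/
def stiffnessForm (S : Set (Euc (m + 1))) (z φ : Euc (m + 1) → ℝ) : ℝ :=
  ∫ x in S, inner ℝ (tgrad S z x) (tgrad S φ x) ∂μHE[m]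

/-- `∫_S (∇_S · w) z φ`. -/
def divForm (S : Set (Euc (m + 1))) (w : Euc (m + 1) → Euc (m + 1)) (z φ : Euc (m + 1) → ℝ) : ℝ :=
  ∫ x in S, tdiv S w x * z x * φ x ∂μHE[m]

/-- `∫_S B(w) ∇_S z · ∇_S φ`. -/
def tensorForm (S : Set (Euc (m + 1))) (w : Euc (m + 1) → Euc (m + 1))
    (z φ : Euc (m + 1) → ℝ) : ℝ :=
  ∫ x in S, (∑ i, ∑ j, velocityTensor S w x i j * tgrad S z x j * tgrad S φ x i) ∂μHE[m]

/-- The norm `‖f‖_{L²(S)}`. -/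
def normL2 {F : Type*} [NormedAddCommGroup F] (S : Set (Euc (m + 1))) (f : Euc (m + 1) → F) : ℝ :=
  Real.sqrt (∫ x in S, ‖f x‖ ^ 2 ∂μHE[m])

/-! ### Evolving surfaces -/

/-- A smooth evolving compact hypersurface in `ℝᵐ⁺¹`, `0 ≤ t ≤ T`, which moves with a smooth
velocity `v`: every point of the initial surface is transported by `v`. -/
structure EvolvingSurface (m : ℕ) (T : ℝ) where
  /-- the initial surface `Γ(0)` -/
  initial : Set (Euc (m + 1))
  /-- the velocity `v(·, t)` -/
  velocity : ℝ → Euc (m + 1) → Euc (m + 1)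
  /-- the position at time `t` of the material point that starts in `x ∈ Γ(0)` -/
  flow : ℝ → Euc (m + 1) → Euc (m + 1)
  isCompact_initial : IsCompact initial
  isSmoothHypersurface_initial : IsSmoothHypersurface initial
  contDiff_velocity : ContDiff ℝ ∞ (fun q : ℝ × Euc (m + 1) => velocity q.1 q.2)
  contDiff_flow : ContDiff ℝ ∞ (fun q : ℝ × Euc (m + 1) => flow q.1 q.2)
  flow_zero : ∀ x ∈ initial, flow 0 x = x
  hasDerivWithinAt_flow : ∀ t ∈ Icc 0 T, ∀ x ∈ initial,
    HasDerivWithinAt (fun s => flow s x) (velocity t (flow t x)) (Icc 0 T) t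

/-- The surface `Γ(t)`. -/
def EvolvingSurface.surface {T : ℝ} (Γ : EvolvingSurface m T) (t : ℝ) : Set (Euc (m + 1)) :=
  Γ.flow t '' Γ.initial

/-- The projection `p(·, t)` onto `Γ(t)`. -/
def EvolvingSurface.proj {T : ℝ} (Γ : EvolvingSurface m T) (t : ℝ) (x : Euc (m + 1)) :
    Euc (m + 1) :=
  closestPoint (Γ.surface t) x

/-! ### Discrete surfaces of order `k`

Points of a simplex are described by their barycentric coordinates `l : Fin (m + 1) → ℝ`, running
through `stdSimplex ℝ (Fin (m + 1))`, and the Lagrange nodes of order `k` by the multi-indices `α`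
with `∑ i, α i = k`, the node of `α` having the barycentric coordinates `α / k`. -/

/-- The Lagrange basis polynomial of degree `k` belonging to `α`: it is `1` at the node `α / k` and
`0` at all the other nodes. -/
def lagrange (k : ℕ) (α : Fin (m + 1) → ℕ) (l : Fin (m + 1) → ℝ) : ℝ :=
  ∏ i, ∏ j ∈ Finset.range (α i), ((k : ℝ) * l i - j) / (j + 1)

/-- A finite family of flat `m`-simplices in `ℝᵐ⁺¹`, given by their vertices. -/
structure FlatMesh (m : ℕ) where
  /-- the number of simplices -/
  card : ℕ
  /-- the vertices of the simplices -/
  vert : Fin card → Fin (m + 1) → Euc (m + 1)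

namespace FlatMesh

/-- The point with barycentric coordinates `l` in the flat simplex `e`. -/
def point (M : FlatMesh m) (e : Fin M.card) (l : Fin (m + 1) → ℝ) : Euc (m + 1) :=
  ∑ i, l i • M.vert e i

variable {T : ℝ} (M : FlatMesh m) (Γ : EvolvingSurface m T) (k : ℕ)

/-- The nodes `a_j(t)`: the Lagrange nodes of the flat simplices are projected to `Γ(0)`, and from
there they are transported with the velocity `v`. -/
def node (t : ℝ) (e : Fin M.card) (α : Fin (m + 1) → ℕ) : Euc (m + 1) :=
  Γ.flow t (closestPoint Γ.initial (M.point e fun i => (α i : ℝ) / k))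

/-- The polynomial of degree `k` on the reference simplex which has the value `w (a_j(t))` at the
reference position of each node `a_j(t)` of the element `e`. -/
def localInterp {F : Type*} [AddCommGroup F] [Module ℝ F] (t : ℝ) (w : Euc (m + 1) → F)
    (e : Fin M.card) (l : Fin (m + 1) → ℝ) : F :=
  ∑ α ∈ Finset.piAntidiag Finset.univ k, lagrange k α l • w (M.node Γ k t e α)

/-- The parametrisation of the curved element `E(t)` over the reference simplex. -/
def param (t : ℝ) (e : Fin M.card) (l : Fin (m + 1) → ℝ) : Euc (m + 1) :=
  M.localInterp Γ k t id e l

/-- The curved element `E(t)`. -/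
def element (t : ℝ) (e : Fin M.card) : Set (Euc (m + 1)) :=
  M.param Γ k t e '' stdSimplex ℝ (Fin (m + 1))

/-- The discrete surface `Γ_h(t)`. -/
def discreteSurface (t : ℝ) : Set (Euc (m + 1)) :=
  ⋃ e, M.element Γ k t e

/-- `M`, with the `k`-order curved elements that it generates, is an admissible evolving
triangulation: the flat simplices are nondegenerate, inscribed in `Γ(0)`, form a conforming mesh and
are shape regular with constant `σ` (diameter at most `σ` times the radius of an inscribed ball).
At every time different points of the mesh do not collide (so the curved elements form a conforming
mesh, too), and `p(·, t)` maps `Γ_h(t)` one-to-one onto `Γ(t)`. -/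
structure Admissible (σ : ℝ) : Prop where
  vert_mem : ∀ e i, M.vert e i ∈ Γ.initial
  affineIndependent : ∀ e, AffineIndependent ℝ (M.vert e)
  injective : Function.Injective fun e => range (M.vert e)
  conforming : ∀ e e', convexHull ℝ (range (M.vert e)) ∩ convexHull ℝ (range (M.vert e')) =
    convexHull ℝ (range (M.vert e) ∩ range (M.vert e'))
  shapeRegular : ∀ e, ∃ z ∈ affineSpan ℝ (range (M.vert e)),
    ∀ x ∈ affineSpan ℝ (range (M.vert e)),
      σ * dist x z ≤ Metric.diam (range (M.vert e)) → x ∈ convexHull ℝ (range (M.vert e))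
  param_injective : ∀ t ∈ Icc 0 T, ∀ e e', ∀ l ∈ stdSimplex ℝ (Fin (m + 1)),
    ∀ l' ∈ stdSimplex ℝ (Fin (m + 1)),
      M.param Γ k t e l = M.param Γ k t e' l' → M.point e l = M.point e' l'
  bijOn_proj : ∀ t ∈ Icc 0 T, BijOn (Γ.proj t) (M.discreteSurface Γ k t) (Γ.surface t)

/-- The finite element space `S_h(t)`: those functions on `Γ_h(t)` which are on each element the
combination of the nodal basis functions with their own nodal values, i.e. the span of the nodal
basis functions. (Values away from `Γ_h(t)` are irrelevant. Adjacent elements share the nodes on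
their common face, so these functions are continuous on `Γ_h(t)`.) -/
def IsFiniteElement (t : ℝ) (φ : Euc (m + 1) → ℝ) : Prop :=
  ∀ e, ∀ l ∈ stdSimplex ℝ (Fin (m + 1)),
    φ (M.param Γ k t e l) = M.localInterp Γ k t φ e l

open Classical in
/-- The discrete velocity `V_h(·, t)`: the finite element interpolation on `Γ_h(t)` of `v(·, t)`.
The value does not depend on the element and the coordinates chosen for `x`. -/
def discreteVelocity (t : ℝ) (x : Euc (m + 1)) : Euc (m + 1) :=
  if h : ∃ q : Fin M.card × (Fin (m + 1) → ℝ),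
      q.2 ∈ stdSimplex ℝ (Fin (m + 1)) ∧ M.param Γ k t q.1 q.2 = x
  then M.localInterp Γ k t (Γ.velocity t) h.choose.1 h.choose.2
  else 0

/-- The inverse of `p(·, t) : Γ_h(t) → Γ(t)`. -/
def projInv (t : ℝ) (y : Euc (m + 1)) : Euc (m + 1) :=
  Function.invFunOn (Γ.proj t) (M.discreteSurface Γ k t) y

/-- The lift `η^l` to `Γ(t)` of a function `η` on `Γ_h(t)`. -/
def lift {F : Type*} (t : ℝ) (η : Euc (m + 1) → F) (y : Euc (m + 1)) : F :=
  η (M.projInv Γ k t y)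

/-- The velocity of the lifted material points,
`v_h(y, t) = ∂_t p(x, t) + V_h(x, t) · ∇p(x, t)` for `y = p(x, t)`, `x ∈ Γ_h(t)`. -/
def liftedVelocity (t : ℝ) (y : Euc (m + 1)) : Euc (m + 1) :=
  derivWithin (fun s => Γ.proj s (M.projInv Γ k t y)) (Icc 0 T) t +
    fderiv ℝ (Γ.proj t) (M.projInv Γ k t y) (M.discreteVelocity Γ k t (M.projInv Γ k t y))

/-! The discrete bilinear forms. Integrals over `Γ_h(t)` are sums of the integrals over the elements,
on which the discrete tangential gradient is taken elementwise. -/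

/-- `m_h(t; Z, φ)`. -/
def discreteMassForm (t : ℝ) (Z φ : Euc (m + 1) → ℝ) : ℝ :=
  ∑ e, massForm (M.element Γ k t e) Z φ

/-- `a_h(t; Z, φ)`. -/
def discreteStiffnessForm (t : ℝ) (Z φ : Euc (m + 1) → ℝ) : ℝ :=
  ∑ e, stiffnessForm (M.element Γ k t e) Z φ

/-- `g_h(t; W; Z, φ)`. -/
def discreteDivForm (t : ℝ) (W : Euc (m + 1) → Euc (m + 1)) (Z φ : Euc (m + 1) → ℝ) : ℝ :=
  ∑ e, divForm (M.element Γ k t e) W Z φ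

/-- `b_h(t; W; Z, φ)`. -/
def discreteTensorForm (t : ℝ) (W : Euc (m + 1) → Euc (m + 1)) (Z φ : Euc (m + 1) → ℝ) : ℝ :=
  ∑ e, tensorForm (M.element Γ k t e) W Z φ

end FlatMesh

end SurfaceFEM

end

/-!
Every curved element and its projection to `Γ(t)` are parametrised over the same reference simplex,
by maps `F` and `P`. All four forms are then integrals over the reference simplex of expressions in
the differential of the parametrisation, in its time derivative and in the nodal values, which a
function and its lift share. It remains to see that these expressions differ by a relative error of
order `h ^ (k + 1)`.

The key is that the forms depend on the parametrisation only through the metric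
`⟨D_w F, D_w' F⟩` and its time derivative, because the tangential divergence and the tensor `B` are
built from the symmetric part of the tangential velocity gradient, that is, from half the rate of
change of the metric. Write `η` for the size of an element. By interpolation `F - P` is of the form
`η ^ (k + 1) R`, where `R` is bounded together with its derivatives, so a naive comparison of the
differentials, which are of order `η`, would lose one power of `η`. However, `F - P` is orthogonal
to the surface. Therefore the mixed terms `⟨D_w P, D_w' R⟩` of the difference of the metrics are equal
to `-⟨D_w' D_w P, R⟩`, and `D_w' D_w P` is of order `η ^ 2`: the metrics, of order `η ^ 2`, differ by
`O(η ^ (k + 3))` (`metric_sub_metric_eq`). The identity holds for all times, so the same is true of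
the time derivatives. This is `exists_elementMap_isClosePair`.

Uniformity of the constants is obtained by compactness. The parametrisations are smooth functions of
the size, a base point, the scaled vertices, the time and the reference coordinates, and the size
`η = 0` is admitted. For this the closest-point projection has to be smooth in space and time,
`exists_contDiff_closestPoint`, and the remainders of interpolation and Taylor expansion have to be
smooth functions of all data. The latter follows from Hadamard's lemma, `exists_contDiff_hadamard`,
and from the reproduction of polynomials by Lagrange interpolation,
`sum_lagrange_mul_prod_linear`, which is a form of the Chu–Vandermonde identity
(`exists_interpolation_error`). Shape regularity enters through the lower bound
`norm_le_mul_norm_offsetLin`.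

On one element, `IsLocalParam.tgrad_eq` and its companions express the tangential derivatives in the
parameters, `pieceMeasure_le` compares the Hausdorff measures of the two pieces by local Lipschitz
bounds, without a Jacobian, and `IsPiecePair.abs_massForm_sub_le` and its analogues for the other
forms compare the integrals. The lifts of the elements cover `Γ(t)` and overlap in null sets, so that
the errors add up, and the Cauchy–Schwarz inequality gives the product of the `L²` norms.
-/

noncomputable section

namespace SurfaceFEM

open Filter Topology

/-! ### Smooth dependence of integrals on parameters, and Hadamard's lemma -/

section Hadamard

universe u
variable {E V Z Y : Type u} [NormedAddCommGroup E] [NormedSpace ℝ E] [FiniteDimensional ℝ E]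
  [NormedAddCommGroup V] [NormedSpace ℝ V]
  [NormedAddCommGroup Z] [NormedSpace ℝ Z] [FiniteDimensional ℝ Z]
  [NormedAddCommGroup Y] [NormedSpace ℝ Y] [FiniteDimensional ℝ Y]

theorem hasFDerivAt_integral_of_contDiff {f : E × ℝ → V} (hf : ContDiff ℝ 1 f) (x₀ : E) :
    HasFDerivAt (fun x => ∫ s in (0 : ℝ)..1, f (x, s))
      (∫ s in (0 : ℝ)..1, (fderiv ℝ f (x₀, s)).comp (ContinuousLinearMap.inl ℝ E ℝ)) x₀ := by
  have : ProperSpace E := FiniteDimensional.proper ℝ E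
  have hd : Continuous (fun q : E × ℝ => (fderiv ℝ f q).comp (ContinuousLinearMap.inl ℝ E ℝ)) :=
    (hf.continuous_fderiv one_ne_zero).clm_comp continuous_const
  obtain ⟨C, hC⟩ := ((isCompact_closedBall x₀ 1).prod (isCompact_uIcc (a := (0 : ℝ)) (b := 1))
    ).exists_bound_of_continuousOn hd.continuousOn
  have hcx : ∀ x, Continuous fun s : ℝ => f (x, s) := fun x =>
    hf.continuous.comp (by fun_prop)
  have hdx : ∀ x, Continuous fun s : ℝ =>
      (fderiv ℝ f (x, s)).comp (ContinuousLinearMap.inl ℝ E ℝ) := fun x =>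
    hd.comp (by fun_prop : Continuous fun s : ℝ => (x, s))
  refine intervalIntegral.hasFDerivAt_integral_of_dominated_of_fderiv_le (bound := fun _ => C)
    (F' := fun x s => (fderiv ℝ f (x, s)).comp (ContinuousLinearMap.inl ℝ E ℝ))
    (Metric.closedBall_mem_nhds x₀ one_pos) ?_ ((hcx x₀).intervalIntegrable _ _)
    (hdx x₀).aestronglyMeasurable ?_ (by simp) ?_
  · exact Filter.Eventually.of_forall fun x => (hcx x).aestronglyMeasurable
  · exact Filter.Eventually.of_forall fun s hs x hx => hC (x, s) ⟨hx, uIoc_subset_uIcc hs⟩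
  · refine Filter.Eventually.of_forall fun s _ x _ => ?_
    have h1 : HasFDerivAt f (fderiv ℝ f (x, s)) (x, s) :=
      (hf.differentiable one_ne_zero _).hasFDerivAt
    exact h1.comp x (hasFDerivAt_prodMk_left x s)

/-- Differentiation under the integral sign, to all orders. -/
theorem contDiff_integral_of_contDiff [CompleteSpace V] {f : E × ℝ → V} (hf : ContDiff ℝ ∞ f) :
    ContDiff ℝ ∞ (fun x => ∫ s in (0 : ℝ)..1, f (x, s)) := by
  refine contDiff_infty.2 fun n => ?_
  induction n generalizing V with
  | zero =>
    refine contDiff_zero.2 ?_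
    exact intervalIntegral.continuous_parametric_intervalIntegral_of_continuous'
      (f := fun x s => f (x, s)) hf.continuous 0 1
  | succ n ih =>
    refine contDiff_succ_iff_hasFDerivAt.2 ⟨_, ih (f := fun q : E × ℝ =>
      (fderiv ℝ f q).comp (ContinuousLinearMap.inl ℝ E ℝ)) ?_, fun x =>
        hasFDerivAt_integral_of_contDiff (hf.of_le (by exact_mod_cast le_top)) x⟩
    exact (hf.fderiv_right (m := ∞) (by simp)).clm_comp contDiff_const

/-- Hadamard's lemma with parameters: `f (z, y) - f (z, 0)` is linear in `y` with a coefficient that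
depends smoothly on `(z, y)`. -/
theorem exists_contDiff_hadamard [CompleteSpace V] {f : Z × Y → V} (hf : ContDiff ℝ ∞ f) :
    ∃ L : Z × Y → (Y →L[ℝ] V), ContDiff ℝ ∞ L ∧
      ∀ z y, f (z, y) = f (z, 0) + L (z, y) y := by
  have hsm : ContDiff ℝ ∞ (fun q : (Z × Y) × ℝ =>
      (fderiv ℝ f (q.1.1, q.2 • q.1.2)).comp (ContinuousLinearMap.inr ℝ Z Y)) := by
    refine ContDiff.clm_comp ?_ contDiff_const
    exact (hf.fderiv_right (m := ∞) (by simp)).comp (by fun_prop)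
  refine ⟨_, contDiff_integral_of_contDiff hsm, fun z y => ?_⟩
  have hc : Continuous fun s : ℝ =>
      (fderiv ℝ f (z, s • y)).comp (ContinuousLinearMap.inr ℝ Z Y) :=
    hsm.continuous.comp (by fun_prop : Continuous fun s : ℝ => ((z, y), s))
  rw [ContinuousLinearMap.intervalIntegral_apply (hc.intervalIntegrable _ _),
    intervalIntegral.integral_eq_sub_of_hasDerivAt (f := fun s : ℝ => f (z, s • y)) ?_
      ((hc.clm_apply continuous_const).intervalIntegrable _ _)]
  · simp
  · intro s _
    have h1 : HasFDerivAt f (fderiv ℝ f (z, s • y)) (z, s • y) :=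
      (hf.differentiable (by simp) _).hasFDerivAt
    have h2 : HasDerivAt (fun s : ℝ => (z, s • y)) ((0 : Z), y) s := by
      refine (hasDerivAt_const s z).prodMk ?_
      simpa using (hasDerivAt_id s).smul_const y
    exact h1.comp_hasDerivAt s h2

end Hadamard

/-! ### Lagrange interpolation on the simplex reproduces polynomials -/

/-- The binomial coefficient `x (x - 1) ⋯ (x - a + 1) / a!` of a real number. -/
def realChoose (x : ℝ) (a : ℕ) : ℝ := ∏ j ∈ Finset.range a, (x - j) / (j + 1)

theorem realChoose_zero_right (x : ℝ) : realChoose x 0 = 1 := by simp [realChoose]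

theorem realChoose_succ (x : ℝ) (a : ℕ) :
    (a + 1) * realChoose x (a + 1) = (x - a) * realChoose x a := by
  have : (a : ℝ) + 1 ≠ 0 := by positivity
  rw [realChoose, Finset.prod_range_succ, realChoose]
  field_simp

theorem realChoose_natCast_of_lt {n a : ℕ} (h : n < a) : realChoose n a = 0 :=
  Finset.prod_eq_zero (Finset.mem_range.2 h) (by simp)

theorem realChoose_add_one (x : ℝ) (a : ℕ) :
    ((a : ℝ) + 1) * realChoose (x + 1) (a + 1) = (x + 1) * realChoose x a := by
  induction a with
  | zero => simp [realChoose]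
  | succ a ih =>
    have g1 := realChoose_succ (x + 1) (a + 1)
    have g2 := realChoose_succ x a
    have : (a : ℝ) + 1 ≠ 0 := by positivity
    refine mul_left_cancel₀ this ?_
    push_cast at g1 g2 ⊢
    linear_combination (a + 1 : ℝ) * g1 + (x - a) * ih - (x + 1) * g2

theorem realChoose_natCast_self (n : ℕ) : realChoose n n = 1 := by
  induction n with
  | zero => simp [realChoose]
  | succ n ih =>
    have h := realChoose_add_one n n
    have : (n : ℝ) + 1 ≠ 0 := by positivity
    rw [ih] at h
    push_cast
    exact mul_left_cancel₀ this h

theorem realChoose_mul_succ (x : ℝ) (b : ℕ) :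
    x * realChoose x b = (b + 1) * realChoose x (b + 1) + b * realChoose x b := by
  rw [realChoose_succ]; ring

theorem sum_antidiagonal_realChoose (x y : ℝ) (n : ℕ) :
    ∑ p ∈ Finset.HasAntidiagonal.antidiagonal n, realChoose x p.1 * realChoose y p.2 = realChoose (x + y) n := by
  induction n with
  | zero => simp [realChoose]
  | succ n ih =>
    have h0 : (n : ℝ) + 1 ≠ 0 := by positivity
    refine mul_left_cancel₀ h0 ?_
    rw [realChoose_succ, ← ih, Finset.mul_sum, Finset.mul_sum]
    have h1 : ∑ p ∈ Finset.HasAntidiagonal.antidiagonal (n + 1), ((p.1 : ℝ) * realChoose x p.1) * realChoose y p.2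
        = ∑ p ∈ Finset.HasAntidiagonal.antidiagonal n, (x - p.1) * realChoose x p.1 * realChoose y p.2 := by
      rw [Finset.Nat.sum_antidiagonal_succ]
      simp only [Nat.cast_zero, zero_mul, zero_add]
      refine Finset.sum_congr rfl fun p _ => ?_
      rw [← realChoose_succ]; push_cast; ring
    have h2 : ∑ p ∈ Finset.HasAntidiagonal.antidiagonal (n + 1), realChoose x p.1 * ((p.2 : ℝ) * realChoose y p.2)
        = ∑ p ∈ Finset.HasAntidiagonal.antidiagonal n, realChoose x p.1 * ((y - p.2) * realChoose y p.2) := by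
      rw [Finset.Nat.sum_antidiagonal_succ']
      simp only [Nat.cast_zero, zero_mul, mul_zero, zero_add]
      refine Finset.sum_congr rfl fun p _ => ?_
      rw [← realChoose_succ]; push_cast; ring
    trans (∑ p ∈ Finset.HasAntidiagonal.antidiagonal (n + 1), ((p.1 : ℝ) * realChoose x p.1) * realChoose y p.2) +
      ∑ p ∈ Finset.HasAntidiagonal.antidiagonal (n + 1), realChoose x p.1 * ((p.2 : ℝ) * realChoose y p.2)
    · rw [← Finset.sum_add_distrib]
      refine Finset.sum_congr rfl fun p hp => ?_
      rw [Finset.HasAntidiagonal.mem_antidiagonal] at hp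
      have : (n : ℝ) + 1 = p.1 + p.2 := by exact_mod_cast hp.symm
      rw [this]; ring
    · rw [h1, h2, ← Finset.sum_add_distrib]
      refine Finset.sum_congr rfl fun p hp => ?_
      rw [Finset.HasAntidiagonal.mem_antidiagonal] at hp
      have : (n : ℝ) = p.1 + p.2 := by exact_mod_cast hp.symm
      rw [this]; ring

/-- The Chu–Vandermonde identity in several variables. -/
theorem sum_piAntidiag_prod_realChoose {ι : Type*} [DecidableEq ι] (s : Finset ι) (x : ι → ℝ)
    (n : ℕ) :
    ∑ α ∈ s.piAntidiag n, ∏ i ∈ s, realChoose (x i) (α i) = realChoose (∑ i ∈ s, x i) n := by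
  induction s using Finset.cons_induction generalizing n with
  | empty =>
    rcases n with _ | n
    · simp [realChoose]
    · rw [Finset.piAntidiag_empty_of_ne_zero (Nat.succ_ne_zero n), Finset.sum_empty,
        Finset.sum_empty]
      exact_mod_cast (realChoose_natCast_of_lt (Nat.succ_pos n)).symm
  | cons i s hi ih =>
    rw [Finset.piAntidiag_cons hi, Finset.sum_disjiUnion, Finset.sum_cons,
      ← sum_antidiagonal_realChoose]
    refine Finset.sum_congr rfl fun p _ => ?_
    rw [Finset.sum_map, ← ih, Finset.mul_sum]
    refine Finset.sum_congr rfl fun α hα => ?_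
    have hαi : α i = 0 := by
      by_contra h
      exact hi ((Finset.mem_piAntidiag.1 hα).2 i h)
    rw [Finset.prod_cons]
    congr 1
    · simp [hαi]
    · refine Finset.prod_congr rfl fun j hj => ?_
      have : j ≠ i := fun h => hi (h ▸ hj)
      simp [this]

theorem realChoose_mul_realChoose_add (x : ℝ) (b c : ℕ) :
    realChoose x (b + c) * realChoose ((b : ℝ) + c) b
      = realChoose x b * realChoose (x - b) c := by
  induction b with
  | zero => simp [realChoose_zero_right]
  | succ b ih =>
    have h0 : (b : ℝ) + 1 ≠ 0 := by positivity
    refine mul_left_cancel₀ h0 ?_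
    have h1 := realChoose_add_one ((b : ℝ) + c) b
    have h2 := realChoose_succ x (b + c)
    have h3 := realChoose_succ x b
    have h4 := realChoose_succ (x - b) c
    have h5 := realChoose_add_one (x - b - 1) c
    rw [sub_add_cancel] at h5
    rw [show b + 1 + c = b + c + 1 by ring]
    push_cast at *
    rw [show (b : ℝ) + 1 + c = b + c + 1 by ring, show x - (b + 1 : ℝ) = x - b - 1 by ring]
    linear_combination realChoose x (b + c + 1) * h1 + realChoose (b + c) b * h2 + (x - b - c) * ih
      - realChoose (x - b - 1) c * h3 - realChoose x b * h4 + realChoose x b * h5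

section Reproduction

variable {m : ℕ}

theorem lagrange_eq_prod_realChoose (k : ℕ) (α : Fin (m + 1) → ℕ) (l : Fin (m + 1) → ℝ) :
    lagrange k α l = ∏ i, realChoose (k * l i) (α i) := rfl

/-- The products of binomial coefficients `∏ i, (k l_i choose β_i)` span the polynomials of degree
at most `n`. -/
def binomialSpan (m k n : ℕ) : Submodule ℝ ((Fin (m + 1) → ℝ) → ℝ) :=
  Submodule.span ℝ {f | ∃ β : Fin (m + 1) → ℕ, ∑ i, β i ≤ n ∧
    f = fun l => ∏ i, realChoose (k * l i) (β i)}

theorem binomialSpan_mono (m k : ℕ) {n n' : ℕ} (h : n ≤ n') :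
    binomialSpan m k n ≤ binomialSpan m k n' :=
  Submodule.span_mono fun _ ⟨β, hβ, hf⟩ => ⟨β, hβ.trans h, hf⟩

theorem mul_coord_mem_binomialSpan {k n : ℕ} (hk : k ≠ 0) (i : Fin (m + 1))
    {f : (Fin (m + 1) → ℝ) → ℝ} (hf : f ∈ binomialSpan m k n) :
    (fun l => l i * f l) ∈ binomialSpan m k (n + 1) := by
  induction hf using Submodule.span_induction with
  | mem f hf =>
    obtain ⟨β, hβ, rfl⟩ := hf
    have hk' : (k : ℝ) ≠ 0 := by exact_mod_cast hk
    let β' := Function.update β i (β i + 1)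
    have hβ' : ∑ j, β' j ≤ n + 1 := by
      have h1 : ∑ j, β' j = β i + 1 + ∑ j ∈ Finset.univ \ {i}, β j :=
        Finset.sum_update_of_mem (Finset.mem_univ i) _ _
      have h2 := Finset.sum_update_of_mem (Finset.mem_univ i) β (β i)
      rw [Function.update_eq_self] at h2
      omega
    have e : (fun l : Fin (m + 1) → ℝ => l i * ∏ j, realChoose (k * l j) (β j)) =
        ((k : ℝ)⁻¹ * (β i + 1)) • (fun l => ∏ j, realChoose (k * l j) (β' j)) +
        ((k : ℝ)⁻¹ * β i) • (fun l => ∏ j, realChoose (k * l j) (β j)) := by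
      funext l
      simp only [Pi.add_apply, Pi.smul_apply, smul_eq_mul]
      rw [← Finset.mul_prod_erase _ _ (Finset.mem_univ i),
        ← Finset.mul_prod_erase _ (fun j => realChoose (k * l j) (β' j)) (Finset.mem_univ i)]
      have h3 : ∏ j ∈ Finset.univ.erase i, realChoose (k * l j) (β' j)
          = ∏ j ∈ Finset.univ.erase i, realChoose (k * l j) (β j) := by
        refine Finset.prod_congr rfl fun j hj => ?_
        rw [show β' j = β j from Function.update_of_ne (Finset.ne_of_mem_erase hj) _ _]
      rw [h3, show β' i = β i + 1 from Function.update_self _ _ _]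
      have h4 := realChoose_mul_succ (k * l i) (β i)
      generalize ∏ j ∈ Finset.univ.erase i, realChoose (k * l j) (β j) = Q at *
      generalize realChoose (k * l i) (β i + 1) = R at *
      generalize realChoose (k * l i) (β i) = S at *
      field_simp
      linear_combination Q * h4
    rw [e]
    exact add_mem (Submodule.smul_mem _ _ (Submodule.subset_span ⟨β', hβ', rfl⟩))
      (Submodule.smul_mem _ _ (Submodule.subset_span ⟨β, by omega, rfl⟩))
  | zero =>
    convert zero_mem (binomialSpan m k (n + 1)) using 1
    funext l; simp
  | add f g _ _ hf hg => simpa [mul_add] using! add_mem hf hg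
  | smul c f _ hf =>
    have := Submodule.smul_mem _ c hf
    convert this using 1
    funext l; simp; ring

theorem prod_linear_mem_binomialSpan {k : ℕ} (hk : k ≠ 0) {ι : Type*} (s : Finset ι)
    (a : ι → Fin (m + 1) → ℝ) :
    (fun l : Fin (m + 1) → ℝ => ∏ r ∈ s, ∑ i, l i * a r i) ∈ binomialSpan m k s.card := by
  induction s using Finset.cons_induction with
  | empty => exact Submodule.subset_span ⟨0, by simp, by simp [realChoose]⟩
  | cons r s hr ih =>
    have : (fun l : Fin (m + 1) → ℝ => ∏ r ∈ Finset.cons r s hr, ∑ i, l i * a r i) =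
        ∑ i, a r i • fun l : Fin (m + 1) → ℝ => l i * ∏ r ∈ s, ∑ i, l i * a r i := by
      funext l
      rw [Finset.prod_cons, Finset.sum_mul, Finset.sum_apply]
      refine Finset.sum_congr rfl fun i _ => ?_
      simp; ring
    rw [this, Finset.card_cons]
    exact Submodule.sum_mem _ fun i _ => Submodule.smul_mem _ _ (mul_coord_mem_binomialSpan hk i ih)

/-- Lagrange interpolation reproduces products of binomial coefficients: by
`realChoose_mul_realChoose_add` this is the Chu–Vandermonde identity for the shifted arguments
`k l_i - β_i`. -/
theorem sum_lagrange_mul_prod_realChoose (k : ℕ) (β : Fin (m + 1) → ℕ) (hβ : ∑ i, β i ≤ k)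
    {l : Fin (m + 1) → ℝ} (hl : ∑ i, l i = 1) :
    ∑ α ∈ Finset.piAntidiag Finset.univ k, lagrange k α l * ∏ i, realChoose (α i) (β i)
      = ∏ i, realChoose (k * l i) (β i) := by
  obtain ⟨n, hn⟩ := Nat.exists_eq_add_of_le hβ
  have h1 : ∑ α ∈ Finset.piAntidiag Finset.univ k, lagrange k α l * ∏ i, realChoose (α i) (β i)
      = ∑ γ ∈ Finset.piAntidiag Finset.univ n,
          (∏ i, realChoose (k * l i) (β i)) * ∏ i, realChoose (k * l i - β i) (γ i) := by
    symm
    refine Finset.sum_of_injOn (fun γ => β + γ) (fun _ _ _ _ h => add_left_cancel h) ?_ ?_ ?_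
    · intro γ hγ
      simp only [Finset.mem_coe, Finset.mem_piAntidiag] at *
      refine ⟨?_, by simp⟩
      simp only [Pi.add_apply, Finset.sum_add_distrib, hγ.1, hn]
    · intro α hα hα'
      have : ∃ i, α i < β i := by
        by_contra! hc
        refine hα' ⟨α - β, ?_, ?_⟩
        · rw [Finset.mem_coe, Finset.mem_piAntidiag] at *
          refine ⟨?_, by simp⟩
          have : ∑ i, (β i + (α i - β i)) = ∑ i, α i :=
            Finset.sum_congr rfl fun i _ => Nat.add_sub_cancel' (hc i)
          rw [Finset.sum_add_distrib, hα.1, hn] at this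
          exact Nat.add_left_cancel this
        · funext i; simp [Nat.add_sub_cancel' (hc i)]
      obtain ⟨i, hi⟩ := this
      rw [Finset.prod_eq_zero (Finset.mem_univ i) (realChoose_natCast_of_lt hi), mul_zero]
    · intro γ _
      rw [lagrange_eq_prod_realChoose, ← Finset.prod_mul_distrib, ← Finset.prod_mul_distrib]
      refine Finset.prod_congr rfl fun i _ => ?_
      have := realChoose_mul_realChoose_add (k * l i) (β i) (γ i)
      simpa using this.symm
  rw [h1, ← Finset.mul_sum, sum_piAntidiag_prod_realChoose, Finset.sum_sub_distrib,
    ← Finset.mul_sum, hl]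
  have : (k : ℝ) * 1 - ∑ i, (β i : ℝ) = n := by
    rw [hn]; push_cast; ring
  rw [this, realChoose_natCast_self, mul_one]

theorem sum_lagrange_mul_of_mem_binomialSpan {k : ℕ} (hk : k ≠ 0)
    {f : (Fin (m + 1) → ℝ) → ℝ} (hf : f ∈ binomialSpan m k k)
    {l : Fin (m + 1) → ℝ} (hl : ∑ i, l i = 1) :
    ∑ α ∈ Finset.piAntidiag Finset.univ k, lagrange k α l * f (fun i => (α i : ℝ) / k) = f l := by
  have hk' : (k : ℝ) ≠ 0 := by exact_mod_cast hk
  induction hf using Submodule.span_induction with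
  | mem f hf =>
    obtain ⟨β, hβ, rfl⟩ := hf
    simp only [mul_div_cancel₀ _ hk']
    exact sum_lagrange_mul_prod_realChoose k β hβ hl
  | zero => simp
  | add f g _ _ hf hg => simp [mul_add, Finset.sum_add_distrib, hf, hg]
  | smul c f _ hf =>
    simp only [Pi.smul_apply, smul_eq_mul]
    rw [← hf, Finset.mul_sum]
    exact Finset.sum_congr rfl fun _ _ => by ring

/-- Lagrange interpolation of order `k` reproduces products of at most `k` linear functions of the
barycentric coordinates. -/
theorem sum_lagrange_mul_prod_linear {k : ℕ} (hk : k ≠ 0) {ι : Type*} (s : Finset ι)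
    (hs : s.card ≤ k) (a : ι → Fin (m + 1) → ℝ) {l : Fin (m + 1) → ℝ} (hl : ∑ i, l i = 1) :
    ∑ α ∈ Finset.piAntidiag Finset.univ k,
      lagrange k α l * ∏ r ∈ s, ∑ i, (α i : ℝ) / k * a r i = ∏ r ∈ s, ∑ i, l i * a r i :=
  sum_lagrange_mul_of_mem_binomialSpan hk
    (binomialSpan_mono m k hs (prod_linear_mem_binomialSpan hk s a)) hl

end Reproduction

/-! ### The interpolation error of a smooth function on a small simplex -/

section Interpolation

variable {m : ℕ}

theorem contDiff_lagrange (k : ℕ) (α : Fin (m + 1) → ℕ) : ContDiff ℝ ∞ (lagrange k α) := by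
  unfold lagrange
  fun_prop

variable {V Z Y : Type} [NormedAddCommGroup V] [NormedSpace ℝ V]
  [NormedAddCommGroup Z] [NormedSpace ℝ Z]
  [NormedAddCommGroup Y] [NormedSpace ℝ Y]

/-- The interpolation error of `y ↦ (∏ r, φ_r y) g (z, η y)` at `∑ i, l_i ζ_i`. -/
def interpError (k : ℕ) {n : ℕ} (φ : Fin n → Y →L[ℝ] ℝ) (g : Z × Y → V)
    (q : Z × ℝ × (Fin (m + 1) → ℝ) × (Fin (m + 1) → Y)) : V :=
  ∑ α ∈ Finset.piAntidiag Finset.univ k, lagrange k α q.2.2.1 •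
      (∏ r, φ r (∑ i, ((α i : ℝ) / k) • q.2.2.2 i)) •
        g (q.1, q.2.1 • ∑ i, ((α i : ℝ) / k) • q.2.2.2 i)
    - (∏ r, φ r (∑ i, q.2.2.1 i • q.2.2.2 i)) • g (q.1, q.2.1 • ∑ i, q.2.2.1 i • q.2.2.2 i)

theorem contDiff_interpError (k : ℕ) {n : ℕ} (φ : Fin n → Y →L[ℝ] ℝ) {g : Z × Y → V}
    (hg : ContDiff ℝ ∞ g) : ContDiff ℝ ∞ (interpError (m := m) k φ g) := by
  have hl := contDiff_lagrange (m := m) k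
  unfold interpError
  refine ContDiff.sub (ContDiff.sum fun α _ => ?_) ?_
  · refine ContDiff.smul ((hl α).comp (by fun_prop)) (ContDiff.smul ?_ (hg.comp ?_)) <;> fun_prop
  · refine ContDiff.smul ?_ (hg.comp ?_) <;> fun_prop

variable [FiniteDimensional ℝ Z] [FiniteDimensional ℝ Y] [CompleteSpace V]

/-- With `n ≤ k + 1` linear factors the interpolation error is of order `η ^ (k + 1 - n)`. The
reason is Hadamard's lemma: the value at `0` contributes a polynomial of degree at most `k`, which
is reproduced, and the remainder has a further linear factor and a factor `η`. -/
theorem exists_interpError_eq {k : ℕ} (hk : k ≠ 0) (d : ℕ) :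
    ∀ (n : ℕ), n + d = k + 1 → ∀ (φ : Fin n → Y →L[ℝ] ℝ) (g : Z × Y → V), ContDiff ℝ ∞ g →
      ∃ R : Z × ℝ × (Fin (m + 1) → ℝ) × (Fin (m + 1) → Y) → V, ContDiff ℝ ∞ R ∧
        ∀ q, ∑ i, q.2.2.1 i = 1 → interpError k φ g q = q.2.1 ^ d • R q := by
  induction d with
  | zero => exact fun n _ φ g hg => ⟨_, contDiff_interpError k φ hg, by simp⟩
  | succ d ih =>
    intro n hn φ g hg
    obtain ⟨L, hL, hgL⟩ := exists_contDiff_hadamard hg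
    let b := Module.finBasis ℝ Y
    let c : Fin (Module.finrank ℝ Y) → Y →L[ℝ] ℝ := fun j => (b.coord j).toContinuousLinearMap
    have hbc : ∀ y, y = ∑ j, c j y • b j := fun y => (b.sum_repr y).symm
    have hsm : ∀ j, ContDiff ℝ ∞ fun p : Z × Y => L p (b j) := fun j => hL.clm_apply contDiff_const
    choose R hR hRe using fun j => ih (n + 1) (by omega) (Fin.cons (c j) φ) _ (hsm j)
    refine ⟨fun q => ∑ j, R j q, ContDiff.sum fun j _ => hR j, fun q hq => ?_⟩
    obtain ⟨z, η, l, ζ⟩ := q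
    have hexp : ∀ y, g (z, η • y) = g (z, 0) + η • ∑ j, c j y • L (z, η • y) (b j) := by
      intro y
      rw [hgL, map_smul]
      conv_lhs => rw [hbc y]
      simp only [map_sum, map_smul]
      rw [← hbc y]
    have h0 : ∑ α ∈ Finset.piAntidiag Finset.univ k, lagrange k α l •
        (∏ r, φ r (∑ i, ((α i : ℝ) / k) • ζ i)) • g (z, 0)
        = (∏ r, φ r (∑ i, l i • ζ i)) • g (z, 0) := by
      have := sum_lagrange_mul_prod_linear hk (Finset.univ : Finset (Fin n)) (by simp; omega)
        (fun r i => φ r (ζ i)) hq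
      simp only [smul_smul]
      rw [← Finset.sum_smul]
      congr 1
      simpa [map_sum, map_smul] using this
    have key : interpError k φ g (z, η, l, ζ)
        = η • ∑ j, interpError k (Fin.cons (c j) φ) (fun p : Z × Y => L p (b j)) (z, η, l, ζ) := by
      simp only [interpError, Finset.sum_sub_distrib, smul_sub]
      rw [Finset.sum_comm]
      simp only [hexp, smul_add, Finset.sum_add_distrib]
      rw [h0, add_sub_add_left_eq_sub]
      simp only [Finset.smul_sum, Fin.prod_univ_succ, Fin.cons_zero, Fin.cons_succ, smul_smul]
      congr 1
      · refine Finset.sum_congr rfl fun α _ => Finset.sum_congr rfl fun j _ => ?_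
        congr 1; ring
      · refine Finset.sum_congr rfl fun j _ => ?_
        congr 1; ring
    rw [key, pow_succ', mul_smul, Finset.smul_sum, Finset.smul_sum, Finset.smul_sum]
    exact Finset.sum_congr rfl fun j _ => by rw [hRe j _ hq]

/-- The Lagrange interpolation error on a simplex of size `η` is `η ^ (k + 1)` times a function
which is smooth in all parameters. -/
theorem exists_interpolation_error {k : ℕ} (hk : k ≠ 0) {g : Z × Y → V} (hg : ContDiff ℝ ∞ g) :
    ∃ R : Z × ℝ × (Fin (m + 1) → ℝ) × (Fin (m + 1) → Y) → V, ContDiff ℝ ∞ R ∧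
      ∀ z η l ζ, ∑ i, l i = 1 →
        ∑ α ∈ Finset.piAntidiag Finset.univ k, lagrange k α l •
          g (z, η • ∑ i, ((α i : ℝ) / k) • ζ i)
        = g (z, η • ∑ i, l i • ζ i) + η ^ (k + 1) • R (z, η, l, ζ) := by
  obtain ⟨R, hR, h⟩ := exists_interpError_eq (m := m) hk (k + 1) 0 (by omega) Fin.elim0 g hg
  refine ⟨R, hR, fun z η l ζ hl => ?_⟩
  rw [← h (z, η, l, ζ) hl]
  simp [interpError]

/-- Second order Taylor expansion with a remainder which is smooth in all parameters. -/
theorem exists_taylor_two {g : Z × Y → V} (hg : ContDiff ℝ ∞ g) :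
    ∃ R : Z × ℝ × Y → V, ContDiff ℝ ∞ R ∧ ∀ z (η : ℝ) y,
      g (z, η • y) = g (z, 0) + η • fderiv ℝ g (z, 0) (0, y) + η ^ 2 • R (z, η, y) := by
  obtain ⟨L, hL, hgL⟩ := exists_contDiff_hadamard hg
  obtain ⟨N, hN, hLN⟩ := exists_contDiff_hadamard hL
  have hd : ∀ z y, fderiv ℝ g (z, 0) (0, y) = L (z, 0) y := by
    intro z y
    have h1 : HasFDerivAt g (fderiv ℝ g (z, 0)) (z, 0) :=
      (hg.differentiable (by simp) _).hasFDerivAt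
    have h2 := h1.comp (0 : Y) (hasFDerivAt_prodMk_right z (0 : Y))
    have h3 : HasFDerivAt (fun y => g (z, 0) + L (z, y) y) (L (z, 0)) (0 : Y) := by
      have h4 : HasFDerivAt (fun y => L (z, y)) (fderiv ℝ (fun y => L (z, y)) 0) (0 : Y) :=
        ((hL.comp (by fun_prop : ContDiff ℝ ∞ fun y : Y => (z, y))).differentiable (by simp)
          _).hasFDerivAt
      have h5 := (h4.clm_apply (hasFDerivAt_id (0 : Y))).const_add (g (z, 0))
      refine h5.congr_fderiv ?_
      ext; simp
    have h6 : (g ∘ fun y => (z, y)) = fun y => g (z, 0) + L (z, y) y := funext fun y => hgL z y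
    rw [h6] at h2
    have := congrArg (fun T : Y →L[ℝ] V => T y) (h2.unique h3)
    simpa using this
  refine ⟨fun p => N (p.1, p.2.1 • p.2.2) p.2.2 p.2.2, ?_, fun z η y => ?_⟩
  · exact ((hN.comp (by fun_prop)).clm_apply (by fun_prop)).clm_apply (by fun_prop)
  · rw [hgL, hLN, hd]
    simp [pow_two, mul_smul, add_assoc]

end Interpolation

/-! ### The flow is bi-Lipschitz on the initial surface -/


section Flow

variable {m : ℕ} {T : ℝ}

theorem isCompact_surface (Γ : EvolvingSurface m T) (t : ℝ) : IsCompact (Γ.surface t) :=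
  Γ.isCompact_initial.image (Γ.contDiff_flow.continuous.comp (by fun_prop : Continuous fun x => (t, x)))

/-- The flow does not contract distances on the initial surface by more than a constant factor:
Gronwall's inequality, backwards in time. -/
theorem exists_dist_le_mul_dist_flow (Γ : EvolvingSurface m T) :
    ∃ C > 0, ∀ t ∈ Icc 0 T, ∀ x ∈ Γ.initial, ∀ y ∈ Γ.initial,
      dist x y ≤ C * dist (Γ.flow t x) (Γ.flow t y) := by
  have hcomp : IsCompact ((fun q : ℝ × Euc (m + 1) => Γ.flow q.1 q.2) '' (Icc 0 T ×ˢ Γ.initial)) :=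
    (isCompact_Icc.prod Γ.isCompact_initial).image Γ.contDiff_flow.continuous
  -- all trajectories stay in a ball, on which the velocity is Lipschitz
  obtain ⟨R, hR⟩ := hcomp.isBounded.subset_closedBall 0
  have hvd : ∀ t, ContDiff ℝ ∞ (Γ.velocity t) := fun t =>
    Γ.contDiff_velocity.comp (by fun_prop : ContDiff ℝ ∞ fun x : Euc (m + 1) => (t, x))
  have hcont : Continuous fun q : ℝ × Euc (m + 1) =>
      (fderiv ℝ (fun q : ℝ × Euc (m + 1) => Γ.velocity q.1 q.2) q).comp
        (ContinuousLinearMap.inr ℝ ℝ (Euc (m + 1))) :=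
    (Γ.contDiff_velocity.continuous_fderiv (by simp)).clm_comp continuous_const
  have hfd : ∀ t x, fderiv ℝ (Γ.velocity t) x =
      (fderiv ℝ (fun q : ℝ × Euc (m + 1) => Γ.velocity q.1 q.2) (t, x)).comp
        (ContinuousLinearMap.inr ℝ ℝ (Euc (m + 1))) := by
    intro t x
    have h1 : HasFDerivAt (fun q : ℝ × Euc (m + 1) => Γ.velocity q.1 q.2)
        (fderiv ℝ (fun q : ℝ × Euc (m + 1) => Γ.velocity q.1 q.2) (t, x)) (t, x) :=
      (Γ.contDiff_velocity.differentiable (by simp) _).hasFDerivAt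
    exact (h1.comp x (hasFDerivAt_prodMk_right t x)).fderiv
  obtain ⟨K, hK⟩ := ((isCompact_Icc (a := (0 : ℝ)) (b := T)).prod
    (isCompact_closedBall (0 : Euc (m + 1)) R)).exists_bound_of_continuousOn hcont.continuousOn
  have hlip : ∀ t ∈ Icc 0 T, LipschitzOnWith K.toNNReal (Γ.velocity t) (Metric.closedBall 0 R) := by
    intro t ht
    refine Convex.lipschitzOnWith_of_nnnorm_fderiv_le (𝕜 := ℝ)
      (fun x _ => (hvd t).differentiable (by simp) x) (fun x hx => ?_) (convex_closedBall _ _)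
    rw [← NNReal.coe_le_coe, coe_nnnorm, hfd]
    exact (hK (t, x) ⟨ht, hx⟩).trans (Real.le_coe_toNNReal K)
  refine ⟨Real.exp (K.toNNReal * T), Real.exp_pos _, fun t ht x hx y hy => ?_⟩
  have hfl : ∀ x, Continuous fun s => Γ.flow (t - s) x := fun x =>
    Γ.contDiff_flow.continuous.comp (by fun_prop : Continuous fun s => (t - s, x))
  have hder : ∀ x ∈ Γ.initial, ∀ s ∈ Ico 0 t, HasDerivWithinAt (fun s => Γ.flow (t - s) x)
      (-Γ.velocity (t - s) (Γ.flow (t - s) x)) (Ici s) s := by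
    intro x hx s hs
    have hts : t - s ∈ Icc 0 T := ⟨by linarith [hs.2], by linarith [hs.1, ht.2]⟩
    have h1 : HasDerivWithinAt (fun s : ℝ => t - s) (-1) (Icc s t) s := by
      simpa using ((hasDerivAt_id s).const_sub t).hasDerivWithinAt
    have h2 := (Γ.hasDerivWithinAt_flow (t - s) hts x hx).scomp s h1 (fun r hr =>
      ⟨by linarith [hr.2], by linarith [hr.1, hs.1, ht.2]⟩)
    rw [neg_one_smul] at h2
    exact h2.mono_of_mem_nhdsWithin (Icc_mem_nhdsGE hs.2)
  have hmem : ∀ x ∈ Γ.initial, ∀ s ∈ Ico 0 t, Γ.flow (t - s) x ∈ Metric.closedBall (0 : Euc (m + 1)) R :=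
    fun x hx s hs => hR ⟨(t - s, x), ⟨⟨by linarith [hs.2], by linarith [hs.1, ht.2]⟩, hx⟩, rfl⟩
  -- the reversed trajectories `s ↦ flow (t - s)` solve the equation with velocity `-v`
  have := dist_le_of_trajectories_ODE_of_mem (v := fun s z => -Γ.velocity (t - s) z)
    (s := fun _ => Metric.closedBall 0 R) (K := K.toNNReal) (a := 0) (b := t)
    (f := fun s => Γ.flow (t - s) x) (g := fun s => Γ.flow (t - s) y)
    (δ := dist (Γ.flow t x) (Γ.flow t y))
    (fun s hs => by
      have h := hlip (t - s) ⟨by linarith [hs.2], by linarith [hs.1, ht.2]⟩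
      intro a ha b hb
      rw [edist_neg_neg]
      exact h ha hb)
    (hfl x).continuousOn (hder x hx) (hmem x hx) (hfl y).continuousOn (hder y hy) (hmem y hy)
    (by simp) t ⟨ht.1, le_rfl⟩
  simp only [sub_self, sub_zero, Γ.flow_zero x hx, Γ.flow_zero y hy] at this
  rw [mul_comm]
  refine this.trans (mul_le_mul_of_nonneg_left ?_ dist_nonneg)
  exact Real.exp_le_exp.2 (mul_le_mul_of_nonneg_left ht.2 (by positivity))

/-- A Lipschitz bound along curves passes to their velocities. -/
theorem norm_deriv_le_mul_of_dist_le {V W : Type*} [NormedAddCommGroup V] [NormedSpace ℝ V]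
    [NormedAddCommGroup W] [NormedSpace ℝ W] {f : ℝ → V} {g : ℝ → W} {f' : V} {g' : W} {C : ℝ}
    (hf : HasDerivAt f f' 0) (hg : HasDerivAt g g' 0)
    (h : ∀ᶠ s in 𝓝 0, dist (f s) (f 0) ≤ C * dist (g s) (g 0)) : ‖f'‖ ≤ C * ‖g'‖ := by
  have h1 := (hasDerivAt_iff_tendsto_slope.1 hf).norm
  have h2 := ((hasDerivAt_iff_tendsto_slope.1 hg).norm).const_mul C
  refine le_of_tendsto_of_tendsto h1 h2 ?_
  filter_upwards [nhdsWithin_le_nhds h] with s hs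
  simp only [slope, vsub_eq_sub, sub_zero, norm_smul]
  rw [dist_eq_norm, dist_eq_norm] at hs
  calc ‖s⁻¹‖ * ‖f s - f 0‖ ≤ ‖s⁻¹‖ * (C * ‖g s - g 0‖) := by gcongr
    _ = _ := by ring

/-- Every vector in the kernel of the derivative of a defining function is the velocity of a curve
in the level set. -/
theorem exists_curve_in_level_set {n : ℕ} {f : Euc n → ℝ} (hf : ContDiff ℝ ∞ f) {z : Euc n}
    (hz : fderiv ℝ f z ≠ 0) {w : Euc n} (hw : fderiv ℝ f z w = 0) :
    ∃ γ : ℝ → Euc n, γ 0 = z ∧ HasDerivAt γ w 0 ∧ ∀ᶠ s in 𝓝 0, f (γ s) = f z := by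
  have hs : HasStrictFDerivAt f (fderiv ℝ f z) z := hf.contDiffAt.hasStrictFDerivAt (by simp)
  have hr : ((fderiv ℝ f z : Euc n →L[ℝ] ℝ) : Euc n →ₗ[ℝ] ℝ).range = ⊤ := by
    rw [LinearMap.range_eq_top]
    refine LinearMap.surjective ?_
    intro h
    exact hz (ContinuousLinearMap.coe_injective h)
  let w' : ((fderiv ℝ f z : Euc n →L[ℝ] ℝ) : Euc n →ₗ[ℝ] ℝ).ker := ⟨w, hw⟩
  have hlin : HasDerivAt (fun s : ℝ => s • w') w' 0 := by
    simpa using (hasDerivAt_id (0 : ℝ)).smul_const w'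
  refine ⟨fun s => hs.implicitFunction f _ hr (f z) (s • w'), ?_, ?_, ?_⟩
  · have := hs.implicitFunction_apply_image hr
    simp only [zero_smul]
    exact this
  · have h1 := (hs.to_implicitFunction hr).hasFDerivAt
    rw [← zero_smul ℝ w'] at h1
    have h2 := h1.comp_hasDerivAt (0 : ℝ) hlin
    exact h2
  · have h1 := hs.map_implicitFunction_eq hr
    have h2 : Tendsto (fun s : ℝ => (f z, s • w')) (𝓝 0) (𝓝 (f z, 0)) := by
      have : Continuous fun s : ℝ => (f z, s • w') := by fun_prop
      simpa using this.tendsto 0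
    exact h2.eventually h1

/-- The differential of the flow in the space variables. -/
def flowDeriv (Γ : EvolvingSurface m T) (q : ℝ × Euc (m + 1)) : Euc (m + 1) →L[ℝ] Euc (m + 1) :=
  (fderiv ℝ (fun q : ℝ × Euc (m + 1) => Γ.flow q.1 q.2) q).comp
    (ContinuousLinearMap.inr ℝ ℝ (Euc (m + 1)))

theorem contDiff_flowDeriv (Γ : EvolvingSurface m T) : ContDiff ℝ ∞ (flowDeriv Γ) :=
  (Γ.contDiff_flow.fderiv_right (m := ∞) (by simp)).clm_comp contDiff_const

theorem hasFDerivAt_flow (Γ : EvolvingSurface m T) (t : ℝ) (z : Euc (m + 1)) :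
    HasFDerivAt (Γ.flow t) (flowDeriv Γ (t, z)) z := by
  have h1 : HasFDerivAt (fun q : ℝ × Euc (m + 1) => Γ.flow q.1 q.2)
      (fderiv ℝ (fun q : ℝ × Euc (m + 1) => Γ.flow q.1 q.2) (t, z)) (t, z) :=
    (Γ.contDiff_flow.differentiable (by simp) _).hasFDerivAt
  exact h1.comp z (hasFDerivAt_prodMk_right t z)

/-- The flow is an immersion of the initial surface: its differential is injective on the tangent
space, the kernel of the derivative of a defining function. -/
theorem flowDeriv_injective_on_ker (Γ : EvolvingSurface m T) {t : ℝ} (ht : t ∈ Icc 0 T)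
    {z : Euc (m + 1)} (hz : z ∈ Γ.initial) {U : Set (Euc (m + 1))} (hU : IsOpen U) (hzU : z ∈ U)
    {f : Euc (m + 1) → ℝ} (hf : ContDiff ℝ ∞ f) (hf0 : fderiv ℝ f z ≠ 0)
    (hfU : Γ.initial ∩ U = {y ∈ U | f y = 0}) {w : Euc (m + 1)} (hw : fderiv ℝ f z w = 0)
    (hw0 : flowDeriv Γ (t, z) w = 0) : w = 0 := by
  obtain ⟨C, -, hC⟩ := exists_dist_le_mul_dist_flow Γ
  obtain ⟨γ, hγ0, hγ, hγf⟩ := exists_curve_in_level_set hf hf0 hw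
  have hfz : f z = 0 := (hfU.subset ⟨hz, hzU⟩).2
  have h1 : HasDerivAt (fun s => Γ.flow t (γ s)) (flowDeriv Γ (t, z) w) 0 := by
    have := hasFDerivAt_flow Γ t z
    rw [← hγ0] at this
    have := this.comp_hasDerivAt (0 : ℝ) hγ
    rwa [hγ0] at this
  have h2 := norm_deriv_le_mul_of_dist_le (C := C) hγ h1 ?_
  · rw [hw0, norm_zero, mul_zero] at h2
    exact norm_le_zero_iff.1 h2
  · have hUe : ∀ᶠ s in 𝓝 (0 : ℝ), γ s ∈ U :=
      hγ.continuousAt.eventually (hU.mem_nhds (by rwa [hγ0]))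
    filter_upwards [hγf, hUe] with s hs hsU
    have : γ s ∈ Γ.initial := (hfU.superset ⟨hsU, by simpa [hfz] using hs⟩).1
    rw [hγ0]
    exact hC t ht _ this _ hz

end Flow

/-! ### Smoothness of the closest-point projection in space and time -/


section ClosestPoint

theorem closestPoint_spec {n : ℕ} {S : Set (Euc n)} (hS : IsCompact S) (hne : S.Nonempty)
    (x : Euc n) : closestPoint S x ∈ S ∧ dist x (closestPoint S x) = Metric.infDist x S := by
  obtain ⟨y, hy, h⟩ := hS.exists_infDist_eq_dist hne x
  exact Classical.epsilon_spec (p := fun p => p ∈ S ∧ dist x p = Metric.infDist x S) ⟨y, hy, h.symm⟩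

theorem dist_closestPoint_le {n : ℕ} {S : Set (Euc n)} (hS : IsCompact S) {y : Euc n} (hy : y ∈ S)
    (x : Euc n) : dist x (closestPoint S x) ≤ dist x y :=
  (closestPoint_spec hS ⟨y, hy⟩ x).2.trans_le (Metric.infDist_le_dist_of_mem hy)

theorem closestPoint_eq_self {n : ℕ} {S : Set (Euc n)} (hS : IsCompact S) {y : Euc n} (hy : y ∈ S) :
    closestPoint S y = y := by
  have := dist_closestPoint_le hS hy y
  rw [dist_self] at this
  exact (dist_le_zero.1 this).symm

variable {m : ℕ} {T : ℝ}

/-- The first order conditions for the point of `Γ(t)` closest to `x`, with the unknown `z ∈ Γ(0)`,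
`f z = 0`, and the Lagrange multiplier `c`. The isomorphism `κ` of the dual space with the space
itself makes the map an endomorphism. -/
def criticalMap (Γ : EvolvingSurface m T) (f : Euc (m + 1) → ℝ)
    (κ : (Euc (m + 1) →L[ℝ] ℝ) ≃L[ℝ] Euc (m + 1))
    (q : ℝ × Euc (m + 1) × Euc (m + 1) × ℝ) : ℝ × Euc (m + 1) × Euc (m + 1) × ℝ :=
  (q.1, q.2.1, κ ((innerSL ℝ (Γ.flow q.1 q.2.2.1 - q.2.1)).comp (flowDeriv Γ (q.1, q.2.2.1))
    - q.2.2.2 • fderiv ℝ f q.2.2.1), f q.2.2.1)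

theorem contDiff_criticalMap (Γ : EvolvingSurface m T) {f : Euc (m + 1) → ℝ} (hf : ContDiff ℝ ∞ f)
    (κ : (Euc (m + 1) →L[ℝ] ℝ) ≃L[ℝ] Euc (m + 1)) : ContDiff ℝ ∞ (criticalMap Γ f κ) := by
  have h1 : ContDiff ℝ ∞ fun q : ℝ × Euc (m + 1) × Euc (m + 1) × ℝ => Γ.flow q.1 q.2.2.1 :=
    Γ.contDiff_flow.comp (by fun_prop : ContDiff ℝ ∞ fun q : ℝ × Euc (m + 1) × Euc (m + 1) × ℝ =>
      (q.1, q.2.2.1))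
  have h2 : ContDiff ℝ ∞ fun q : ℝ × Euc (m + 1) × Euc (m + 1) × ℝ =>
      flowDeriv Γ (q.1, q.2.2.1) := (contDiff_flowDeriv Γ).comp (by fun_prop)
  have h3 : ContDiff ℝ ∞ fun q : ℝ × Euc (m + 1) × Euc (m + 1) × ℝ => fderiv ℝ f q.2.2.1 :=
    (hf.fderiv_right (m := ∞) (by simp)).comp (by fun_prop)
  have h4 : ContDiff ℝ ∞ fun q : ℝ × Euc (m + 1) × Euc (m + 1) × ℝ =>
      innerSL ℝ (Γ.flow q.1 q.2.2.1 - q.2.1) :=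
    (innerSL ℝ (E := Euc (m + 1))).contDiff.comp (h1.sub (by fun_prop))
  have h5 : ContDiff ℝ ∞ fun q : ℝ × Euc (m + 1) × Euc (m + 1) × ℝ => f q.2.2.1 :=
    hf.comp (by fun_prop)
  unfold criticalMap
  exact contDiff_fst.prodMk ((contDiff_fst.comp contDiff_snd).prodMk
    ((κ.contDiff.comp ((h4.clm_comp h2).sub
      ((by fun_prop : ContDiff ℝ ∞ fun q : ℝ × Euc (m + 1) × Euc (m + 1) × ℝ => q.2.2.2).smul h3))
      ).prodMk h5))

/-- The first order conditions are nondegenerate at the points of the surface, so that the implicit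
function theorem applies. -/
theorem fderiv_criticalMap_injective (Γ : EvolvingSurface m T) {t : ℝ} (ht : t ∈ Icc 0 T)
    {z : Euc (m + 1)} (hz : z ∈ Γ.initial) {U : Set (Euc (m + 1))} (hU : IsOpen U) (hzU : z ∈ U)
    {f : Euc (m + 1) → ℝ} (hf : ContDiff ℝ ∞ f) (hf0 : fderiv ℝ f z ≠ 0)
    (hfU : Γ.initial ∩ U = {y ∈ U | f y = 0}) (κ : (Euc (m + 1) →L[ℝ] ℝ) ≃L[ℝ] Euc (m + 1)) :
    Function.Injective (fderiv ℝ (criticalMap Γ f κ) (t, Γ.flow t z, z, 0)) := by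
  rw [injective_iff_map_eq_zero]
  rintro ⟨a, b, c, d⟩ h
  have hd : HasFDerivAt (criticalMap Γ f κ) _ (t, Γ.flow t z, z, 0) :=
    ((contDiff_criticalMap Γ hf κ).differentiable (by simp) _).hasFDerivAt
  have hline : HasDerivAt (fun s : ℝ => (t, Γ.flow t z, z, (0 : ℝ)) + s • (a, b, c, d)) (a, b, c, d) 0 := by
    simpa using ((hasDerivAt_id (0 : ℝ)).smul_const (a, b, c, d)).const_add (t, Γ.flow t z, z, (0 : ℝ))
  have hd0 : HasDerivAt (fun s : ℝ => criticalMap Γ f κ ((t, Γ.flow t z, z, (0 : ℝ)) + s • (a, b, c, d)))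
      0 0 := by
    have hd' : HasFDerivAt (criticalMap Γ f κ)
        (fderiv ℝ (criticalMap Γ f κ) (t, Γ.flow t z, z, 0))
        ((t, Γ.flow t z, z, (0 : ℝ)) + (0 : ℝ) • (a, b, c, d)) := by simpa using hd
    rw [← h]
    exact hd'.comp_hasDerivAt (0 : ℝ) hline
  -- the components of the derivative along the line in the direction `(a, b, c, d)` vanish
  have ha : a = 0 := by
    have h1 := (ContinuousLinearMap.fst ℝ ℝ _).hasFDerivAt.comp_hasDerivAt (0 : ℝ) hd0
    have h2 := (ContinuousLinearMap.fst ℝ ℝ _).hasFDerivAt.comp_hasDerivAt (0 : ℝ) hline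
    exact h2.unique h1
  have hb : b = 0 := by
    have h1 := ((ContinuousLinearMap.fst ℝ (Euc (m + 1)) _).comp
      (ContinuousLinearMap.snd ℝ ℝ _)).hasFDerivAt.comp_hasDerivAt (0 : ℝ) hd0
    have h2 := ((ContinuousLinearMap.fst ℝ (Euc (m + 1)) _).comp
      (ContinuousLinearMap.snd ℝ ℝ _)).hasFDerivAt.comp_hasDerivAt (0 : ℝ) hline
    exact h2.unique h1
  subst ha hb
  have hzl : HasDerivAt (fun s : ℝ => z + s • c) c 0 := by
    simpa using ((hasDerivAt_id (0 : ℝ)).smul_const c).const_add z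
  have hfc : fderiv ℝ f z c = 0 := by
    have h1 := ((ContinuousLinearMap.snd ℝ (Euc (m + 1)) ℝ).comp
      ((ContinuousLinearMap.snd ℝ (Euc (m + 1)) _).comp
        (ContinuousLinearMap.snd ℝ ℝ _))).hasFDerivAt.comp_hasDerivAt (0 : ℝ) hd0
    have h2 : HasFDerivAt f (fderiv ℝ f z) (z + (0 : ℝ) • c) := by
      simpa using (hf.differentiable (by simp) z).hasFDerivAt
    have h3 := h2.comp_hasDerivAt (0 : ℝ) hzl
    exact h3.unique h1
  have hcrit : ∀ w, inner ℝ (flowDeriv Γ (t, z) c) (flowDeriv Γ (t, z) w) - d * fderiv ℝ f z w = 0 := by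
    intro w
    have h1 := ((ContinuousLinearMap.fst ℝ (Euc (m + 1)) ℝ).comp
      ((ContinuousLinearMap.snd ℝ (Euc (m + 1)) _).comp
        (ContinuousLinearMap.snd ℝ ℝ _))).hasFDerivAt.comp_hasDerivAt (0 : ℝ) hd0
    have h2 := (κ.symm : Euc (m + 1) →L[ℝ] (Euc (m + 1) →L[ℝ] ℝ)).hasFDerivAt.comp_hasDerivAt (0 : ℝ) h1
    have h3 := (ContinuousLinearMap.apply ℝ ℝ w).hasFDerivAt.comp_hasDerivAt (0 : ℝ) h2
    have e : (fun s : ℝ => κ.symm (criticalMap Γ f κ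
        ((t, Γ.flow t z, z, (0 : ℝ)) + s • (0, 0, c, d))).2.2.1 w) =
        fun s : ℝ => inner ℝ (Γ.flow t (z + s • c) - Γ.flow t z) (flowDeriv Γ (t, z + s • c) w)
          - (s * d) * fderiv ℝ f (z + s • c) w := by
      funext s
      simp [criticalMap, inner_sub_left]
    replace h3 : HasDerivAt (fun s : ℝ => κ.symm (criticalMap Γ f κ
        ((t, Γ.flow t z, z, (0 : ℝ)) + s • (0, 0, c, d))).2.2.1 w) 0 0 := by
      simpa using! h3
    rw [e] at h3
    have h4 : HasDerivAt (fun s : ℝ => Γ.flow t (z + s • c) - Γ.flow t z) (flowDeriv Γ (t, z) c) 0 := by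
      have := hasFDerivAt_flow Γ t (z + (0 : ℝ) • c)
      have := (this.comp_hasDerivAt (0 : ℝ) hzl).sub_const (Γ.flow t z)
      simpa using! this
    have h5 : DifferentiableAt ℝ (fun s : ℝ => flowDeriv Γ (t, z + s • c) w) 0 := by
      have : ContDiff ℝ ∞ (fun s : ℝ => flowDeriv Γ (t, z + s • c) w) :=
        ((contDiff_flowDeriv Γ).comp (by fun_prop : ContDiff ℝ ∞ fun s : ℝ => (t, z + s • c))).clm_apply
          contDiff_const
      exact this.differentiable (by simp) _
    have h6 : DifferentiableAt ℝ (fun s : ℝ => fderiv ℝ f (z + s • c) w) 0 := by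
      have : ContDiff ℝ ∞ (fun s : ℝ => fderiv ℝ f (z + s • c) w) :=
        ((hf.fderiv_right (m := ∞) (by simp)).comp (by fun_prop : ContDiff ℝ ∞ fun s : ℝ => z + s • c)).clm_apply
          contDiff_const
      exact this.differentiable (by simp) _
    have h7 : HasDerivAt (fun s : ℝ => s * d) d 0 := by
      simpa using (hasDerivAt_id (0 : ℝ)).mul_const d
    have h8 := (h4.inner ℝ h5.hasDerivAt).sub (h7.mul h6.hasDerivAt)
    have := h8.unique h3
    simpa using this
  -- `c` is tangential and `flowDeriv c` is orthogonal to itself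
  have hc : c = 0 := by
    refine flowDeriv_injective_on_ker Γ ht hz hU hzU hf hf0 hfU hfc ?_
    have := hcrit c
    rw [hfc, mul_zero, sub_zero] at this
    exact inner_self_eq_zero.1 this
  subst hc
  have hd' : d = 0 := by
    by_contra hne
    refine hf0 (ContinuousLinearMap.ext fun w => ?_)
    have := hcrit w
    simpa [hne] using this
  rw [hd']
  rfl

theorem exists_dual_equiv (n : ℕ) : Nonempty ((Euc n →L[ℝ] ℝ) ≃L[ℝ] Euc n) := by
  refine FiniteDimensional.nonempty_continuousLinearEquiv_iff_finrank_eq.2 ?_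
  exact (LinearMap.toContinuousLinearMap (𝕜 := ℝ) (E := Euc n) (F' := ℝ)).finrank_eq.symm.trans
    Subspace.dual_finrank_eq

/-- A closest point satisfies the first order conditions. -/
theorem exists_multiplier (Γ : EvolvingSurface m T) {t : ℝ} {x z : Euc (m + 1)}
    (hz : z ∈ Γ.initial) (hmin : ∀ y ∈ Γ.initial, dist x (Γ.flow t z) ≤ dist x (Γ.flow t y))
    {U : Set (Euc (m + 1))} (hU : IsOpen U) (hzU : z ∈ U)
    {f : Euc (m + 1) → ℝ} (hf : ContDiff ℝ ∞ f) (hf0 : fderiv ℝ f z ≠ 0)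
    (hfU : Γ.initial ∩ U = {y ∈ U | f y = 0}) :
    ∃ c : ℝ, (innerSL ℝ (Γ.flow t z - x)).comp (flowDeriv Γ (t, z)) = c • fderiv ℝ f z := by
  have hfz : f z = 0 := (hfU.subset ⟨hz, hzU⟩).2
  have hφ : HasStrictFDerivAt (fun y => ‖Γ.flow t y - x‖ ^ 2)
      (2 • (innerSL ℝ (Γ.flow t z - x)).comp (flowDeriv Γ (t, z))) z := by
    have h1 : HasStrictFDerivAt (Γ.flow t) (flowDeriv Γ (t, z)) z := by
      have : ContDiff ℝ ∞ (Γ.flow t) :=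
        Γ.contDiff_flow.comp (by fun_prop : ContDiff ℝ ∞ fun x : Euc (m + 1) => (t, x))
      rw [← (hasFDerivAt_flow Γ t z).fderiv]
      exact this.contDiffAt.hasStrictFDerivAt (by simp)
    have h2 := (h1.sub_const x).inner ℝ (h1.sub_const x)
    simp only [real_inner_self_eq_norm_sq] at h2
    refine h2.congr_fderiv ?_
    ext w
    simp [fderivInnerCLM_apply, real_inner_comm, two_mul, inner_sub_left]
  have hext : IsLocalExtrOn (fun y => ‖Γ.flow t y - x‖ ^ 2) {y | f y = f z} z := by
    left
    have : ∀ᶠ y in 𝓝[{y | f y = f z}] z, y ∈ U := nhdsWithin_le_nhds (hU.mem_nhds hzU)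
    filter_upwards [this, self_mem_nhdsWithin] with y hyU hy
    have hyf : f y = 0 := hfz ▸ hy
    have := hmin y (hfU.superset ⟨hyU, hyf⟩).1
    rw [dist_comm, dist_eq_norm, dist_comm, dist_eq_norm] at this
    gcongr
  obtain ⟨a, b, hab, h⟩ := hext.exists_multipliers_of_hasStrictFDerivAt_1d
    (hf.contDiffAt.hasStrictFDerivAt (by simp)) hφ
  have hb : b ≠ 0 := by
    rintro rfl
    have ha : a ≠ 0 := by rintro rfl; exact hab rfl
    rw [zero_smul, add_zero] at h
    exact hf0 ((smul_eq_zero.1 h).resolve_left ha)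
  refine ⟨-(a / (2 * b)), ?_⟩
  ext w
  have hw := congrArg (fun φ : Euc (m + 1) →L[ℝ] ℝ => φ w) h
  have hw' : a * fderiv ℝ f z w + b * (2 * inner ℝ (Γ.flow t z - x) (flowDeriv Γ (t, z) w)) = 0 := by
    simpa [inner_sub_left] using hw
  have : inner ℝ (Γ.flow t z - x) (flowDeriv Γ (t, z) w) = -(a / (2 * b)) * fderiv ℝ f z w := by
    field_simp
    linarith
  simpa [inner_sub_left] using this

end ClosestPoint

section Tube

variable {m : ℕ} {T : ℝ}

/-- Near every point of the space-time surface the closest-point projection is the restriction to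
`[0, T]` of a smooth function of space and time: by the inverse function theorem the first order
conditions have a unique solution close to that point. -/
theorem exists_local_closestPoint (Γ : EvolvingSurface m T) {t₀ : ℝ} (ht₀ : t₀ ∈ Icc 0 T)
    {z₀ : Euc (m + 1)} (hz₀ : z₀ ∈ Γ.initial) :
    ∃ G : ℝ × Euc (m + 1) → Euc (m + 1), ∃ N ∈ 𝓝 (t₀, Γ.flow t₀ z₀), ContDiffOn ℝ ∞ G N ∧
      ∀ q ∈ N, q.1 ∈ Icc 0 T → closestPoint (Γ.surface q.1) q.2 = G q := by
  obtain ⟨U, hU, hzU, f, hf, hfU0, hfU⟩ := Γ.isSmoothHypersurface_initial z₀ hz₀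
  obtain ⟨κ⟩ := exists_dual_equiv (m + 1)
  obtain ⟨C, hC0, hC⟩ := exists_dist_le_mul_dist_flow Γ
  set p₀ : ℝ × Euc (m + 1) × Euc (m + 1) × ℝ := (t₀, Γ.flow t₀ z₀, z₀, 0) with hp₀
  have hΘ := contDiff_criticalMap Γ hf κ
  have hinj := fderiv_criticalMap_injective Γ ht₀ hz₀ hU hzU hf (hfU0 z₀ hzU) hfU κ
  let e : (ℝ × Euc (m + 1) × Euc (m + 1) × ℝ) ≃L[ℝ] (ℝ × Euc (m + 1) × Euc (m + 1) × ℝ) :=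
    (LinearEquiv.ofInjectiveEndo _ hinj).toContinuousLinearEquiv
  have he : (e : _ →L[ℝ] _) = fderiv ℝ (criticalMap Γ f κ) p₀ := by
    exact ContinuousLinearMap.ext fun v => rfl
  have hd : HasFDerivAt (criticalMap Γ f κ)
      (e : (ℝ × Euc (m + 1) × Euc (m + 1) × ℝ) →L[ℝ] (ℝ × Euc (m + 1) × Euc (m + 1) × ℝ)) p₀ :=
    he ▸ (hΘ.differentiable (by simp) p₀).hasFDerivAt
  -- the local inverse of the first order conditions
  let H := hΘ.contDiffAt.toOpenPartialHomeomorph (criticalMap Γ f κ) hd (by simp)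
  have hHc : (H : _ → _) = criticalMap Γ f κ := rfl
  have hp₀s : p₀ ∈ H.source := hΘ.contDiffAt.mem_toOpenPartialHomeomorph_source hd (by simp)
  have hfz₀ : f z₀ = 0 := (hfU.subset ⟨hz₀, hzU⟩).2
  have hΘp₀ : H p₀ = (t₀, Γ.flow t₀ z₀, 0, 0) := by
    rw [hHc]; simp [criticalMap, hp₀, hfz₀]
  let ι : ℝ × Euc (m + 1) → ℝ × Euc (m + 1) × Euc (m + 1) × ℝ := fun q => (q.1, q.2, 0, 0)
  have hι : ContDiff ℝ ∞ ι := by fun_prop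
  have hιp : ι (t₀, Γ.flow t₀ z₀) = H p₀ := hΘp₀.symm
  have htgt : ∀ᶠ q in 𝓝 (t₀, Γ.flow t₀ z₀), ι q ∈ H.target := by
    refine hι.continuous.continuousAt.eventually (H.open_target.mem_nhds ?_)
    rw [hιp]; exact H.map_source hp₀s
  have hequiv : ∀ᶠ q in 𝓝 (t₀, Γ.flow t₀ z₀),
      fderiv ℝ (criticalMap Γ f κ) (H.symm (ι q)) ∈ range (ContinuousLinearEquiv.toContinuousLinearMap
        : ((ℝ × Euc (m + 1) × Euc (m + 1) × ℝ) ≃L[ℝ] (ℝ × Euc (m + 1) × Euc (m + 1) × ℝ)) → _) := by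
    have hc : ContinuousAt (fun q => fderiv ℝ (criticalMap Γ f κ) (H.symm (ι q)))
        (t₀, Γ.flow t₀ z₀) := by
      refine (hΘ.continuous_fderiv (by simp)).continuousAt.comp ?_
      refine ContinuousAt.comp (g := H.symm) ?_ hι.continuous.continuousAt
      rw [hιp]
      exact H.continuousAt_symm (H.map_source hp₀s)
    refine hc.eventually ?_
    have : fderiv ℝ (criticalMap Γ f κ) (H.symm (ι (t₀, Γ.flow t₀ z₀))) = e := by
      rw [hιp, H.left_inv hp₀s, he]
    change ∀ᶠ y in 𝓝 (fderiv ℝ (criticalMap Γ f κ) (H.symm (ι (t₀, Γ.flow t₀ z₀)))), _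
    rw [this]
    exact e.nhds
  -- Bounds on a neighbourhood of `(t₀, z₀)`, which make the multiplier of a close point small.
  have hm₀ : 0 < ‖fderiv ℝ f z₀‖ := norm_pos_iff.2 (hfU0 z₀ hzU)
  have hcont1 : Continuous fun z => ‖fderiv ℝ f z‖ := (hf.continuous_fderiv (by simp)).norm
  have hcont2 : Continuous fun q => ‖flowDeriv Γ q‖ := (contDiff_flowDeriv Γ).continuous.norm
  have hnb : ∀ᶠ q in 𝓝 (t₀, z₀), q.2 ∈ U ∧ ‖fderiv ℝ f z₀‖ / 2 < ‖fderiv ℝ f q.2‖ ∧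
      ‖flowDeriv Γ q‖ < ‖flowDeriv Γ (t₀, z₀)‖ + 1 := by
    refine (continuous_snd.continuousAt.eventually (hU.mem_nhds hzU)).and
      (((hcont1.comp continuous_snd).continuousAt.eventually (lt_mem_nhds ?_)).and
        (hcont2.continuousAt.eventually (gt_mem_nhds ?_)))
    · exact half_lt_self hm₀
    · exact lt_add_one _
  obtain ⟨ρ, hρ, hρb⟩ := Metric.eventually_nhds_iff.1 hnb
  obtain ⟨r, hr, hrb⟩ := Metric.isOpen_iff.1 H.open_source p₀ hp₀s
  let M : ℝ := (‖flowDeriv Γ (t₀, z₀)‖ + 1) / (‖fderiv ℝ f z₀‖ / 2)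
  have hM : 0 < M := by positivity
  have hsmall : ∀ᶠ q : ℝ × Euc (m + 1) in 𝓝 (t₀, Γ.flow t₀ z₀),
      dist q.2 (Γ.flow q.1 z₀) * (2 * C) < min ρ r ∧ dist q.2 (Γ.flow q.1 z₀) * M < r ∧
        dist q (t₀, Γ.flow t₀ z₀) < min ρ r := by
    have hc : Continuous fun q : ℝ × Euc (m + 1) => dist q.2 (Γ.flow q.1 z₀) := by
      have : Continuous fun q : ℝ × Euc (m + 1) => Γ.flow q.1 z₀ :=
        Γ.contDiff_flow.continuous.comp (by fun_prop : Continuous fun q : ℝ × Euc (m + 1) => (q.1, z₀))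
      fun_prop
    refine ((hc.mul continuous_const).continuousAt.eventually (gt_mem_nhds ?_)).and
      (((hc.mul continuous_const).continuousAt.eventually (gt_mem_nhds ?_)).and
        (Metric.ball_mem_nhds _ (lt_min hρ hr)))
    · simp [hρ, hr]
    · simp [hr]
  refine ⟨fun q => Γ.flow q.1 (H.symm (ι q)).2.2.1, _, htgt.and (hequiv.and hsmall), ?_, ?_⟩
  · rintro q ⟨hq1, ⟨e', he'⟩, -⟩
    have h1 : ContDiffAt ℝ ∞ H.symm (ι q) := by
      refine H.contDiffAt_symm (f₀' := e') hq1 ?_ hΘ.contDiffAt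
      rw [he']
      exact (hΘ.differentiable (by simp) _).hasFDerivAt
    have h2 : ContDiffAt ℝ ∞ (fun q => H.symm (ι q)) q := h1.comp q hι.contDiffAt
    exact (Γ.contDiff_flow.contDiffAt.comp q (contDiffAt_fst.prodMk h2.snd.snd.fst)).contDiffWithinAt
  · rintro ⟨t, x⟩ ⟨hq1, -, hq2, hq3, hq4⟩ ht
    simp only at ht hq2 hq3 ⊢
    have hzs : Γ.flow t z₀ ∈ Γ.surface t := ⟨z₀, hz₀, rfl⟩
    have hcp := dist_closestPoint_le (isCompact_surface Γ t) hzs x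
    have hmin := fun y hy => dist_closestPoint_le (isCompact_surface Γ t) (y := y) hy x
    obtain ⟨z, hz, hzc⟩ := (closestPoint_spec (isCompact_surface Γ t) ⟨_, hzs⟩ x).1
    rw [← hzc] at hcp hmin ⊢
    -- the closest point and its multiplier lie in the domain of the local inverse, hence are given by it
    have hzz : dist z z₀ < min ρ r := by
      have h1 := hC t ht z hz z₀ hz₀
      have h2 : dist (Γ.flow t z) (Γ.flow t z₀) ≤ 2 * dist x (Γ.flow t z₀) := by
        have := dist_triangle (Γ.flow t z) x (Γ.flow t z₀)
        rw [dist_comm _ x] at this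
        linarith
      have h3 := mul_le_mul_of_nonneg_left h2 hC0.le
      linarith
    have htx : dist t t₀ < min ρ r ∧ dist x (Γ.flow t₀ z₀) < min ρ r :=
      max_lt_iff.1 (by simpa [Prod.dist_eq] using hq4)
    obtain ⟨hz1, hz2, hz3⟩ := hρb (y := (t, z))
      (max_lt (htx.1.trans_le (min_le_left _ _)) (hzz.trans_le (min_le_left _ _)))
    simp only at hz1 hz2 hz3
    obtain ⟨c, hc⟩ := exists_multiplier Γ hz (fun y hy => hmin _ ⟨y, hy, rfl⟩) hU hz1 hf
      (hfU0 z hz1) hfU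
    have hcr : |c| < r := by
      have h1 : |c| * ‖fderiv ℝ f z‖ ≤ dist x (Γ.flow t z₀) * (‖flowDeriv Γ (t₀, z₀)‖ + 1) := by
        rw [← Real.norm_eq_abs, ← norm_smul, ← hc]
        refine (ContinuousLinearMap.opNorm_comp_le _ _).trans ?_
        refine mul_le_mul ?_ hz3.le (norm_nonneg _) dist_nonneg
        rw [innerSL_apply_norm, ← dist_eq_norm, dist_comm]
        exact hcp
      have h2 : |c| ≤ dist x (Γ.flow t z₀) * M := by
        simp only [M]
        rw [← mul_div_assoc, le_div_iff₀ (by positivity)]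
        exact (mul_le_mul_of_nonneg_left hz2.le (abs_nonneg c)).trans h1
      exact h2.trans_lt hq3
    have hsrc : (t, x, z, c) ∈ H.source := by
      refine hrb ?_
      simp only [Metric.mem_ball, Prod.dist_eq, hp₀]
      refine max_lt (htx.1.trans_le (min_le_right _ _)) (max_lt (htx.2.trans_le (min_le_right _ _))
        (max_lt (hzz.trans_le (min_le_right _ _)) ?_))
      simpa [Real.dist_eq] using hcr
    have hH : H (t, x, z, c) = ι (t, x) := by
      rw [hHc]
      have hfz : f z = 0 := (hfU.subset ⟨hz, hz1⟩).2
      simp only [criticalMap, hc, sub_self, map_zero, hfz, ι]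
    rw [← hH, H.left_inv hsrc]

/-- The closest-point projection of a tubular neighbourhood of the space-time surface extends to a
smooth function of space and time. -/
theorem exists_contDiff_closestPoint (Γ : EvolvingSurface m T) :
    ∃ δ > 0, ∃ p : ℝ × Euc (m + 1) → Euc (m + 1), ContDiff ℝ ∞ p ∧
      ∀ t ∈ Icc 0 T, ∀ x, ∀ y ∈ Γ.surface t, dist x y < δ →
        closestPoint (Γ.surface t) x = p (t, x) := by
  let K : Set (ℝ × Euc (m + 1)) := (fun q : ℝ × Euc (m + 1) => (q.1, Γ.flow q.1 q.2)) ''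
    (Icc 0 T ×ˢ Γ.initial)
  have hK : IsCompact K := (isCompact_Icc.prod Γ.isCompact_initial).image
    (continuous_fst.prodMk Γ.contDiff_flow.continuous)
  let W : Set (ℝ × Euc (m + 1)) := interior {q | ∃ G : ℝ × Euc (m + 1) → Euc (m + 1), ∃ N ∈ 𝓝 q,
    ContDiffOn ℝ ∞ G N ∧ ∀ q ∈ N, q.1 ∈ Icc 0 T → closestPoint (Γ.surface q.1) q.2 = G q}
  have hKW : K ⊆ W := by
    rintro _ ⟨⟨t, z⟩, ⟨ht, hz⟩, rfl⟩
    obtain ⟨G, N, hN, hG, h⟩ := exists_local_closestPoint Γ ht hz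
    rw [mem_interior_iff_mem_nhds]
    filter_upwards [eventually_eventually_nhds.2 hN] with q hq
    exact ⟨G, N, hq, hG, h⟩
  obtain ⟨δ, hδ, hδW⟩ := hK.exists_cthickening_subset_open isOpen_interior hKW
  let A := Metric.cthickening δ K
  -- the local extensions are glued by a partition of unity, since the prescribed values form convex sets
  let target : ℝ × Euc (m + 1) → Set (Euc (m + 1)) := fun q =>
    {y | q ∈ A → q.1 ∈ Icc 0 T → y = closestPoint (Γ.surface q.1) q.2}
  have hconv : ∀ q, Convex ℝ (target q) := by
    intro q
    by_cases h : q ∈ A ∧ q.1 ∈ Icc 0 T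
    · have : target q = {closestPoint (Γ.surface q.1) q.2} := by
        ext y; exact ⟨fun hy => hy h.1 h.2, fun hy _ _ => hy⟩
      rw [this]; exact convex_singleton _
    · have : target q = univ := by
        ext y; exact ⟨fun _ => trivial, fun _ h1 h2 => (h ⟨h1, h2⟩).elim⟩
      rw [this]; exact convex_univ
  obtain ⟨p, hp⟩ := exists_contMDiffMap_forall_mem_convex_of_local (n := ⊤)
    (modelWithCornersSelf ℝ (ℝ × Euc (m + 1))) hconv (fun q => by
      by_cases hq : q ∈ A
      · obtain ⟨G, N, hN, hG, h⟩ := interior_subset (hδW hq)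
        exact ⟨N, hN, G, contMDiffOn_iff_contDiffOn.2 hG, fun q hq _ ht => (h q hq ht).symm⟩
      · exact ⟨Aᶜ, Metric.isClosed_cthickening.isOpen_compl.mem_nhds hq, fun _ => 0,
          contMDiffOn_const, fun q hq h => (hq h).elim⟩)
  refine ⟨δ, hδ, p, contMDiff_iff_contDiff.1 p.contMDiff, fun t ht x y hy hxy => ?_⟩
  obtain ⟨z, hz, rfl⟩ := hy
  refine (hp (t, x) ?_ ht).symm
  refine Metric.mem_cthickening_of_dist_le _ (t, Γ.flow t z) _ _ ⟨(t, z), ⟨ht, hz⟩, rfl⟩ ?_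
  simpa [Prod.dist_eq, hδ.le] using hxy.le

end Tube

/-! ### Directional derivatives -/

section Directional

variable {X V W : Type} [NormedAddCommGroup X] [NormedSpace ℝ X]
  [NormedAddCommGroup V] [NormedSpace ℝ V] [NormedAddCommGroup W] [InnerProductSpace ℝ W]

/-- The directional derivative of `f` in the direction `v`, as a function of the point. -/
def dirDeriv (v : X) (f : X → V) (x : X) : V := fderiv ℝ f x v

theorem contDiff_dirDeriv (v : X) {f : X → V} (hf : ContDiff ℝ ∞ f) :
    ContDiff ℝ ∞ (dirDeriv v f) :=
  (hf.fderiv_right (m := ∞) (by simp)).clm_apply contDiff_const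

theorem hasDerivAt_line (v : X) {f : X → V} (hf : ContDiff ℝ ∞ f) (x : X) (s : ℝ) :
    HasDerivAt (fun s : ℝ => f (x + s • v)) (dirDeriv v f (x + s • v)) s := by
  have h1 : HasFDerivAt f (fderiv ℝ f (x + s • v)) (x + s • v) :=
    (hf.differentiable (by simp) _).hasFDerivAt
  have h2 : HasDerivAt (fun s : ℝ => x + s • v) v s := by
    simpa using ((hasDerivAt_id s).smul_const v).const_add x
  exact h1.comp_hasDerivAt s h2

theorem hasDerivAt_line_zero (v : X) {f : X → V} (hf : ContDiff ℝ ∞ f) (x : X) :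
    HasDerivAt (fun s : ℝ => f (x + s • v)) (dirDeriv v f x) 0 := by
  simpa using hasDerivAt_line v hf x 0

theorem dirDeriv_eq_of_hasDerivAt {v : X} {f : X → V} (hf : ContDiff ℝ ∞ f) {x : X} {f' : V}
    (h : HasDerivAt (fun s : ℝ => f (x + s • v)) f' 0) : dirDeriv v f x = f' :=
  (hasDerivAt_line_zero v hf x).unique h

theorem dirDeriv_comm (v w : X) {f : X → V} (hf : ContDiff ℝ ∞ f) (x : X) :
    dirDeriv v (dirDeriv w f) x = dirDeriv w (dirDeriv v f) x := by
  have h : ∀ v w, dirDeriv v (dirDeriv w f) x = fderiv ℝ (fderiv ℝ f) x v w := by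
    intro v w
    have h1 : HasFDerivAt (fderiv ℝ f) (fderiv ℝ (fderiv ℝ f) x) x :=
      ((hf.fderiv_right (m := ∞) (by simp)).differentiable (by simp) x).hasFDerivAt
    have h2 := h1.clm_apply (hasFDerivAt_const w x)
    have : fderiv ℝ (dirDeriv w f) x = _ := h2.fderiv
    rw [dirDeriv, this]
    simp
  rw [h, h]
  exact (hf.contDiffAt.isSymmSndFDerivAt (by
    rw [minSmoothness_of_isRCLikeNormedField]
    exact WithTop.coe_le_coe.2 le_top)) v w

end Directional

/-! ### The parametrisation of the elements as a smooth function of all data -/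

section Element

variable {m : ℕ} {T : ℝ}

/-- The data `(η, x₀, ζ)` of a flat simplex with the vertices `x₀ + η ζ_i`: a size, a base point and
the scaled offsets of the vertices. All sizes `η`, the degenerate `η = 0` included, are admitted, so
that the maps below are smooth in `η` and expand in powers of it. -/
abbrev SimplexData (m : ℕ) : Type := ℝ × Euc (m + 1) × (Fin (m + 1) → Euc (m + 1))

/-- Simplex data, together with a time and a point of the reference simplex. -/
abbrev ElementSpace (m : ℕ) : Type := SimplexData m × ℝ × Euc m

/-- The direction `w` in the reference simplex. -/
def spaceDir (w : Euc m) : ElementSpace m := (0, 0, w)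

/-- The time direction. -/
def timeDir : ElementSpace m := (0, 1, 0)

/-- Barycentric coordinates as a function of the last `m` of them. -/
def bary (u : Euc m) : Fin (m + 1) → ℝ := Fin.cons (1 - ∑ i, u i) fun i => u i

/-- The linear part of `bary`. -/
def baryLin (w : Euc m) : Fin (m + 1) → ℝ := Fin.cons (-∑ i, w i) fun i => w i

theorem sum_bary (u : Euc m) : ∑ i, bary u i = 1 := by
  simp [bary, Fin.sum_univ_succ]

theorem bary_add_smul (u w : Euc m) (s : ℝ) (i : Fin (m + 1)) :
    bary (u + s • w) i = bary u i + s * baryLin w i := by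
  refine Fin.cases ?_ (fun i => ?_) i
  · simp [bary, baryLin, Finset.sum_add_distrib, Finset.mul_sum]; ring
  · simp [bary, baryLin]

theorem contDiff_bary : ContDiff ℝ ∞ (bary (m := m)) := by
  rw [contDiff_pi]
  intro i
  refine Fin.cases ?_ (fun i => ?_) i
  · simp only [bary, Fin.cons_zero]; fun_prop
  · simp only [bary, Fin.cons_succ]; fun_prop

theorem abs_baryLin_le (w : Euc m) (i : Fin (m + 1)) : |baryLin w i| ≤ (m + 1) * ‖w‖ := by
  have h : ∀ i, |w i| ≤ ‖w‖ := fun i => PiLp.norm_apply_le w i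
  refine Fin.cases ?_ (fun i => ?_) i
  · simp only [baryLin, Fin.cons_zero, abs_neg]
    refine (Finset.abs_sum_le_sum_abs _ _).trans ((Finset.sum_le_sum fun i _ => h i).trans ?_)
    simp; nlinarith [norm_nonneg w]
  · simp only [baryLin, Fin.cons_succ]
    refine (h i).trans ?_
    nlinarith [norm_nonneg w, Nat.cast_nonneg (α := ℝ) m]

theorem abs_bary_le (u : Euc m) (i : Fin (m + 1)) : |bary u i| ≤ 1 + (m + 1) * ‖u‖ := by
  have h := bary_add_smul 0 u 1 i
  simp only [one_smul, zero_add, one_mul] at h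
  rw [h]
  have h0 : |bary (0 : Euc m) i| ≤ 1 := by
    refine Fin.cases ?_ (fun i => ?_) i <;> simp [bary]
  exact (abs_add_le _ _).trans (add_le_add h0 (abs_baryLin_le u i))

/-- The scaled offset `∑ i, l_i ζ_i` of the point with barycentric coordinates `bary u`. -/
def offset (ζ : Fin (m + 1) → Euc (m + 1)) (u : Euc m) : Euc (m + 1) := ∑ i, bary u i • ζ i

/-- The linear part of `offset ζ`. -/
def offsetLin (ζ : Fin (m + 1) → Euc (m + 1)) (w : Euc m) : Euc (m + 1) := ∑ i, baryLin w i • ζ i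

theorem offset_add_smul (ζ : Fin (m + 1) → Euc (m + 1)) (u w : Euc m) (s : ℝ) :
    offset ζ (u + s • w) = offset ζ u + s • offsetLin ζ w := by
  simp only [offset, offsetLin, bary_add_smul, add_smul, Finset.sum_add_distrib, Finset.smul_sum,
    mul_smul]

theorem norm_offset_le {ζ : Fin (m + 1) → Euc (m + 1)} (hζ : ‖ζ‖ ≤ 1) (u : Euc m) :
    ‖offset ζ u‖ ≤ (m + 1) * (1 + (m + 1) * ‖u‖) := by
  have h : ∀ i ∈ Finset.univ, ‖bary u i • ζ i‖ ≤ 1 + (m + 1) * ‖u‖ := by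
    intro i _
    rw [norm_smul, Real.norm_eq_abs]
    have h1 := (norm_le_pi_norm ζ i).trans hζ
    have h2 := abs_bary_le u i
    calc |bary u i| * ‖ζ i‖ ≤ (1 + (m + 1) * ‖u‖) * 1 := by gcongr
      _ = _ := mul_one _
  refine (norm_sum_le_of_le _ h).trans_eq ?_
  simp
  ring

/-- The map `(t, x) ↦ flow t (p (0, x))`, where `p` is a smooth extension of the closest-point
projection. -/
def transport (Γ : EvolvingSurface m T) (p : ℝ × Euc (m + 1) → Euc (m + 1))
    (q : ℝ × Euc (m + 1)) : Euc (m + 1) := Γ.flow q.1 (p (0, q.2))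

theorem contDiff_transport (Γ : EvolvingSurface m T) {p : ℝ × Euc (m + 1) → Euc (m + 1)}
    (hp : ContDiff ℝ ∞ p) : ContDiff ℝ ∞ (transport Γ p) := by
  have h : ContDiff ℝ ∞ fun q : ℝ × Euc (m + 1) => p (0, q.2) :=
    hp.comp (by fun_prop : ContDiff ℝ ∞ fun q : ℝ × Euc (m + 1) => ((0 : ℝ), q.2))
  exact Γ.contDiff_flow.comp (contDiff_fst.prodMk h)

theorem contDiff_transport_comp (Γ : EvolvingSurface m T) {p : ℝ × Euc (m + 1) → Euc (m + 1)}
    (hp : ContDiff ℝ ∞ p) {X : Type*} [NormedAddCommGroup X] [NormedSpace ℝ X] {f : X → ℝ}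
    {g : X → Euc (m + 1)} (hf : ContDiff ℝ ∞ f) (hg : ContDiff ℝ ∞ g) :
    ContDiff ℝ ∞ fun q => transport Γ p (f q, g q) :=
  (contDiff_transport Γ hp).comp (hf.prodMk hg)

/-- The exact surface parametrised over the flat simplex. -/
def exactMap (Γ : EvolvingSurface m T) (p : ℝ × Euc (m + 1) → Euc (m + 1))
    (q : ElementSpace m) : Euc (m + 1) :=
  transport Γ p (q.2.1, q.1.2.1 + q.1.1 • offset q.1.2.2 q.2.2)

/-- The curved element parametrised over the reference simplex: the interpolation of `exactMap`. -/
def elementMap (Γ : EvolvingSurface m T) (p : ℝ × Euc (m + 1) → Euc (m + 1)) (k : ℕ)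
    (q : ElementSpace m) : Euc (m + 1) :=
  ∑ α ∈ Finset.piAntidiag Finset.univ k, lagrange k α (bary q.2.2) •
    transport Γ p (q.2.1, q.1.2.1 + q.1.1 • ∑ i, ((α i : ℝ) / k) • q.1.2.2 i)

theorem contDiff_elementMap (Γ : EvolvingSurface m T) {p : ℝ × Euc (m + 1) → Euc (m + 1)}
    (hp : ContDiff ℝ ∞ p) (k : ℕ) : ContDiff ℝ ∞ (elementMap Γ p k) := by
  have hb : ContDiff ℝ ∞ fun q : ElementSpace m => bary q.2.2 := contDiff_bary.comp (by fun_prop)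
  have hl : ∀ α, ContDiff ℝ ∞ fun q : ElementSpace m => lagrange k α (bary q.2.2) := fun α =>
    (contDiff_lagrange k α).comp hb
  have ht : ∀ α : Fin (m + 1) → ℕ, ContDiff ℝ ∞ fun q : ElementSpace m => transport Γ p
      (q.2.1, q.1.2.1 + q.1.1 • ∑ i, ((α i : ℝ) / k) • q.1.2.2 i) := by
    intro α
    have h1 : ContDiff ℝ ∞ fun q : ElementSpace m => q.2.1 := by fun_prop
    refine contDiff_transport_comp Γ hp h1 ?_
    have : ∀ i, ContDiff ℝ ∞ fun q : ElementSpace m => ((α i : ℝ) / k) • q.1.2.2 i := by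
      intro i
      have h1 : ContDiff ℝ ∞ fun q : ElementSpace m => q.1.2.2 i := by fun_prop
      exact h1.const_smul ((α i : ℝ) / k)
    have h2 : ContDiff ℝ ∞ fun q : ElementSpace m => ∑ i, ((α i : ℝ) / k) • q.1.2.2 i :=
      ContDiff.sum fun i _ => this i
    fun_prop
  exact ContDiff.sum fun α _ => (hl α).smul (ht α)

theorem contDiff_elementOffset :
    ContDiff ℝ ∞ fun q : ElementSpace m => offset q.1.2.2 q.2.2 := by
  have h : ContDiff ℝ ∞ fun q : ElementSpace m => bary q.2.2 := contDiff_bary.comp (by fun_prop)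
  rw [contDiff_pi] at h
  have hζ : ∀ i, ContDiff ℝ ∞ fun q : ElementSpace m => q.1.2.2 i := by fun_prop
  exact ContDiff.sum fun i _ => (h i).smul (hζ i)

theorem contDiff_size : ContDiff ℝ ∞ fun q : ElementSpace m => q.1.1 := by fun_prop

theorem contDiff_base : ContDiff ℝ ∞ fun q : ElementSpace m => (q.2.1, q.1.2.1) := by fun_prop

theorem contDiff_exactMap (Γ : EvolvingSurface m T) {p : ℝ × Euc (m + 1) → Euc (m + 1)}
    (hp : ContDiff ℝ ∞ p) : ContDiff ℝ ∞ (exactMap Γ p) :=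
  contDiff_transport_comp Γ hp (by fun_prop)
    (ContDiff.add (by fun_prop) (contDiff_size.smul contDiff_elementOffset))

/-- The interpolation error of the exact parametrisation is of order `η ^ (k + 1)`, together with all
its derivatives. -/
theorem exists_elementMap_eq_exactMap_add (Γ : EvolvingSurface m T)
    {p : ℝ × Euc (m + 1) → Euc (m + 1)} (hp : ContDiff ℝ ∞ p) {k : ℕ} (hk : k ≠ 0) :
    ∃ R : ElementSpace m → Euc (m + 1), ContDiff ℝ ∞ R ∧
      ∀ q, elementMap Γ p k q = exactMap Γ p q + q.1.1 ^ (k + 1) • R q := by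
  have hg : ContDiff ℝ ∞ fun q : (ℝ × Euc (m + 1)) × Euc (m + 1) =>
      transport Γ p (q.1.1, q.1.2 + q.2) :=
    contDiff_transport_comp Γ hp (by fun_prop) (by fun_prop)
  obtain ⟨R, hR, h⟩ := exists_interpolation_error (m := m) hk hg
  have hb : ContDiff ℝ ∞ fun q : ElementSpace m => bary q.2.2 := contDiff_bary.comp (by fun_prop)
  have hζ : ContDiff ℝ ∞ fun q : ElementSpace m => q.1.2.2 := by fun_prop
  refine ⟨fun q => R ((q.2.1, q.1.2.1), q.1.1, bary q.2.2, q.1.2.2),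
    hR.comp (contDiff_base.prodMk (contDiff_size.prodMk (hb.prodMk hζ))), ?_⟩
  intro q
  exact h (q.2.1, q.1.2.1) q.1.1 (bary q.2.2) q.1.2.2 (sum_bary _)

/-- The distance vector of the curved element from the surface is of order `η ^ (k + 1)`, together
with all its derivatives. -/
theorem exists_sub_proj_elementMap (Γ : EvolvingSurface m T)
    {p : ℝ × Euc (m + 1) → Euc (m + 1)} (hp : ContDiff ℝ ∞ p) {k : ℕ} (hk : k ≠ 0) :
    ∃ R : ElementSpace m → Euc (m + 1), ContDiff ℝ ∞ R ∧
      ∀ q, exactMap Γ p q - p (q.2.1, exactMap Γ p q) = 0 →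
        p (q.2.1, elementMap Γ p k q) = elementMap Γ p k q - q.1.1 ^ (k + 1) • R q := by
  obtain ⟨R₁, hR₁, h₁⟩ := exists_elementMap_eq_exactMap_add Γ hp hk
  have hf : ContDiff ℝ ∞ fun q : (ℝ × Euc (m + 1)) × Euc (m + 1) =>
      (q.1.2 + q.2) - p (q.1.1, q.1.2 + q.2) :=
    ContDiff.sub (by fun_prop) (hp.comp (by fun_prop :
      ContDiff ℝ ∞ fun q : (ℝ × Euc (m + 1)) × Euc (m + 1) => (q.1.1, q.1.2 + q.2)))
  obtain ⟨L, hL, h⟩ := exists_contDiff_hadamard hf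
  have hΦ := contDiff_exactMap Γ hp
  have ht : ContDiff ℝ ∞ fun q : ElementSpace m => q.2.1 := by fun_prop
  refine ⟨fun q => L ((q.2.1, exactMap Γ p q), q.1.1 ^ (k + 1) • R₁ q) (R₁ q), ?_, ?_⟩
  · exact (hL.comp ((ht.prodMk hΦ).prodMk ((contDiff_size.pow _).smul hR₁))).clm_apply hR₁
  · intro q hq
    have := h (q.2.1, exactMap Γ p q) (q.1.1 ^ (k + 1) • R₁ q)
    simp only [add_zero, hq, zero_add, ← h₁, map_smul] at this
    rw [← this]
    abel

/-- Second order Taylor expansion in the space variable. -/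
theorem exists_taylor_shift {n : ℕ} {V : Type} [NormedAddCommGroup V] [NormedSpace ℝ V]
    [CompleteSpace V] {f : ℝ × Euc n → V} (hf : ContDiff ℝ ∞ f) :
    ∃ R : (ℝ × Euc n) × ℝ × Euc n → V, ContDiff ℝ ∞ R ∧ ∀ t x (η : ℝ) y,
      f (t, x + η • y) = f (t, x) + η • fderiv ℝ f (t, x) (0, y) + η ^ 2 • R ((t, x), η, y) := by
  have hg : ContDiff ℝ ∞ fun q : (ℝ × Euc n) × Euc n => f (q.1.1, q.1.2 + q.2) :=
    hf.comp (by fun_prop : ContDiff ℝ ∞ fun q : (ℝ × Euc n) × Euc n => (q.1.1, q.1.2 + q.2))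
  obtain ⟨R, hR, h⟩ := exists_taylor_two hg
  refine ⟨R, hR, fun t x η y => ?_⟩
  have hd : fderiv ℝ (fun q : (ℝ × Euc n) × Euc n => f (q.1.1, q.1.2 + q.2)) ((t, x), 0) (0, y)
      = fderiv ℝ f (t, x) (0, y) := by
    refine dirDeriv_eq_of_hasDerivAt hg ?_
    have := hasDerivAt_line_zero ((0 : ℝ), y) hf (t, x)
    have e : (fun s : ℝ => f ((t, x) + s • ((0 : ℝ), y))) = fun s : ℝ =>
        f ((((t, x), (0 : Euc n)) + s • ((0 : ℝ × Euc n), y)).1.1,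
          (((t, x), (0 : Euc n)) + s • ((0 : ℝ × Euc n), y)).1.2 +
          (((t, x), (0 : Euc n)) + s • ((0 : ℝ × Euc n), y)).2) := by
      funext s
      congr 1
      ext <;> simp
    rw [e] at this
    exact this
  have h2 := h (t, x) η y
  rw [hd] at h2
  simpa only [add_zero] using h2

/-- Expansion of the curved element in powers of its size. -/
theorem exists_elementMap_expansion (Γ : EvolvingSurface m T)
    {p : ℝ × Euc (m + 1) → Euc (m + 1)} (hp : ContDiff ℝ ∞ p) {k : ℕ} (hk : k ≠ 0) :
    ∃ F₂ : ElementSpace m → Euc (m + 1), ContDiff ℝ ∞ F₂ ∧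
      ∀ q, elementMap Γ p k q = transport Γ p (q.2.1, q.1.2.1) +
        q.1.1 • fderiv ℝ (transport Γ p) (q.2.1, q.1.2.1) (0, offset q.1.2.2 q.2.2) +
        q.1.1 ^ 2 • F₂ q := by
  obtain ⟨R₁, hR₁, h₁⟩ := exists_elementMap_eq_exactMap_add Γ hp hk
  obtain ⟨R, hR, h⟩ := exists_taylor_shift (contDiff_transport Γ hp)
  obtain ⟨j, rfl⟩ := Nat.exists_eq_succ_of_ne_zero hk
  refine ⟨fun q => R ((q.2.1, q.1.2.1), q.1.1, offset q.1.2.2 q.2.2) + q.1.1 ^ j • R₁ q,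
    (hR.comp (contDiff_base.prodMk (contDiff_size.prodMk contDiff_elementOffset))).add
      ((contDiff_size.pow _).smul hR₁), fun q => ?_⟩
  rw [h₁, exactMap, h, smul_add, smul_smul, ← pow_add, add_comm 2 j]
  simp only [add_assoc]

end Element

/-! ### Estimates that are uniform in the element data -/

section ElementEstimates

variable {m : ℕ} {T : ℝ}

/-- The compact set of element data over which all constants are taken. -/
def dataSet (Γ : EvolvingSurface m T) : Set (ElementSpace m) :=
  (Icc 0 1 ×ˢ (Γ.initial ×ˢ Metric.closedBall 0 1)) ×ˢ (Icc 0 T ×ˢ Metric.closedBall 0 2)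

theorem isCompact_dataSet (Γ : EvolvingSurface m T) : IsCompact (dataSet Γ) :=
  (isCompact_Icc.prod (Γ.isCompact_initial.prod (isCompact_closedBall _ _))).prod
    (isCompact_Icc.prod (isCompact_closedBall _ _))

theorem norm_spaceDir (w : Euc m) : ‖spaceDir w‖ = ‖w‖ := by
  simp [spaceDir, Prod.norm_def]

theorem dirDeriv_dirDeriv {X V : Type} [NormedAddCommGroup X] [NormedSpace ℝ X]
    [NormedAddCommGroup V] [NormedSpace ℝ V] (v w : X) {f : X → V} (hf : ContDiff ℝ ∞ f) (x : X) :
    dirDeriv v (dirDeriv w f) x = fderiv ℝ (fderiv ℝ f) x v w := by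
  have h1 : HasFDerivAt (fderiv ℝ f) (fderiv ℝ (fderiv ℝ f) x) x :=
    ((hf.fderiv_right (m := ∞) (by simp)).differentiable (by simp) x).hasFDerivAt
  have h2 := h1.clm_apply (hasFDerivAt_const w x)
  have : fderiv ℝ (dirDeriv w f) x = _ := h2.fderiv
  rw [dirDeriv, this]
  simp

theorem exists_jet_bound_of_isCompact {X V : Type} [NormedAddCommGroup X] [NormedSpace ℝ X]
    [NormedAddCommGroup V] [NormedSpace ℝ V] {K : Set X} (hK : IsCompact K) {f : X → V}
    (hf : ContDiff ℝ ∞ f) :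
    ∃ C ≥ 0, ∀ q ∈ K, ‖f q‖ ≤ C ∧ (∀ w, ‖dirDeriv w f q‖ ≤ C * ‖w‖) ∧
      ∀ w w', ‖dirDeriv w (dirDeriv w' f) q‖ ≤ C * ‖w‖ * ‖w'‖ := by
  have h1 : ContDiff ℝ ∞ (fderiv ℝ f) := hf.fderiv_right (m := ∞) (by simp)
  have h2 : ContDiff ℝ ∞ (fderiv ℝ (fderiv ℝ f)) := h1.fderiv_right (m := ∞) (by simp)
  obtain ⟨C₀, hC₀⟩ := hK.exists_bound_of_continuousOn hf.continuous.continuousOn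
  obtain ⟨C₁, hC₁⟩ := hK.exists_bound_of_continuousOn h1.continuous.continuousOn
  obtain ⟨C₂, hC₂⟩ : ∃ C₂, ∀ q ∈ K, ‖fderiv ℝ (fderiv ℝ f) q‖ ≤ C₂ := by
    have hc : Continuous (fun q => ‖fderiv ℝ (fderiv ℝ f) q‖) := by
      exact (@continuous_norm (X →L[ℝ] X →L[ℝ] V) _).comp h2.continuous
    obtain ⟨C, hC⟩ := hK.exists_bound_of_continuousOn hc.continuousOn
    exact ⟨C, fun q hq => (le_abs_self _).trans (hC q hq)⟩
  refine ⟨max 0 (max C₀ (max C₁ C₂)), le_max_left _ _, fun q hq => ⟨?_, fun w => ?_, fun w w' => ?_⟩⟩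
  · exact (hC₀ q hq).trans (by simp)
  · refine ((fderiv ℝ f q).le_opNorm _).trans ?_
    gcongr
    exact (hC₁ q hq).trans (by simp)
  · rw [dirDeriv_dirDeriv _ _ hf]
    refine ((fderiv ℝ (fderiv ℝ f) q).le_opNorm₂ _ _).trans ?_
    gcongr
    exact (hC₂ q hq).trans (by simp)

/-- Smooth functions and their first and second derivatives are bounded on `dataSet`. -/
theorem exists_jet_bound {V : Type} [NormedAddCommGroup V] [NormedSpace ℝ V]
    (Γ : EvolvingSurface m T) {f : ElementSpace m → V} (hf : ContDiff ℝ ∞ f) :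
    ∃ C ≥ 0, ∀ q ∈ dataSet Γ, ‖f q‖ ≤ C ∧ (∀ w, ‖dirDeriv (spaceDir w) f q‖ ≤ C * ‖w‖) ∧
      ∀ w w', ‖dirDeriv (spaceDir w) (dirDeriv (spaceDir w') f) q‖ ≤ C * ‖w‖ * ‖w'‖ := by
  obtain ⟨C, hC, h⟩ := exists_jet_bound_of_isCompact (isCompact_dataSet Γ) hf
  refine ⟨C, hC, fun q hq => ⟨(h q hq).1, fun w => ?_, fun w w' => ?_⟩⟩
  · rw [← norm_spaceDir w]; exact (h q hq).2.1 _
  · rw [← norm_spaceDir w, ← norm_spaceDir w']; exact (h q hq).2.2 _ _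

theorem contDiff_transportDeriv (Γ : EvolvingSurface m T) {p : ℝ × Euc (m + 1) → Euc (m + 1)}
    (hp : ContDiff ℝ ∞ p) : ContDiff ℝ ∞ fun q : ElementSpace m =>
      fderiv ℝ (transport Γ p) (q.2.1, q.1.2.1) (0, offset q.1.2.2 q.2.2) := by
  have h1 : ContDiff ℝ ∞ (fderiv ℝ (transport Γ p)) :=
    (contDiff_transport Γ hp).fderiv_right (m := ∞) (by simp)
  have h2 : ContDiff ℝ ∞ fun q : ElementSpace m => fderiv ℝ (transport Γ p) (q.2.1, q.1.2.1) :=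
    h1.comp contDiff_base
  exact h2.clm_apply (contDiff_const.prodMk contDiff_elementOffset)

/-- `f` has the form `y(t, x₀) + η D(t, x₀) (∑ l_i ζ_i) + η² f₂`, the leading terms being those of
the exact surface. -/
def HasExpansion (Γ : EvolvingSurface m T) (p : ℝ × Euc (m + 1) → Euc (m + 1))
    (f f₂ : ElementSpace m → Euc (m + 1)) : Prop :=
  ContDiff ℝ ∞ f₂ ∧ ∀ q, f q = transport Γ p (q.2.1, q.1.2.1) +
        q.1.1 • fderiv ℝ (transport Γ p) (q.2.1, q.1.2.1) (0, offset q.1.2.2 q.2.2) +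
        q.1.1 ^ 2 • f₂ q

variable {Γ : EvolvingSurface m T} {p : ℝ × Euc (m + 1) → Euc (m + 1)}
  {f f₂ : ElementSpace m → Euc (m + 1)}

theorem HasExpansion.contDiff (hp : ContDiff ℝ ∞ p) (h : HasExpansion Γ p f f₂) :
    ContDiff ℝ ∞ f := by
  have e : f = _ := funext h.2
  rw [e]
  exact (((contDiff_transport Γ hp).comp contDiff_base).add
    (contDiff_size.smul (contDiff_transportDeriv Γ hp))).add ((contDiff_size.pow 2).smul h.1)

theorem HasExpansion.dirDeriv (hp : ContDiff ℝ ∞ p) (h : HasExpansion Γ p f f₂) (w : Euc m)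
    (q : ElementSpace m) : dirDeriv (spaceDir w) f q =
      q.1.1 • fderiv ℝ (transport Γ p) (q.2.1, q.1.2.1) (0, offsetLin q.1.2.2 w) +
        q.1.1 ^ 2 • dirDeriv (spaceDir w) f₂ q := by
  refine dirDeriv_eq_of_hasDerivAt (h.contDiff hp) ?_
  have e : (fun s : ℝ => f (q + s • spaceDir w)) = fun s : ℝ => transport Γ p (q.2.1, q.1.2.1) +
      q.1.1 • (fderiv ℝ (transport Γ p) (q.2.1, q.1.2.1) (0, offset q.1.2.2 q.2.2) +
        s • fderiv ℝ (transport Γ p) (q.2.1, q.1.2.1) (0, offsetLin q.1.2.2 w)) +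
      q.1.1 ^ 2 • f₂ (q + s • spaceDir w) := by
    funext s
    rw [h.2]
    simp only [spaceDir, Prod.fst_add, Prod.snd_add, Prod.smul_fst, Prod.smul_snd, smul_zero,
      add_zero, offset_add_smul]
    have e2 : ((0 : ℝ), offset q.1.2.2 q.2.2 + s • offsetLin q.1.2.2 w) =
        (0, offset q.1.2.2 q.2.2) + s • ((0 : ℝ), offsetLin q.1.2.2 w) := by simp
    rw [e2, map_add, map_smul]
  rw [e]
  have h2 := (hasDerivAt_line_zero (spaceDir w) h.1 q).const_smul (q.1.1 ^ 2)
  have h1 : HasDerivAt (fun s : ℝ => q.1.1 • (fderiv ℝ (transport Γ p) (q.2.1, q.1.2.1)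
      (0, offset q.1.2.2 q.2.2) +
        s • fderiv ℝ (transport Γ p) (q.2.1, q.1.2.1) (0, offsetLin q.1.2.2 w)))
      (q.1.1 • (1 : ℝ) • fderiv ℝ (transport Γ p) (q.2.1, q.1.2.1) (0, offsetLin q.1.2.2 w)) 0 := by
    have := (((hasDerivAt_id (0 : ℝ)).smul_const
      (fderiv ℝ (transport Γ p) (q.2.1, q.1.2.1) (0, offsetLin q.1.2.2 w))).const_add
      (fderiv ℝ (transport Γ p) (q.2.1, q.1.2.1) (0, offset q.1.2.2 q.2.2))).const_smul q.1.1
    exact this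
  rw [one_smul] at h1
  exact (h1.const_add _).add h2

theorem HasExpansion.dirDeriv_dirDeriv (hp : ContDiff ℝ ∞ p) (h : HasExpansion Γ p f f₂)
    (w w' : Euc m) (q : ElementSpace m) :
    SurfaceFEM.dirDeriv (spaceDir w) (SurfaceFEM.dirDeriv (spaceDir w') f) q =
      q.1.1 ^ 2 • SurfaceFEM.dirDeriv (spaceDir w) (SurfaceFEM.dirDeriv (spaceDir w') f₂) q := by
  refine dirDeriv_eq_of_hasDerivAt (contDiff_dirDeriv _ (h.contDiff hp)) ?_
  have e : (fun s : ℝ => SurfaceFEM.dirDeriv (spaceDir w') f (q + s • spaceDir w)) = fun s : ℝ =>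
      q.1.1 • fderiv ℝ (transport Γ p) (q.2.1, q.1.2.1) (0, offsetLin q.1.2.2 w') +
        q.1.1 ^ 2 • SurfaceFEM.dirDeriv (spaceDir w') f₂ (q + s • spaceDir w) := by
    funext s
    rw [h.dirDeriv hp]
    simp [spaceDir]
  rw [e]
  exact ((hasDerivAt_line_zero (spaceDir w) (contDiff_dirDeriv (spaceDir w') h.1) q).const_smul
    (q.1.1 ^ 2)).const_add _

/-- The velocity gradient is of the order of the element size. -/
theorem HasExpansion.exists_velocity_bound (hp : ContDiff ℝ ∞ p) (h : HasExpansion Γ p f f₂) :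
    ∃ C ≥ 0, ∀ q ∈ dataSet Γ, ∀ w,
      ‖SurfaceFEM.dirDeriv (spaceDir w) (SurfaceFEM.dirDeriv timeDir f) q‖ ≤ C * q.1.1 * ‖w‖ := by
  let f₁ : ElementSpace m → Euc (m + 1) := fun q =>
    fderiv ℝ (transport Γ p) (q.2.1, q.1.2.1) (0, offset q.1.2.2 q.2.2) + q.1.1 • f₂ q
  have hf₁ : ContDiff ℝ ∞ f₁ := (contDiff_transportDeriv Γ hp).add (contDiff_size.smul h.1)
  have hff₁ : ∀ q, f q = transport Γ p (q.2.1, q.1.2.1) + q.1.1 • f₁ q := by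
    intro q
    rw [h.2, smul_add, smul_smul, pow_two, add_assoc]
  have hd : ∀ w q, SurfaceFEM.dirDeriv (spaceDir w) f q =
      q.1.1 • SurfaceFEM.dirDeriv (spaceDir w) f₁ q := by
    intro w q
    refine dirDeriv_eq_of_hasDerivAt (h.contDiff hp) ?_
    have e : (fun s : ℝ => f (q + s • spaceDir w)) = fun s : ℝ => transport Γ p (q.2.1, q.1.2.1) +
        q.1.1 • f₁ (q + s • spaceDir w) := by
      funext s; rw [hff₁]; simp [spaceDir]
    rw [e]
    exact ((hasDerivAt_line_zero (spaceDir w) hf₁ q).const_smul q.1.1).const_add _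
  obtain ⟨C, hC, hCb⟩ := exists_jet_bound Γ (contDiff_dirDeriv timeDir hf₁)
  refine ⟨C, hC, fun q hq w => ?_⟩
  have hdt : SurfaceFEM.dirDeriv (spaceDir w) (SurfaceFEM.dirDeriv timeDir f) q =
      q.1.1 • SurfaceFEM.dirDeriv (spaceDir w) (SurfaceFEM.dirDeriv timeDir f₁) q := by
    rw [dirDeriv_comm _ _ (h.contDiff hp), dirDeriv_comm _ _ hf₁]
    refine dirDeriv_eq_of_hasDerivAt (contDiff_dirDeriv _ (h.contDiff hp)) ?_
    have e : (fun s : ℝ => SurfaceFEM.dirDeriv (spaceDir w) f (q + s • timeDir)) = fun s : ℝ =>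
        q.1.1 • SurfaceFEM.dirDeriv (spaceDir w) f₁ (q + s • timeDir) := by
      funext s; rw [hd]; simp [timeDir]
    rw [e]
    exact (hasDerivAt_line_zero timeDir (contDiff_dirDeriv (spaceDir w) hf₁) q).const_smul
      q.1.1
  have hη : 0 ≤ q.1.1 := hq.1.1.1
  rw [hdt, norm_smul, Real.norm_eq_abs, abs_of_nonneg hη]
  have := (hCb q hq).2.1 w
  calc q.1.1 * _ ≤ q.1.1 * (C * ‖w‖) := by gcongr
    _ = _ := by ring

/-- The data describe a shape regular simplex with vertices on the initial surface. -/
structure IsRegularData (Γ : EvolvingSurface m T) (η₀ c : ℝ) (π : SimplexData m) : Prop where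
  size_pos : 0 < π.1
  size_le : π.1 ≤ η₀
  base_mem : π.2.1 ∈ Γ.initial
  norm_le : ‖π.2.2‖ ≤ 1
  vertex_mem : ∀ i, π.2.1 + π.1 • π.2.2 i ∈ Γ.initial
  regular : ∀ w, c * ‖w‖ ≤ ‖offsetLin π.2.2 w‖

theorem surface_zero (Γ : EvolvingSurface m T) : Γ.surface 0 = Γ.initial := by
  ext x
  constructor
  · rintro ⟨y, hy, rfl⟩; rwa [Γ.flow_zero y hy]
  · exact fun hx => ⟨x, hx, Γ.flow_zero x hx⟩

/-- `p` is a smooth extension of the closest-point projection from the `δ`-neighbourhood. -/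
def IsProjection (Γ : EvolvingSurface m T) (δ : ℝ) (p : ℝ × Euc (m + 1) → Euc (m + 1)) : Prop :=
  ContDiff ℝ ∞ p ∧ ∀ t ∈ Icc 0 T, ∀ x, ∀ y ∈ Γ.surface t, dist x y < δ →
        closestPoint (Γ.surface t) x = p (t, x)

theorem IsProjection.initial {δ : ℝ} (h : IsProjection Γ δ p) (hT : 0 ≤ T) {x y : Euc (m + 1)}
    (hy : y ∈ Γ.initial) (hxy : dist x y < δ) :
    closestPoint Γ.initial x = p (0, x) ∧ p (0, x) ∈ Γ.initial := by
  have h1 := h.2 0 ⟨le_rfl, hT⟩ x y (by rwa [surface_zero]) hxy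
  rw [surface_zero] at h1
  exact ⟨h1, h1 ▸ (closestPoint_spec Γ.isCompact_initial ⟨y, hy⟩ x).1⟩

/-- The differential of `x ↦ flow t (p (0, x))` controls that of the projection. -/
theorem exists_norm_projDeriv_le (Γ : EvolvingSurface m T) (hT : 0 ≤ T) {δ : ℝ} (hδ : 0 < δ)
    (h : IsProjection Γ δ p) : ∃ C > 0, ∀ t ∈ Icc 0 T, ∀ x ∈ Γ.initial, ∀ τ,
      ‖fderiv ℝ p (0, x) (0, τ)‖ ≤ C * ‖fderiv ℝ (transport Γ p) (t, x) (0, τ)‖ := by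
  obtain ⟨C, hC0, hC⟩ := exists_dist_le_mul_dist_flow Γ
  refine ⟨C, hC0, fun t ht x hx τ => ?_⟩
  refine norm_deriv_le_mul_of_dist_le (hasDerivAt_line_zero (0, τ) h.1 (0, x))
    (hasDerivAt_line_zero (0, τ) (contDiff_transport Γ h.1) (t, x)) ?_
  have hc : ∀ᶠ s : ℝ in 𝓝 0, dist (x + s • τ) x < δ := by
    have : Continuous fun s : ℝ => dist (x + s • τ) x := by fun_prop
    exact this.continuousAt.eventually (gt_mem_nhds (by simpa using hδ))
  filter_upwards [hc] with s hs
  have h1 := (h.initial hT hx hs).2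
  have h2 := (h.initial (x := x) hT hx (by simpa using hδ)).2
  simpa [transport] using hC t ht _ h1 _ h2

/-- The edges of a small simplex inscribed in the surface are almost tangential. -/
theorem exists_norm_offsetLin_sub_le (Γ : EvolvingSurface m T) (hT : 0 ≤ T) {δ : ℝ} (hδ : 0 < δ)
    (h : IsProjection Γ δ p) : ∃ C ≥ 0, ∀ c, ∀ π : SimplexData m, IsRegularData Γ 1 c π → ∀ w,
      ‖offsetLin π.2.2 w - fderiv ℝ p (0, π.2.1) (0, offsetLin π.2.2 w)‖ ≤ C * π.1 * ‖w‖ := by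
  obtain ⟨R, hR, hRe⟩ := exists_taylor_shift h.1
  obtain ⟨C, hC⟩ := ((isCompact_singleton (x := (0 : ℝ)).prod Γ.isCompact_initial).prod
    ((isCompact_Icc (a := (0 : ℝ)) (b := 1)).prod
      (isCompact_closedBall (0 : Euc (m + 1)) 1))).exists_bound_of_continuousOn
        hR.continuous.continuousOn
  refine ⟨(m + 1) * (m + 1) * max C 0, by positivity, fun c π hπ w => ?_⟩
  obtain ⟨η, x₀, ζ⟩ := π
  have hη : 0 < η := hπ.size_pos
  have hfix : ∀ y ∈ Γ.initial, p (0, y) = y := fun y hy =>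
    (h.initial hT hy (by simpa using hδ)).1.symm.trans (closestPoint_eq_self Γ.isCompact_initial hy)
  have hvert : ∀ i, ‖ζ i - fderiv ℝ p (0, x₀) (0, ζ i)‖ ≤ max C 0 * η := by
    intro i
    have h1 := hRe 0 x₀ η (ζ i)
    rw [hfix _ (hπ.vertex_mem i), hfix _ hπ.base_mem, add_assoc, add_right_inj, pow_two, mul_smul,
      ← smul_add] at h1
    have h2 := smul_right_injective _ hη.ne' h1
    simp only at h2
    have h3 : ζ i - fderiv ℝ p (0, x₀) (0, ζ i) = η • R ((0, x₀), η, ζ i) := by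
      rw [sub_eq_iff_eq_add']; exact h2
    rw [h3, norm_smul, Real.norm_eq_abs, abs_of_pos hη, mul_comm]
    gcongr
    refine (hC _ ⟨⟨mem_singleton _, hπ.base_mem⟩, ⟨hη.le, hπ.size_le⟩, ?_⟩).trans (le_max_left _ _)
    simpa using (norm_le_pi_norm ζ i).trans hπ.norm_le
  have hlin : offsetLin ζ w - fderiv ℝ p (0, x₀) (0, offsetLin ζ w) =
      ∑ i, baryLin w i • (ζ i - fderiv ℝ p (0, x₀) (0, ζ i)) := by
    have : ((0 : ℝ), offsetLin ζ w) = ∑ i, baryLin w i • ((0 : ℝ), ζ i) := by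
      ext1 <;> simp [offsetLin, Prod.fst_sum, Prod.snd_sum]
    rw [this, map_sum, offsetLin, ← Finset.sum_sub_distrib]
    simp only [map_smul, smul_sub]
  have hsum : ∀ i ∈ Finset.univ, ‖baryLin w i • (ζ i - fderiv ℝ p (0, x₀) (0, ζ i))‖ ≤
      ((m + 1) * ‖w‖) * (max C 0 * η) := by
    intro i _
    rw [norm_smul, Real.norm_eq_abs]
    exact mul_le_mul (abs_baryLin_le w i) (hvert i) (norm_nonneg _) (by positivity)
  rw [hlin]
  refine (norm_sum_le_of_le _ hsum).trans_eq ?_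
  simp
  ring

end ElementEstimates

/-! ### The metric of the discrete and of the lifted elements -/

section Directional

variable {X V W : Type} [NormedAddCommGroup X] [NormedSpace ℝ X]
  [NormedAddCommGroup V] [NormedSpace ℝ V] [NormedAddCommGroup W] [InnerProductSpace ℝ W]

theorem dirDeriv_inner (v : X) {f g : X → W} (hf : ContDiff ℝ ∞ f) (hg : ContDiff ℝ ∞ g) (x : X) :
    dirDeriv v (fun x => inner ℝ (f x) (g x)) x =
      inner ℝ (dirDeriv v f x) (g x) + inner ℝ (f x) (dirDeriv v g x) := by
  rw [add_comm]
  exact fderiv_inner_apply ℝ (hf.differentiable (by simp) x) (hg.differentiable (by simp) x) v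

theorem dirDeriv_sub (v : X) {f g : X → V} (hf : ContDiff ℝ ∞ f) (hg : ContDiff ℝ ∞ g) (x : X) :
    dirDeriv v (fun x => f x - g x) x = dirDeriv v f x - dirDeriv v g x := by
  rw [dirDeriv, fderiv_fun_sub (hf.differentiable (by simp) x) (hg.differentiable (by simp) x)]
  rfl

theorem dirDeriv_add (v : X) {f g : X → V} (hf : ContDiff ℝ ∞ f) (hg : ContDiff ℝ ∞ g) (x : X) :
    dirDeriv v (fun x => f x + g x) x = dirDeriv v f x + dirDeriv v g x := by
  rw [dirDeriv, fderiv_fun_add (hf.differentiable (by simp) x) (hg.differentiable (by simp) x)]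
  rfl

/-- A function that is constant along the line does not contribute to the directional derivative
of a product. -/
theorem dirDeriv_smul_of_const {v : X} {c : X → ℝ} {f : X → V} (hc : ContDiff ℝ ∞ c)
    (hf : ContDiff ℝ ∞ f) {x : X} (h : ∀ s : ℝ, c (x + s • v) = c x) :
    dirDeriv v (fun x => c x • f x) x = c x • dirDeriv v f x := by
  refine dirDeriv_eq_of_hasDerivAt (ContDiff.fun_smul hc hf) ?_
  have e : (fun s : ℝ => c (x + s • v) • f (x + s • v)) = fun s : ℝ => c x • f (x + s • v) :=
    funext fun s => by rw [h]
  rw [e]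
  exact (hasDerivAt_line_zero v hf x).const_smul (c x)

theorem dirDeriv_eq_zero_of_eventually {v : X} {f : X → V} (hf : ContDiff ℝ ∞ f) {x : X}
    (h : ∀ᶠ s : ℝ in 𝓝 0, f (x + s • v) = 0) : dirDeriv v f x = 0 :=
  dirDeriv_eq_of_hasDerivAt hf ((hasDerivAt_const (0 : ℝ) (0 : V)).congr_of_eventuallyEq h)

/-- The residual of a nearest point is orthogonal to the curves through that point. -/
theorem inner_dirDeriv_eq_zero {v : X} {f : X → W} (hf : ContDiff ℝ ∞ f) {x : X} {y : W}
    (h : ∀ᶠ s : ℝ in 𝓝 0, dist y (f x) ≤ dist y (f (x + s • v))) :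
    inner ℝ (dirDeriv v f x) (y - f x) = 0 := by
  have h1 : HasDerivAt (fun s : ℝ => ‖f (x + s • v) - y‖ ^ 2)
      (2 * inner ℝ (f (x + (0 : ℝ) • v) - y) (dirDeriv v f x)) 0 :=
    ((hasDerivAt_line_zero v hf x).sub_const y).norm_sq
  have h2 : IsLocalMin (fun s : ℝ => ‖f (x + s • v) - y‖ ^ 2) 0 := by
    filter_upwards [h] with s hs
    rw [dist_comm, dist_comm y, dist_eq_norm, dist_eq_norm] at hs
    simp only [zero_smul, add_zero]
    gcongr
  have h3 := h2.hasDerivAt_eq_zero h1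
  rw [zero_smul, add_zero, real_inner_comm] at h3
  rw [← neg_sub, inner_neg_right]
  linarith

end Directional

section ElementEstimates

variable {m : ℕ} {T : ℝ} {Γ : EvolvingSurface m T} {p : ℝ × Euc (m + 1) → Euc (m + 1)}
  {f f₂ : ElementSpace m → Euc (m + 1)}

theorem dirDeriv_spaceDir_size_smul {V : Type} [NormedAddCommGroup V] [NormedSpace ℝ V]
    (w : Euc m) (n : ℕ) {f : ElementSpace m → V} (hf : ContDiff ℝ ∞ f) (q : ElementSpace m) :
    dirDeriv (spaceDir w) (fun q => q.1.1 ^ n • f q) q = q.1.1 ^ n • dirDeriv (spaceDir w) f q :=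
  dirDeriv_smul_of_const (contDiff_size.pow n) hf (by simp [spaceDir])

theorem dirDeriv_timeDir_size_smul {V : Type} [NormedAddCommGroup V] [NormedSpace ℝ V]
    (n : ℕ) {f : ElementSpace m → V} (hf : ContDiff ℝ ∞ f) (q : ElementSpace m) :
    dirDeriv timeDir (fun q => q.1.1 ^ n • f q) q = q.1.1 ^ n • dirDeriv timeDir f q :=
  dirDeriv_smul_of_const (contDiff_size.pow n) hf (by simp [timeDir])

/-- One-sided information in time determines the time derivative, also at the end points. -/
theorem dirDeriv_timeDir_congr (hT : 0 < T) {V : Type} [NormedAddCommGroup V] [NormedSpace ℝ V]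
    {f g : ElementSpace m → V} (hf : ContDiff ℝ ∞ f) (hg : ContDiff ℝ ∞ g) {π : SimplexData m}
    {t : ℝ} (ht : t ∈ Icc 0 T) {u : Euc m} (h : ∀ t ∈ Icc 0 T, f (π, (t, u)) = g (π, (t, u))) :
    dirDeriv timeDir f (π, (t, u)) = dirDeriv timeDir g (π, (t, u)) := by
  have hd : UniqueDiffWithinAt ℝ (Icc (-t) (T - t)) 0 :=
    uniqueDiffOn_Icc (by linarith) 0 ⟨by linarith [ht.1], by linarith [ht.2]⟩
  have h1 := (hasDerivAt_line_zero timeDir hf (π, (t, u))).hasDerivWithinAt (s := Icc (-t) (T - t))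
  have h2 := (hasDerivAt_line_zero timeDir hg (π, (t, u))).hasDerivWithinAt (s := Icc (-t) (T - t))
  have e : ∀ s ∈ Icc (-t) (T - t), f ((π, (t, u)) + s • timeDir) = g ((π, (t, u)) + s • timeDir) := by
    intro s hs
    have := h (t + s) ⟨by linarith [hs.1], by linarith [hs.2]⟩
    simpa [timeDir] using this
  exact hd.eq_deriv _ h1 (h2.congr e (e 0 ⟨by linarith [ht.1], by linarith [ht.2]⟩))

theorem IsRegularData.mono {η₀ η₁ c : ℝ} {π : SimplexData m} (h : IsRegularData Γ η₀ c π)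
    (hη : η₀ ≤ η₁) : IsRegularData Γ η₁ c π :=
  { h with size_le := h.size_le.trans hη }

theorem IsRegularData.mem_dataSet {η₀ c : ℝ} {π : SimplexData m} (h : IsRegularData Γ η₀ c π)
    (hη : η₀ ≤ 1) {t : ℝ} (ht : t ∈ Icc 0 T) {u : Euc m} (hu : ‖u‖ ≤ 2) :
    (π, (t, u)) ∈ dataSet Γ :=
  ⟨⟨⟨h.size_pos.le, h.size_le.trans hη⟩, h.base_mem, by simpa using h.norm_le⟩, ht, by simpa using hu⟩

/-- Shape regularity: the differential of the parametrisation is bounded below by the size. -/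
theorem HasExpansion.exists_le_norm_dirDeriv (hT : 0 ≤ T) {δ : ℝ} (hδ : 0 < δ)
    (hp : IsProjection Γ δ p) (h : HasExpansion Γ p f f₂) {c : ℝ} (hc : 0 < c) :
    ∃ η₁ > 0, η₁ ≤ 1 ∧ ∃ C > 0, ∀ π, IsRegularData Γ η₁ c π → ∀ t ∈ Icc 0 T, ∀ u : Euc m, ‖u‖ ≤ 2 →
      ∀ w, π.1 * ‖w‖ ≤ C * ‖SurfaceFEM.dirDeriv (spaceDir w) f (π, (t, u))‖ := by
  obtain ⟨C₁, hC₁, h₁⟩ := exists_norm_projDeriv_le Γ hT hδ hp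
  obtain ⟨C₂, hC₂, h₂⟩ := exists_norm_offsetLin_sub_le Γ hT hδ hp
  obtain ⟨C₃, hC₃, h₃⟩ := exists_jet_bound Γ h.1
  refine ⟨min 1 (c / (2 * (C₂ + C₁ * C₃ + 1))), lt_min one_pos (by positivity), min_le_left _ _,
    2 * C₁ / c, by positivity, fun π hπ t ht u hu w => ?_⟩
  have hη := hπ.size_pos
  have hq := hπ.mem_dataSet (min_le_left _ _) ht hu
  have hle : (C₂ + C₁ * C₃) * π.1 ≤ c / 2 := by
    have h4 : π.1 ≤ c / (2 * (C₂ + C₁ * C₃ + 1)) := hπ.size_le.trans (min_le_right _ _)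
    rw [le_div_iff₀ (by positivity)] at h4
    nlinarith
  set B := offsetLin π.2.2 w
  have e1 : c * ‖w‖ ≤ ‖B‖ := hπ.regular w
  have e2 := h₂ c π (hπ.mono (min_le_left _ _)) w
  have e3 := h₁ t ht π.2.1 hπ.base_mem B
  have e4 := (h₃ _ hq).2.1 w
  set D := fderiv ℝ (transport Γ p) (t, π.2.1) (0, B)
  set d := SurfaceFEM.dirDeriv (spaceDir w) f₂ (π, (t, u))
  have e5 : ‖B‖ ≤ ‖B - fderiv ℝ p (0, π.2.1) (0, B)‖ + ‖fderiv ℝ p (0, π.2.1) (0, B)‖ :=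
    norm_le_norm_sub_add _ _
  have e6 : SurfaceFEM.dirDeriv (spaceDir w) f (π, (t, u)) = π.1 • (D + π.1 • d) := by
    rw [h.dirDeriv hp.1, smul_add, smul_smul, ← pow_two]
  have e7 : ‖D‖ ≤ ‖D + π.1 • d‖ + π.1 * (C₃ * ‖w‖) := by
    have : ‖D‖ ≤ ‖D + π.1 • d‖ + ‖π.1 • d‖ := by
      simpa using norm_sub_le (D + π.1 • d) (π.1 • d)
    rw [norm_smul, Real.norm_eq_abs, abs_of_pos hη] at this
    refine this.trans ?_
    gcongr
  have e8 : c * ‖w‖ ≤ (C₂ + C₁ * C₃) * π.1 * ‖w‖ + C₁ * ‖D + π.1 • d‖ := by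
    have : C₁ * ‖D‖ ≤ C₁ * (‖D + π.1 • d‖ + π.1 * (C₃ * ‖w‖)) := by gcongr
    change _ ≤ C₁ * ‖D‖ at e3
    nlinarith
  have e9 : c / 2 * ‖w‖ ≤ C₁ * ‖D + π.1 • d‖ := by
    nlinarith [mul_le_mul_of_nonneg_right hle (norm_nonneg w)]
  rw [e6, norm_smul, Real.norm_eq_abs, abs_of_pos hη]
  have e10 : ‖w‖ ≤ 2 * C₁ / c * ‖D + π.1 • d‖ := by
    rw [div_mul_eq_mul_div, le_div_iff₀ hc]
    linarith
  calc π.1 * ‖w‖ ≤ π.1 * (2 * C₁ / c * ‖D + π.1 • d‖) := by gcongr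
    _ = _ := by ring

/-- The metric `⟨D_w f, D_w' f⟩` of a parametrisation `f`. -/
def metric (f : ElementSpace m → Euc (m + 1)) (w w' : Euc m) (q : ElementSpace m) : ℝ :=
  inner ℝ (dirDeriv (spaceDir w) f q) (dirDeriv (spaceDir w') f q)

/-- The time derivative of the metric. -/
def metricRate (f : ElementSpace m → Euc (m + 1)) (w w' : Euc m) (q : ElementSpace m) : ℝ :=
  inner ℝ (dirDeriv (spaceDir w) (dirDeriv timeDir f) q) (dirDeriv (spaceDir w') f q) +
    inner ℝ (dirDeriv (spaceDir w) f q) (dirDeriv (spaceDir w') (dirDeriv timeDir f) q)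

theorem contDiff_metric (hf : ContDiff ℝ ∞ f) (w w' : Euc m) : ContDiff ℝ ∞ (metric f w w') :=
  (contDiff_dirDeriv _ hf).inner ℝ (contDiff_dirDeriv _ hf)

theorem dirDeriv_metric (hf : ContDiff ℝ ∞ f) (w w' : Euc m) (q : ElementSpace m) :
    dirDeriv timeDir (metric f w w') q = metricRate f w w' q := by
  have := dirDeriv_inner timeDir (contDiff_dirDeriv (spaceDir w) hf)
    (contDiff_dirDeriv (spaceDir w') hf) q
  rw [dirDeriv_comm timeDir _ hf, dirDeriv_comm timeDir _ hf] at this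
  exact this

/-- The difference of the metrics of `P + η^(k+1) R` and `P`, if `R` is orthogonal to the image
of `P`, divided by `η^(k+3)`; here `k = j + 1`, and `P₂` is the second order part of `P`. -/
def metricDefect (j : ℕ) (P₂ R : ElementSpace m → Euc (m + 1)) (w w' : Euc m)
    (q : ElementSpace m) : ℝ :=
  q.1.1 ^ j • inner ℝ (dirDeriv (spaceDir w) R q) (dirDeriv (spaceDir w') R q) -
    (2 : ℝ) • inner ℝ (dirDeriv (spaceDir w) (dirDeriv (spaceDir w') P₂) q) (R q)

theorem contDiff_metricDefect (j : ℕ) {P₂ R : ElementSpace m → Euc (m + 1)}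
    (hP₂ : ContDiff ℝ ∞ P₂) (hR : ContDiff ℝ ∞ R) (w w' : Euc m) :
    ContDiff ℝ ∞ (metricDefect j P₂ R w w') :=
  (ContDiff.fun_smul (contDiff_size.pow j)
    ((contDiff_dirDeriv (spaceDir w) hR).inner ℝ (contDiff_dirDeriv (spaceDir w') hR))).sub
    (ContDiff.fun_smul contDiff_const
      ((contDiff_dirDeriv (spaceDir w) (contDiff_dirDeriv (spaceDir w') hP₂)).inner ℝ hR))

/-- The defect and its time derivative are bounded: this is where the two orders in addition to
`η ^ (k + 1)` go, as the metric itself is of order `η ^ 2`. -/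
theorem exists_metricDefect_bound (Γ : EvolvingSurface m T) (j : ℕ)
    {P₂ R : ElementSpace m → Euc (m + 1)} (hP₂ : ContDiff ℝ ∞ P₂) (hR : ContDiff ℝ ∞ R) :
    ∃ C ≥ 0, ∀ q ∈ dataSet Γ, ∀ w w', |metricDefect j P₂ R w w' q| ≤ C * ‖w‖ * ‖w'‖ ∧
      |dirDeriv timeDir (metricDefect j P₂ R w w') q| ≤ C * ‖w‖ * ‖w'‖ := by
  obtain ⟨C₁, hC₁, h₁⟩ := exists_jet_bound Γ hP₂
  obtain ⟨C₂, hC₂, h₂⟩ := exists_jet_bound Γ hR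
  obtain ⟨C₃, hC₃, h₃⟩ := exists_jet_bound Γ (contDiff_dirDeriv timeDir hP₂)
  obtain ⟨C₄, hC₄, h₄⟩ := exists_jet_bound Γ (contDiff_dirDeriv timeDir hR)
  refine ⟨C₂ * C₂ + 2 * (C₁ * C₂) + (C₄ * C₂ + C₂ * C₄) + 2 * (C₃ * C₂ + C₁ * C₄), by positivity,
    fun q hq w w' => ?_⟩
  have hη0 : 0 ≤ q.1.1 ^ j := pow_nonneg hq.1.1.1 _
  have hη1 : q.1.1 ^ j ≤ 1 := pow_le_one₀ hq.1.1.1 hq.1.1.2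
  have hinner : ∀ (a b : Euc (m + 1)) (α β : ℝ), 0 ≤ α → ‖a‖ ≤ α → ‖b‖ ≤ β →
      |inner ℝ a b| ≤ α * β := fun a b α β h0 ha hb =>
    (abs_real_inner_le_norm a b).trans (mul_le_mul ha hb (norm_nonneg _) h0)
  have hsmul : ∀ a b : ℝ, |a| ≤ b → |q.1.1 ^ j • a| ≤ b := by
    intro a b hab
    rw [smul_eq_mul, abs_mul, abs_of_nonneg hη0]
    nlinarith [abs_nonneg a]
  have e1 := hsmul _ _ (hinner _ _ _ _ (by positivity) ((h₂ q hq).2.1 w) ((h₂ q hq).2.1 w'))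
  have e2 := hinner _ _ _ _ (by positivity) ((h₁ q hq).2.2 w w') ((h₂ q hq).1)
  have e3 := hinner _ _ _ _ (by positivity) ((h₄ q hq).2.1 w) ((h₂ q hq).2.1 w')
  have e4 := hinner _ _ _ _ (by positivity) ((h₂ q hq).2.1 w) ((h₄ q hq).2.1 w')
  have e5 := hinner _ _ _ _ (by positivity) ((h₃ q hq).2.2 w w') ((h₂ q hq).1)
  have e6 := hinner _ _ _ _ (by positivity) ((h₁ q hq).2.2 w w') ((h₄ q hq).1)
  have hww : 0 ≤ ‖w‖ * ‖w'‖ := by positivity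
  constructor
  · have : C₂ * ‖w‖ * (C₂ * ‖w'‖) + 2 * (C₁ * ‖w‖ * ‖w'‖ * C₂) ≤
        (C₂ * C₂ + 2 * (C₁ * C₂) + (C₄ * C₂ + C₂ * C₄) + 2 * (C₃ * C₂ + C₁ * C₄)) * ‖w‖ * ‖w'‖ := by
      have : 0 ≤ ((C₄ * C₂ + C₂ * C₄) + 2 * (C₃ * C₂ + C₁ * C₄)) * (‖w‖ * ‖w'‖) := by positivity
      linarith
    refine le_trans ?_ this
    rw [metricDefect]
    refine (abs_sub _ _).trans (add_le_add e1 ?_)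
    rw [smul_eq_mul, abs_mul, abs_two]
    gcongr
  · have hd : dirDeriv timeDir (metricDefect j P₂ R w w') q =
        q.1.1 ^ j • (inner ℝ (dirDeriv (spaceDir w) (dirDeriv timeDir R) q)
            (dirDeriv (spaceDir w') R q) +
          inner ℝ (dirDeriv (spaceDir w) R q) (dirDeriv (spaceDir w') (dirDeriv timeDir R) q)) -
        (2 : ℝ) • (inner ℝ (dirDeriv (spaceDir w) (dirDeriv (spaceDir w') (dirDeriv timeDir P₂)) q)
            (R q) + inner ℝ (dirDeriv (spaceDir w) (dirDeriv (spaceDir w') P₂) q)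
              (dirDeriv timeDir R q)) := by
      have i1 := (contDiff_dirDeriv (spaceDir w) hR).inner ℝ (contDiff_dirDeriv (spaceDir w') hR)
      have i2 := (contDiff_dirDeriv (spaceDir w) (contDiff_dirDeriv (spaceDir w') hP₂)).inner ℝ hR
      have e := dirDeriv_sub timeDir (ContDiff.fun_smul (contDiff_size.pow j) i1)
        (ContDiff.fun_smul (contDiff_const (c := (2 : ℝ))) i2) q
      rw [dirDeriv_timeDir_size_smul j i1, dirDeriv_smul_of_const contDiff_const i2 (fun _ => rfl),
        dirDeriv_inner _ (contDiff_dirDeriv _ hR) (contDiff_dirDeriv _ hR),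
        dirDeriv_inner _ (contDiff_dirDeriv _ (contDiff_dirDeriv _ hP₂)) hR,
        dirDeriv_comm timeDir (spaceDir w) hR, dirDeriv_comm timeDir (spaceDir w') hR,
        dirDeriv_comm timeDir (spaceDir w) (contDiff_dirDeriv _ hP₂)] at e
      have e' : dirDeriv timeDir (dirDeriv (spaceDir w') P₂) =
        dirDeriv (spaceDir w') (dirDeriv timeDir P₂) := funext fun q => dirDeriv_comm _ _ hP₂ q
      rw [e'] at e
      exact e
    rw [hd]
    have : (C₄ * ‖w‖ * (C₂ * ‖w'‖) + C₂ * ‖w‖ * (C₄ * ‖w'‖)) +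
          2 * (C₃ * ‖w‖ * ‖w'‖ * C₂ + C₁ * ‖w‖ * ‖w'‖ * C₄) ≤
        (C₂ * C₂ + 2 * (C₁ * C₂) + (C₄ * C₂ + C₂ * C₄) + 2 * (C₃ * C₂ + C₁ * C₄)) * ‖w‖ * ‖w'‖ := by
      have : 0 ≤ (C₂ * C₂ + 2 * (C₁ * C₂)) * (‖w‖ * ‖w'‖) := by positivity
      linarith
    refine le_trans ?_ this
    refine (abs_sub _ _).trans (add_le_add (hsmul _ _ ((abs_add_le _ _).trans (add_le_add e3 e4))) ?_)
    rw [smul_eq_mul, abs_mul, abs_two]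
    gcongr
    exact (abs_add_le _ _).trans (add_le_add e5 e6)

/-- If the normal error `R` is orthogonal to the image of `P`, then in the metrics its first order
contribution is, by differentiating the orthogonality, given by second derivatives of `P`. -/
theorem metric_sub_metric_eq (hp : ContDiff ℝ ∞ p) (j : ℕ)
    {F P P₂ R : ElementSpace m → Euc (m + 1)} (hR : ContDiff ℝ ∞ R) (hP : HasExpansion Γ p P P₂)
    (hF : ∀ q, F q = P q + q.1.1 ^ (j + 2) • R q) (π : SimplexData m) (t : ℝ)
    (horth : ∀ u ∈ Metric.ball (0 : Euc m) 2, ∀ w,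
      inner ℝ (dirDeriv (spaceDir w) P (π, (t, u))) (R (π, (t, u))) = 0)
    {u : Euc m} (hu : u ∈ Metric.ball (0 : Euc m) 2) (w w' : Euc m) :
    metric F w w' (π, (t, u)) - metric P w w' (π, (t, u)) =
      π.1 ^ (j + 4) • metricDefect j P₂ R w w' (π, (t, u)) := by
  have hPs := hP.contDiff hp
  have hFe : F = fun q => P q + q.1.1 ^ (j + 2) • R q := funext hF
  have hdF : ∀ w, dirDeriv (spaceDir w) F (π, (t, u)) = dirDeriv (spaceDir w) P (π, (t, u)) +
      π.1 ^ (j + 2) • dirDeriv (spaceDir w) R (π, (t, u)) := by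
    intro w
    rw [hFe, dirDeriv_add _ hPs (ContDiff.fun_smul (contDiff_size.pow _) hR), dirDeriv_spaceDir_size_smul _ _ hR]
  have horth' : ∀ w w', inner ℝ (dirDeriv (spaceDir w) P (π, (t, u)))
      (dirDeriv (spaceDir w') R (π, (t, u))) =
        -(π.1 ^ 2 * inner ℝ (dirDeriv (spaceDir w') (dirDeriv (spaceDir w) P₂) (π, (t, u)))
          (R (π, (t, u)))) := by
    intro w w'
    have h1 : dirDeriv (spaceDir w') (fun q => inner ℝ (dirDeriv (spaceDir w) P q) (R q))
        (π, (t, u)) = 0 := by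
      refine dirDeriv_eq_zero_of_eventually ((contDiff_dirDeriv _ hPs).inner ℝ hR) ?_
      have hc : Continuous fun s : ℝ => u + s • w' := by fun_prop
      have := hc.continuousAt.eventually (Metric.isOpen_ball.mem_nhds
        (show u + (0 : ℝ) • w' ∈ Metric.ball (0 : Euc m) 2 by rwa [zero_smul, add_zero]))
      filter_upwards [this] with s hs
      simpa [spaceDir] using horth _ hs w
    rw [dirDeriv_inner _ (contDiff_dirDeriv _ hPs) hR, hP.dirDeriv_dirDeriv hp,
      real_inner_smul_left] at h1
    linarith
  have hsymm : dirDeriv (spaceDir w') (dirDeriv (spaceDir w) P₂) (π, (t, u)) =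
    dirDeriv (spaceDir w) (dirDeriv (spaceDir w') P₂) (π, (t, u)) := dirDeriv_comm _ _ hP.1 _
  have h1 := horth' w w'
  have h2 := horth' w' w
  rw [hsymm] at h1
  rw [real_inner_comm] at h2
  simp only [metric, metricDefect, hdF, inner_add_left, inner_add_right, real_inner_smul_left,
    real_inner_smul_right, smul_eq_mul, h1, h2]
  ring

end ElementEstimates

section ElementEstimates

variable {m : ℕ} {T : ℝ} {Γ : EvolvingSurface m T} {p : ℝ × Euc (m + 1) → Euc (m + 1)}
  {f f₂ : ElementSpace m → Euc (m + 1)}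

/-- The estimates that compare a parametrised element `F` with its projection `P` to the surface,
for the data `q` of an element of size `η`, with constant `C` and relative error `ε`: both the
metrics and their time derivatives differ by `ε` relative to the metric. -/
structure IsClosePair (C ε : ℝ) (F P : ElementSpace m → Euc (m + 1)) (q : ElementSpace m) :
    Prop where
  metric_le : ∀ w w', |metric F w w' q - metric P w w' q| ≤
    ε * ‖dirDeriv (spaceDir w) P q‖ * ‖dirDeriv (spaceDir w') P q‖
  metricRate_le : ∀ w w', |metricRate F w w' q - metricRate P w w' q| ≤
    ε * ‖dirDeriv (spaceDir w) P q‖ * ‖dirDeriv (spaceDir w') P q‖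
  velocity_le : ∀ w, ‖dirDeriv (spaceDir w) (dirDeriv timeDir P) q‖ ≤
    C * ‖dirDeriv (spaceDir w) P q‖
  ne_zero : ∀ w, w ≠ 0 → dirDeriv (spaceDir w) P q ≠ 0
  ne_zero' : ∀ w, w ≠ 0 → dirDeriv (spaceDir w) F q ≠ 0

/-- The projection `P` of the curved elements to the surface is smooth in all data, and it is close to
the elements with the relative error `C η ^ (k + 1)`. -/
theorem exists_elementMap_isClosePair (Γ : EvolvingSurface m T) (hT : 0 < T) {δ : ℝ} (hδ : 0 < δ)
    (hp : IsProjection Γ δ p) {k : ℕ} (hk : k ≠ 0) {c : ℝ} (hc : 0 < c) :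
    ∃ η₀ > 0, ∃ C > 0, ∃ P : ElementSpace m → Euc (m + 1), ContDiff ℝ ∞ P ∧
      ∀ π, IsRegularData Γ η₀ c π → ∀ u ∈ Metric.ball (0 : Euc m) 2,
        dist (π.2.1 + π.1 • offset π.2.2 u) π.2.1 < δ ∧
        ∀ t ∈ Icc 0 T,
          P (π, (t, u)) ∈ Γ.surface t ∧
          closestPoint (Γ.surface t) (elementMap Γ p k (π, (t, u))) = P (π, (t, u)) ∧
          dist (elementMap Γ p k (π, (t, u))) (P (π, (t, u))) < δ ∧
          IsClosePair C (C * π.1 ^ (k + 1)) (elementMap Γ p k) P (π, (t, u)) := by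
  have hT0 := hT.le
  obtain ⟨j, rfl⟩ := Nat.exists_eq_succ_of_ne_zero hk
  obtain ⟨R₁, hR₁, hFΦ⟩ := exists_elementMap_eq_exactMap_add Γ hp.1 hk
  obtain ⟨R, hR, hpF⟩ := exists_sub_proj_elementMap Γ hp.1 hk
  obtain ⟨F₂, hF₂, hFe⟩ := exists_elementMap_expansion Γ hp.1 hk
  have hFexp : HasExpansion Γ p (elementMap Γ p (j + 1)) F₂ := ⟨hF₂, hFe⟩
  set F := elementMap Γ p (j + 1) with hFdef
  have hF : ContDiff ℝ ∞ F := contDiff_elementMap Γ hp.1 _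
  -- the projection of the element, written as the element minus its smooth distance vector
  let P : ElementSpace m → Euc (m + 1) := fun q => F q - q.1.1 ^ (j + 2) • R q
  let P₂ : ElementSpace m → Euc (m + 1) := fun q => F₂ q - q.1.1 ^ j • R q
  have hPexp : HasExpansion Γ p P P₂ := by
    refine ⟨hF₂.sub ((contDiff_size.pow j).fun_smul hR), fun q => ?_⟩
    simp only [P, P₂]
    rw [hFe, smul_sub, smul_smul, ← pow_add, add_comm 2 j, add_sub_assoc]
  have hP := hPexp.contDiff hp.1
  obtain ⟨C₁, hC₁, hb₁⟩ := exists_jet_bound Γ hR₁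
  obtain ⟨η₁, hη₁, hη₁1, C₂, hC₂, hb₂⟩ := hPexp.exists_le_norm_dirDeriv hT0 hδ hp hc
  obtain ⟨η₂, hη₂, hη₂1, C₃, hC₃, hb₃⟩ := hFexp.exists_le_norm_dirDeriv hT0 hδ hp hc
  obtain ⟨C₄, hC₄, hb₄⟩ := exists_metricDefect_bound Γ j hPexp.1 hR
  obtain ⟨C₅, hC₅, hb₅⟩ := hPexp.exists_velocity_bound hp.1
  obtain ⟨B, hB, hoff⟩ : ∃ B > 0, ∀ (ζ : Fin (m + 1) → Euc (m + 1)) (u : Euc m), ‖ζ‖ ≤ 1 →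
      ‖u‖ ≤ 2 → ‖offset ζ u‖ ≤ B := by
    refine ⟨(m + 1) * (1 + (m + 1) * 2), by positivity, fun ζ u hζ hu => ?_⟩
    refine (norm_offset_le hζ u).trans ?_
    gcongr
  refine ⟨min (min η₁ η₂) (min (δ / (2 * B)) (δ / (2 * (C₁ + 1)))),
    by positivity, C₄ * C₂ ^ 2 + C₅ * C₂ + 1, by positivity, P, hP, fun π hπ => ?_⟩
  have hπη := hπ.size_le
  simp only [le_min_iff] at hπη
  obtain ⟨⟨hη1, hη2⟩, hη3, hη4⟩ := hπη
  have hη := hπ.size_pos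
  have hηone : π.1 ≤ 1 := hη1.trans hη₁1
  have hπ1 : IsRegularData Γ 1 c π := { hπ with size_le := hηone }
  have hdist : ∀ u : Euc m, ‖u‖ ≤ 2 → dist (π.2.1 + π.1 • offset π.2.2 u) π.2.1 < δ := by
    intro u hu
    rw [dist_eq_norm, add_sub_cancel_left, norm_smul, Real.norm_eq_abs, abs_of_pos hη]
    have := hoff π.2.2 u hπ.norm_le hu
    calc π.1 * ‖offset π.2.2 u‖ ≤ δ / (2 * B) * B := by gcongr
      _ = δ / 2 := by field_simp
      _ < δ := by linarith
  have hexact : ∀ u : Euc m, ‖u‖ ≤ 2 → ∀ t ∈ Icc 0 T,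
      exactMap Γ p (π, (t, u)) ∈ Γ.surface t := fun u hu t ht =>
    mem_image_of_mem _ (hp.initial hT0 hπ.base_mem (hdist u hu)).2
  have hcpt := fun t => isCompact_surface Γ t
  have hvalid : ∀ u : Euc m, ‖u‖ ≤ 2 → ∀ t ∈ Icc 0 T, P (π, (t, u)) ∈ Γ.surface t ∧
      closestPoint (Γ.surface t) (F (π, (t, u))) = P (π, (t, u)) ∧
      (∀ y ∈ Γ.surface t, dist (F (π, (t, u))) (P (π, (t, u))) ≤ dist (F (π, (t, u))) y) ∧
      dist (F (π, (t, u))) (P (π, (t, u))) < δ := by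
    intro u hu t ht
    have hy := hexact u hu t ht
    have hd : dist (F (π, (t, u))) (exactMap Γ p (π, (t, u))) < δ := by
      rw [dist_eq_norm, hFΦ, add_sub_cancel_left, norm_smul, norm_pow, Real.norm_eq_abs,
        abs_of_pos hη]
      have h1 := (hb₁ _ (hπ1.mem_dataSet le_rfl ht hu)).1
      have h2 : π.1 ^ (j + 1 + 1) ≤ π.1 := pow_le_of_le_one hη.le hηone (by simp)
      calc π.1 ^ (j + 1 + 1) * ‖R₁ (π, (t, u))‖ ≤ π.1 * (C₁ + 1) := by
            gcongr; linarith
        _ ≤ δ / (2 * (C₁ + 1)) * (C₁ + 1) := by gcongr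
        _ = δ / 2 := by field_simp
        _ < δ := by linarith
    have h0 : exactMap Γ p (π, (t, u)) - p (t, exactMap Γ p (π, (t, u))) = 0 := by
      rw [← hp.2 t ht _ _ hy (by simpa using hδ), closestPoint_eq_self (hcpt t) hy, sub_self]
    have h1 : closestPoint (Γ.surface t) (F (π, (t, u))) = P (π, (t, u)) :=
      (hp.2 t ht _ _ hy hd).trans (hpF (π, (t, u)) h0)
    have h2 := closestPoint_spec (hcpt t) ⟨_, hy⟩ (F (π, (t, u)))
    rw [h1] at h2
    have h3 : ∀ y ∈ Γ.surface t, dist (F (π, (t, u))) (P (π, (t, u))) ≤ dist (F (π, (t, u))) y :=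
      fun y hy => h2.2.trans_le (Metric.infDist_le_dist_of_mem hy)
    exact ⟨h2.1, h1, h3, (h3 _ hy).trans_lt hd⟩
  -- the distance vector of a closest point is orthogonal to the surface
  have horth : ∀ t ∈ Icc 0 T, ∀ u ∈ Metric.ball (0 : Euc m) 2, ∀ w,
      inner ℝ (dirDeriv (spaceDir w) P (π, (t, u))) (R (π, (t, u))) = 0 := by
    intro t ht u hu w
    have h1 := (hvalid u (by simpa using (Metric.mem_ball.1 hu).le) t ht).2.2.1
    have hc : Continuous fun s : ℝ => u + s • w := by fun_prop
    have h2 := hc.continuousAt.eventually (Metric.isOpen_ball.mem_nhds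
        (show u + (0 : ℝ) • w ∈ Metric.ball (0 : Euc m) 2 by rwa [zero_smul, add_zero]))
    have h3 := inner_dirDeriv_eq_zero (v := spaceDir w) hP (x := (π, (t, u)))
      (y := F (π, (t, u))) (by
        filter_upwards [h2] with s hs
        have := (hvalid (u + s • w) (by simpa using (Metric.mem_ball.1 hs).le) t ht).1
        have e : ((π, (t, u)) : ElementSpace m) + s • spaceDir w = (π, (t, u + s • w)) := by
          simp [spaceDir]
        rw [e]
        exact h1 _ this)
    have e : F (π, (t, u)) - P (π, (t, u)) = π.1 ^ (j + 2) • R (π, (t, u)) := by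
      simp [P]
    rw [e, real_inner_smul_right] at h3
    exact (mul_eq_zero.1 h3).resolve_left (by positivity)
  have hmetric : ∀ t ∈ Icc 0 T, ∀ u ∈ Metric.ball (0 : Euc m) 2, ∀ w w',
      metric F w w' (π, (t, u)) - metric P w w' (π, (t, u)) =
        π.1 ^ (j + 4) • metricDefect j P₂ R w w' (π, (t, u)) := fun t ht u hu w w' =>
    metric_sub_metric_eq hp.1 j hR hPexp (fun q => by simp [P]) π t (horth t ht) hu w w'
  intro u hu
  have hu2 : ‖u‖ ≤ 2 := by simpa using (Metric.mem_ball.1 hu).le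
  refine ⟨hdist u hu2, fun t ht => ?_⟩
  obtain ⟨h1, h2, -, h4⟩ := hvalid u hu2 t ht
  have hq := hπ1.mem_dataSet le_rfl ht hu2
  have hlow := hb₂ π ({ hπ1 with size_le := hη1 }) t ht u hu2
  have hlow' := hb₃ π ({ hπ1 with size_le := hη2 }) t ht u hu2
  have key : ∀ x w w', |x| ≤ C₄ * ‖w‖ * ‖w'‖ → |π.1 ^ (j + 4) • x| ≤
      (C₄ * C₂ ^ 2 + C₅ * C₂ + 1) * π.1 ^ (j + 2) * ‖dirDeriv (spaceDir w) P (π, (t, u))‖ *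
        ‖dirDeriv (spaceDir w') P (π, (t, u))‖ := by
    intro x w w' hx
    rw [smul_eq_mul, abs_mul, abs_of_pos (by positivity)]
    calc π.1 ^ (j + 4) * |x| ≤ π.1 ^ (j + 4) * (C₄ * ‖w‖ * ‖w'‖) := by gcongr
      _ = C₄ * π.1 ^ (j + 2) * ((π.1 * ‖w‖) * (π.1 * ‖w'‖)) := by ring
      _ ≤ C₄ * π.1 ^ (j + 2) * ((C₂ * ‖dirDeriv (spaceDir w) P (π, (t, u))‖) *
          (C₂ * ‖dirDeriv (spaceDir w') P (π, (t, u))‖)) := by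
          exact mul_le_mul_of_nonneg_left (mul_le_mul (hlow w) (hlow w') (by positivity)
            (by positivity)) (by positivity)
      _ = (C₄ * C₂ ^ 2) * (π.1 ^ (j + 2) * (‖dirDeriv (spaceDir w) P (π, (t, u))‖ *
          ‖dirDeriv (spaceDir w') P (π, (t, u))‖)) := by ring
      _ ≤ (C₄ * C₂ ^ 2 + C₅ * C₂ + 1) * (π.1 ^ (j + 2) * (‖dirDeriv (spaceDir w) P (π, (t, u))‖ *
          ‖dirDeriv (spaceDir w') P (π, (t, u))‖)) := by
          gcongr
          have : 0 ≤ C₅ * C₂ := by positivity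
          linarith
      _ = _ := by ring
  have hne : ∀ C > 0, ∀ f : ElementSpace m → Euc (m + 1),
      (∀ w, π.1 * ‖w‖ ≤ C * ‖dirDeriv (spaceDir w) f (π, (t, u))‖) → ∀ w, w ≠ 0 →
        dirDeriv (spaceDir w) f (π, (t, u)) ≠ 0 := by
    intro C hC f hf w hw h0
    have := hf w
    rw [h0, norm_zero, mul_zero] at this
    have : 0 < π.1 * ‖w‖ := by positivity
    linarith
  refine ⟨h1, h2, h4, fun w w' => ?_, fun w w' => ?_, fun w => ?_, hne C₂ hC₂ P hlow,
    hne C₃ hC₃ F hlow'⟩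
  · rw [hmetric t ht u hu]
    exact key _ _ _ (hb₄ _ hq w w').1
  · rw [← dirDeriv_metric hF, ← dirDeriv_metric hP,
      ← dirDeriv_sub _ (contDiff_metric hF w w') (contDiff_metric hP w w'),
      dirDeriv_timeDir_congr hT ((contDiff_metric hF w w').sub (contDiff_metric hP w w'))
        ((contDiff_size.pow (j + 4)).fun_smul (contDiff_metricDefect j hPexp.1 hR w w')) ht
        (fun s hs => hmetric s hs u hu w w'), dirDeriv_timeDir_size_smul _
          (contDiff_metricDefect j hPexp.1 hR w w')]
    exact key _ _ _ (hb₄ _ hq w w').2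
  · refine (hb₅ _ hq w).trans ?_
    rw [mul_assoc]
    calc C₅ * (π.1 * ‖w‖) ≤ C₅ * (C₂ * ‖dirDeriv (spaceDir w) P (π, (t, u))‖) :=
          mul_le_mul_of_nonneg_left (hlow w) hC₅
      _ = (C₅ * C₂) * ‖dirDeriv (spaceDir w) P (π, (t, u))‖ := by ring
      _ ≤ _ := by
          gcongr
          have : 0 ≤ C₄ * C₂ ^ 2 := by positivity
          linarith

end ElementEstimates

/-! ### Gradient and divergence of a parametrised surface at a point -/

section LinearAlgebra

variable {U E : Type} [NormedAddCommGroup U] [InnerProductSpace ℝ U] [FiniteDimensional ℝ U]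
  [NormedAddCommGroup E] [InnerProductSpace ℝ E] [FiniteDimensional ℝ E]

/-- If `A` is the differential of a parametrisation and `l` that of a function in the parameters,
then `A (gradCoeff A l)` is the tangential gradient of the function. -/
def gradCoeff (A : U →L[ℝ] E) (l : U →L[ℝ] ℝ) : U :=
  Ring.inverse (ContinuousLinearMap.adjoint A ∘L A) ((InnerProductSpace.toDual ℝ U).symm l)

theorem isUnit_adjoint_comp_self {A : U →L[ℝ] E} (hA : Function.Injective A) :
    IsUnit (ContinuousLinearMap.adjoint A ∘L A) := by
  have hinj : Function.Injective (ContinuousLinearMap.adjoint A ∘L A) := by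
    rw [injective_iff_map_eq_zero]
    intro w hw
    have : inner ℝ (A w) (A w) = 0 := by
      rw [← ContinuousLinearMap.adjoint_inner_left]
      simp only [ContinuousLinearMap.comp_apply] at hw
      rw [hw, inner_zero_left]
    exact hA (by rw [inner_self_eq_zero.1 this, map_zero])
  rw [ContinuousLinearMap.isUnit_iff_bijective]
  exact ⟨hinj, (LinearMap.injective_iff_surjective
    (f := (ContinuousLinearMap.adjoint A ∘L A).toLinearMap)).1 hinj⟩

theorem inner_gradCoeff {A : U →L[ℝ] E} (hA : Function.Injective A) (l : U →L[ℝ] ℝ) (w : U) :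
    inner ℝ (A (gradCoeff A l)) (A w) = l w := by
  rw [← ContinuousLinearMap.adjoint_inner_left]
  have h := Ring.mul_inverse_cancel _ (isUnit_adjoint_comp_self hA)
  have h2 := DFunLike.congr_fun h ((InnerProductSpace.toDual ℝ U).symm l)
  change ContinuousLinearMap.adjoint A (A (gradCoeff A l)) = _ at h2
  rw [h2]
  simp

theorem continuousAt_gradCoeff {A : U →L[ℝ] E} (hA : Function.Injective A) (l : U →L[ℝ] ℝ) :
    ContinuousAt (fun q : (U →L[ℝ] E) × (U →L[ℝ] ℝ) => gradCoeff q.1 q.2) (A, l) := by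
  obtain ⟨v, hv⟩ := isUnit_adjoint_comp_self hA
  have h1 : ContinuousAt (fun q : (U →L[ℝ] E) × (U →L[ℝ] ℝ) =>
      ContinuousLinearMap.adjoint q.1 ∘L q.1) (A, l) := by
    refine ContinuousAt.clm_comp ?_ continuousAt_fst
    exact (ContinuousLinearMap.adjoint (𝕜 := ℝ) (E := U) (F := E)).continuous.continuousAt.comp
      continuousAt_fst
  have h2 : ContinuousAt (fun q : (U →L[ℝ] E) × (U →L[ℝ] ℝ) =>
      Ring.inverse (ContinuousLinearMap.adjoint q.1 ∘L q.1)) (A, l) := by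
    refine ContinuousAt.comp (g := Ring.inverse) ?_ h1
    have := NormedRing.inverse_continuousAt v
    rw [hv] at this
    exact this
  exact h2.clm_apply ((InnerProductSpace.toDual ℝ U).symm.continuous.continuousAt.comp
    continuousAt_snd)

/-- The relative difference of two metrics changes gradients accordingly. -/
theorem norm_map_gradCoeff_sub_le {A A' : U →L[ℝ] E} (hA : Function.Injective A)
    (hA' : Function.Injective A') {ε : ℝ} (hε : ε ≤ 1 / 2)
    (hm : ∀ w w', |inner ℝ (A' w) (A' w') - inner ℝ (A w) (A w')| ≤ ε * ‖A w‖ * ‖A w'‖)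
    (l : U →L[ℝ] ℝ) : ‖A (gradCoeff A' l)‖ ≤ 2 * ‖A (gradCoeff A l)‖ ∧
      ‖A (gradCoeff A l - gradCoeff A' l)‖ ≤ ε * ‖A (gradCoeff A' l)‖ := by
  set a := gradCoeff A l
  set a' := gradCoeff A' l
  have h1 : inner ℝ (A (a - a')) (A (a - a')) =
      inner ℝ (A' a') (A' (a - a')) - inner ℝ (A a') (A (a - a')) := by
    rw [inner_gradCoeff hA', ← inner_gradCoeff hA, ← inner_sub_left, ← map_sub]
  have h2 := (le_abs_self _).trans (hm a' (a - a'))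
  rw [← h1, real_inner_self_eq_norm_sq] at h2
  have h3 : ‖A (a - a')‖ ≤ ε * ‖A a'‖ := by
    rcases (norm_nonneg (A (a - a'))).eq_or_lt with h0 | h0
    · rw [← h0]
      by_contra hneg
      push Not at hneg
      have hlt : 0 < ‖A a'‖ := (norm_nonneg _).lt_of_ne fun h => by rw [← h] at hneg; simp at hneg
      have := (abs_nonneg _).trans (hm a' a')
      nlinarith
    · nlinarith
  refine ⟨?_, h3⟩
  have h4 : ‖A a'‖ ≤ ‖A a‖ + ‖A (a - a')‖ := by
    rw [map_sub, norm_sub_rev]; exact norm_le_norm_add_norm_sub' _ _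
  nlinarith [norm_nonneg (A a')]

theorem abs_inner_gradCoeff_sub_le {A A' : U →L[ℝ] E} (hA : Function.Injective A)
    (hA' : Function.Injective A') {ε : ℝ} (hε0 : 0 ≤ ε) (hε : ε ≤ 1 / 2)
    (hm : ∀ w w', |inner ℝ (A' w) (A' w') - inner ℝ (A w) (A w')| ≤ ε * ‖A w‖ * ‖A w'‖)
    (l l' : U →L[ℝ] ℝ) :
    |inner ℝ (A (gradCoeff A l)) (A (gradCoeff A l')) -
        inner ℝ (A' (gradCoeff A' l)) (A' (gradCoeff A' l'))| ≤
      2 * ε * ‖A (gradCoeff A l)‖ * ‖A (gradCoeff A l')‖ := by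
  have h1 : inner ℝ (A (gradCoeff A l)) (A (gradCoeff A l')) -
        inner ℝ (A' (gradCoeff A' l)) (A' (gradCoeff A' l')) =
      inner ℝ (A' (gradCoeff A' l')) (A' (gradCoeff A l)) -
        inner ℝ (A (gradCoeff A' l')) (A (gradCoeff A l)) := by
    rw [inner_gradCoeff hA, inner_gradCoeff hA', inner_gradCoeff hA',
      real_inner_comm (A (gradCoeff A l)) (A (gradCoeff A' l')), inner_gradCoeff hA,
      ← inner_gradCoeff hA l' (gradCoeff A l), real_inner_comm, inner_gradCoeff hA]
  rw [h1]
  refine (hm _ _).trans ?_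
  have := (norm_map_gradCoeff_sub_le hA hA' hε hm l').1
  calc ε * ‖A (gradCoeff A' l')‖ * ‖A (gradCoeff A l)‖
      ≤ ε * (2 * ‖A (gradCoeff A l')‖) * ‖A (gradCoeff A l)‖ := by gcongr
    _ = _ := by ring

end LinearAlgebra

section Divergence

variable {U : Type} [NormedAddCommGroup U] [InnerProductSpace ℝ U] [FiniteDimensional ℝ U] {n : ℕ}

/-- The tangential divergence of a vector field with differential `B` in the parameters. -/
def paramDiv (A B : U →L[ℝ] Euc n) : ℝ :=
  ∑ i, A (gradCoeff A (EuclideanSpace.proj i ∘L B)) i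

/-- A basis of the parameter space which `A` maps to an orthonormal system. -/
theorem exists_adapted_basis {A : U →L[ℝ] Euc n} (hA : Function.Injective A) :
    ∃ w : Fin (Module.finrank ℝ U) → U, (∀ i, ‖A (w i)‖ = 1) ∧
      ∀ a, ∑ i, inner ℝ (A (w i)) (A a) • w i = a := by
  have hr : Module.finrank ℝ A.toLinearMap.range = Module.finrank ℝ U :=
    LinearMap.finrank_range_of_inj hA
  let b := (stdOrthonormalBasis ℝ A.toLinearMap.range).reindex (finCongr hr)
  choose w hw using fun i => (b i).2
  have hw' : ∀ i, A (w i) = b i := hw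
  refine ⟨w, fun i => ?_, fun a => hA ?_⟩
  · rw [hw']
    exact b.orthonormal.1 i
  · have h := congrArg Subtype.val (b.sum_repr' ⟨A a, a, rfl⟩)
    rw [map_sum]
    simp only [map_smul, hw']
    simpa using h

theorem inner_euc (x y : Euc n) : inner ℝ x y = ∑ i, x i * y i := by
  simp [PiLp.inner_apply, mul_comm]

theorem paramDiv_eq_sum {A : U →L[ℝ] Euc n} (hA : Function.Injective A) (B : U →L[ℝ] Euc n)
    {ι : Type} [Fintype ι] {w : ι → U} (hw : ∀ a, ∑ α, inner ℝ (A (w α)) (A a) • w α = a) :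
    paramDiv A B = ∑ α, inner ℝ (B (w α)) (A (w α)) := by
  have h : ∀ i, A (gradCoeff A (EuclideanSpace.proj i ∘L B)) i =
      ∑ α, (B (w α)) i * (A (w α)) i := by
    intro i
    conv_lhs => rw [← hw (gradCoeff A (EuclideanSpace.proj i ∘L B))]
    rw [map_sum]
    simp only [real_inner_comm (A (gradCoeff A (EuclideanSpace.proj i ∘L B))), map_smul,
      WithLp.ofLp_sum, Finset.sum_apply, PiLp.smul_apply, smul_eq_mul]
    refine Finset.sum_congr rfl fun α _ => ?_
    rw [inner_gradCoeff hA]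
    rfl
  simp only [paramDiv, h, inner_euc]
  exact Finset.sum_comm

theorem abs_paramDiv_le {A B : U →L[ℝ] Euc n} (hA : Function.Injective A) {C : ℝ}
    (hB : ∀ w, ‖B w‖ ≤ C * ‖A w‖) : |paramDiv A B| ≤ Module.finrank ℝ U * C := by
  obtain ⟨w, hw1, hw⟩ := exists_adapted_basis hA
  rw [paramDiv_eq_sum hA B hw]
  refine (Finset.abs_sum_le_sum_abs _ _).trans ?_
  have : ∀ α ∈ Finset.univ, |inner ℝ (B (w α)) (A (w α))| ≤ C := by
    intro α _
    refine (abs_real_inner_le_norm _ _).trans ?_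
    have := hB (w α)
    rw [hw1, mul_one] at this ⊢
    exact this
  refine (Finset.sum_le_sum this).trans ?_
  simp

/-- Two parametrised surfaces whose metrics, and the rates of change of these metrics, are relatively
close have close divergences of their velocities. The trace that defines the divergence on the first
surface is evaluated in a basis which is orthonormal for the second one. -/
theorem abs_paramDiv_sub_le {A A' B B' : U →L[ℝ] Euc n} (hA : Function.Injective A)
    (hA' : Function.Injective A') {ε C : ℝ} (hε0 : 0 ≤ ε) (hε : ε ≤ 1 / 2) (hC : 0 ≤ C)
    (hm : ∀ w w', |inner ℝ (A' w) (A' w') - inner ℝ (A w) (A w')| ≤ ε * ‖A w‖ * ‖A w'‖)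
    (hr : ∀ w w', |(inner ℝ (B' w) (A' w') + inner ℝ (A' w) (B' w')) -
      (inner ℝ (B w) (A w') + inner ℝ (A w) (B w'))| ≤ ε * ‖A w‖ * ‖A w'‖)
    (hB : ∀ w, ‖B w‖ ≤ C * ‖A w‖) :
    |paramDiv A B - paramDiv A' B'| ≤ Module.finrank ℝ U * ((1 + 2 * C) * ε) := by
  obtain ⟨w, hw1, hw⟩ := exists_adapted_basis hA'
  let a : Fin n → U := fun i => gradCoeff A (EuclideanSpace.proj i ∘L B)
  -- `x α` represents the functional `⟨A (w α), B ·⟩` in the metric of `A`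
  let x : Fin (Module.finrank ℝ U) → U := fun α => ∑ i, (A (w α)) i • a i
  have hx : ∀ α v, inner ℝ (A (x α)) (A v) = inner ℝ (A (w α)) (B v) := by
    intro α v
    simp only [x, map_sum, map_smul, sum_inner, real_inner_smul_left]
    rw [inner_euc]
    refine Finset.sum_congr rfl fun i _ => ?_
    rw [inner_gradCoeff hA]
    rfl
  have hdiv : paramDiv A B = ∑ α, inner ℝ (A' (x α)) (A' (w α)) := by
    have h : ∀ i, A (a i) i = ∑ α, inner ℝ (A' (w α)) (A' (a i)) * (A (w α)) i := by
      intro i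
      conv_lhs => rw [← hw (a i)]
      rw [map_sum]
      simp
    have h2 : paramDiv A B = ∑ i, A (a i) i := rfl
    simp only [h2, h, x, map_sum, map_smul, sum_inner, real_inner_smul_left]
    rw [Finset.sum_comm]
    refine Finset.sum_congr rfl fun α _ => Finset.sum_congr rfl fun i _ => ?_
    rw [real_inner_comm, mul_comm]
  have hAw : ∀ α, ‖A (w α)‖ ^ 2 ≤ 2 := by
    intro α
    have h := (abs_le.1 (hm (w α) (w α))).1
    rw [real_inner_self_eq_norm_sq, real_inner_self_eq_norm_sq, hw1, mul_assoc, ← pow_two] at h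
    nlinarith [sq_nonneg ‖A (w α)‖]
  have hAx : ∀ α, ‖A (x α)‖ ≤ C * ‖A (w α)‖ := by
    intro α
    have h1 := hx α (x α)
    rw [real_inner_self_eq_norm_sq] at h1
    have h2 := (le_abs_self _).trans (abs_real_inner_le_norm (A (w α)) (B (x α)))
    have h3 := mul_le_mul_of_nonneg_left (hB (x α)) (norm_nonneg (A (w α)))
    rcases (norm_nonneg (A (x α))).eq_or_lt with h0 | h0
    · rw [← h0]; positivity
    · nlinarith
  rw [hdiv, paramDiv_eq_sum hA' B' hw, ← Finset.sum_sub_distrib]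
  refine (Finset.abs_sum_le_sum_abs _ _).trans ?_
  have hterm : ∀ α ∈ Finset.univ, |inner ℝ (A' (x α)) (A' (w α)) -
      inner ℝ (B' (w α)) (A' (w α))| ≤ (1 + 2 * C) * ε := by
    intro α _
    have h1 := hm (x α) (w α)
    have h2 := hr (w α) (w α)
    rw [hx] at h1
    rw [real_inner_comm (B' (w α)) (A' (w α)), real_inner_comm (B (w α)) (A (w α))] at h2
    rw [real_inner_comm (B (w α)) (A (w α))] at h1
    have h3 : ε * ‖A (x α)‖ * ‖A (w α)‖ ≤ 2 * C * ε := by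
      calc ε * ‖A (x α)‖ * ‖A (w α)‖ ≤ ε * (C * ‖A (w α)‖) * ‖A (w α)‖ := by
            gcongr; exact hAx α
        _ = ε * C * ‖A (w α)‖ ^ 2 := by ring
        _ ≤ ε * C * 2 := by gcongr; exact hAw α
        _ = _ := by ring
    have h4 : ε * ‖A (w α)‖ * ‖A (w α)‖ ≤ 2 * ε := by
      rw [mul_assoc, ← pow_two]
      nlinarith [hAw α]
    rw [abs_le] at h1 h2 ⊢
    constructor <;> nlinarith [h1.1, h1.2, h2.1, h2.2]
  refine (Finset.sum_le_sum hterm).trans ?_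
  simp

/-- The integrand of the form `b` in terms of the parametrisation: the contribution of the
symmetrised gradient of the velocity is the rate of change of the metric. -/
def paramTensor (A B : U →L[ℝ] Euc n) (a b : U) : ℝ :=
  paramDiv A B * inner ℝ (A a) (A b) - (inner ℝ (B a) (A b) + inner ℝ (A a) (B b))

theorem abs_paramTensor_le {A B : U →L[ℝ] Euc n} (hA : Function.Injective A) {C : ℝ} (hC : 0 ≤ C)
    (hB : ∀ w, ‖B w‖ ≤ C * ‖A w‖) (a b : U) :
    |paramTensor A B a b| ≤ (Module.finrank ℝ U * C + 2 * C) * ‖A a‖ * ‖A b‖ := by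
  have h1 := abs_paramDiv_le hA hB
  have h2 := abs_real_inner_le_norm (A a) (A b)
  have h3 : |inner ℝ (B a) (A b)| ≤ C * ‖A a‖ * ‖A b‖ :=
    (abs_real_inner_le_norm _ _).trans (by gcongr; exact hB a)
  have h4 : |inner ℝ (A a) (B b)| ≤ C * ‖A a‖ * ‖A b‖ :=
    (abs_real_inner_le_norm _ _).trans ((mul_le_mul_of_nonneg_left (hB b) (norm_nonneg _)).trans_eq
      (by ring))
  have h5 : |paramDiv A B * inner ℝ (A a) (A b)| ≤ Module.finrank ℝ U * C * (‖A a‖ * ‖A b‖) := by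
    rw [abs_mul]; gcongr
  refine (abs_sub _ _).trans ?_
  refine (add_le_add h5 ((abs_add_le _ _).trans (add_le_add h3 h4))).trans_eq ?_
  ring

theorem abs_paramTensor_sub_le {A A' B B' : U →L[ℝ] Euc n} (hA : Function.Injective A)
    (hA' : Function.Injective A') {ε C : ℝ} (hε0 : 0 ≤ ε) (hε : ε ≤ 1 / 2) (hC : 0 ≤ C)
    (hm : ∀ w w', |inner ℝ (A' w) (A' w') - inner ℝ (A w) (A w')| ≤ ε * ‖A w‖ * ‖A w'‖)
    (hr : ∀ w w', |(inner ℝ (B' w) (A' w') + inner ℝ (A' w) (B' w')) -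
      (inner ℝ (B w) (A w') + inner ℝ (A w) (B w'))| ≤ ε * ‖A w‖ * ‖A w'‖)
    (hB : ∀ w, ‖B w‖ ≤ C * ‖A w‖) (l l' : U →L[ℝ] ℝ) :
    |paramTensor A B (gradCoeff A l) (gradCoeff A l') -
        paramTensor A' B' (gradCoeff A' l) (gradCoeff A' l')| ≤
      (2 * Module.finrank ℝ U * (1 + 3 * C) + 12 * C + 4) * ε *
        ‖A (gradCoeff A l)‖ * ‖A (gradCoeff A l')‖ := by
  set a := gradCoeff A l
  set b := gradCoeff A l'
  set a' := gradCoeff A' l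
  set b' := gradCoeff A' l'
  have i1 := abs_paramDiv_sub_le hA hA' hε0 hε hC hm hr hB
  have i2 := abs_paramDiv_le hA hB
  have i3 := abs_inner_gradCoeff_sub_le hA hA' hε0 hε hm l l'
  obtain ⟨j1, j2⟩ := norm_map_gradCoeff_sub_le hA hA' hε hm l
  obtain ⟨j3, j4⟩ := norm_map_gradCoeff_sub_le hA hA' hε hm l'
  have i4 : |inner ℝ (A' a') (A' b')| ≤ 2 * (‖A a‖ * ‖A b‖) := by
    have h1 := abs_real_inner_le_norm (A a) (A b)
    have h2 : 2 * ε * ‖A a‖ * ‖A b‖ ≤ ‖A a‖ * ‖A b‖ := by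
      have : 2 * ε ≤ 1 := by linarith
      calc 2 * ε * ‖A a‖ * ‖A b‖ ≤ 1 * ‖A a‖ * ‖A b‖ := by gcongr
        _ = _ := by ring
    have h3 : inner ℝ (A' a') (A' b') = inner ℝ (A a) (A b) -
      (inner ℝ (A a) (A b) - inner ℝ (A' a') (A' b')) := by ring
    rw [h3]
    refine (abs_sub _ _).trans ?_
    linarith
  have k1 : |paramDiv A B * inner ℝ (A a) (A b) - paramDiv A' B' * inner ℝ (A' a') (A' b')| ≤
      Module.finrank ℝ U * C * (2 * ε * ‖A a‖ * ‖A b‖) +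
        Module.finrank ℝ U * ((1 + 2 * C) * ε) * (2 * (‖A a‖ * ‖A b‖)) := by
    have : paramDiv A B * inner ℝ (A a) (A b) - paramDiv A' B' * inner ℝ (A' a') (A' b') =
        paramDiv A B * (inner ℝ (A a) (A b) - inner ℝ (A' a') (A' b')) +
          (paramDiv A B - paramDiv A' B') * inner ℝ (A' a') (A' b') := by ring
    rw [this]
    refine (abs_add_le _ _).trans ?_
    rw [abs_mul, abs_mul]
    gcongr
  have hlip : ∀ v v', |inner ℝ (B v) (A v')| ≤ C * ‖A v‖ * ‖A v'‖ := fun v v' =>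
    (abs_real_inner_le_norm _ _).trans (by gcongr; exact hB v)
  have hdiff : ∀ v v', |inner ℝ (B v) (A v') + inner ℝ (A v) (B v')| ≤ 2 * C * ‖A v‖ * ‖A v'‖ := by
    intro v v'
    have h1 := hlip v v'
    have h2 := hlip v' v
    rw [real_inner_comm] at h2
    refine (abs_add_le _ _).trans ?_
    linarith
  have k2 : |(inner ℝ (B a) (A b) + inner ℝ (A a) (B b)) -
      (inner ℝ (B a') (A b') + inner ℝ (A a') (B b'))| ≤ 12 * C * ε * (‖A a‖ * ‖A b‖) := by
    have e : (inner ℝ (B a) (A b) + inner ℝ (A a) (B b)) -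
        (inner ℝ (B a') (A b') + inner ℝ (A a') (B b')) =
        (inner ℝ (B (a - a')) (A b) + inner ℝ (A (a - a')) (B b)) +
          (inner ℝ (B a') (A (b - b')) + inner ℝ (A a') (B (b - b'))) := by
      simp only [map_sub, inner_sub_left, inner_sub_right]; ring
    rw [e]
    refine (abs_add_le _ _).trans ?_
    have h1 : 2 * C * ‖A (a - a')‖ * ‖A b‖ ≤ 2 * C * (ε * (2 * ‖A a‖)) * ‖A b‖ := by
      gcongr; exact j2.trans (by gcongr)
    have h2 : 2 * C * ‖A a'‖ * ‖A (b - b')‖ ≤ 2 * C * (2 * ‖A a‖) * (ε * (2 * ‖A b‖)) := by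
      gcongr; exact j4.trans (by gcongr)
    have := hdiff (a - a') b
    have := hdiff a' (b - b')
    linarith
  have k3 : |(inner ℝ (B' a') (A' b') + inner ℝ (A' a') (B' b')) -
      (inner ℝ (B a') (A b') + inner ℝ (A a') (B b'))| ≤ 4 * ε * (‖A a‖ * ‖A b‖) := by
    refine (hr a' b').trans ?_
    calc ε * ‖A a'‖ * ‖A b'‖ ≤ ε * (2 * ‖A a‖) * (2 * ‖A b‖) := by gcongr
      _ = _ := by ring
  rw [abs_le] at k1 k2 k3 ⊢
  simp only [paramTensor]
  constructor <;> linarith [k1.1, k1.2, k2.1, k2.2, k3.1, k3.2]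

end Divergence

/-! ### Tangential derivatives in a local parametrisation -/

section LocalParam

variable {m n : ℕ}

/-- `G` is, near `u`, a regular parametrisation of a relative neighbourhood of `G u` in `S`, with
differential `A` at `u`. -/
structure IsLocalParam (S : Set (Euc n)) (G : Euc m → Euc n) (A : Euc m →L[ℝ] Euc n) (u : Euc m) :
    Prop where
  hasFDerivAt : HasFDerivAt G A u
  injective : Function.Injective A
  map_nhds : map G (𝓝 u) = 𝓝[S] (G u)

/-- A parametrisation of a compact piece of `S` is a local parametrisation at an interior point
which is attained only once, and not on the rest of `S`. -/
theorem map_nhds_eq_of_isCompact {X Y : Type} [TopologicalSpace X] [TopologicalSpace Y] [T2Space Y]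
    {S Z : Set Y} {K : Set X} (hK : IsCompact K) {G : X → Y} (hG : Continuous G)
    {u : X} (hS : ∀ᶠ v in 𝓝 u, G v ∈ S) (hcover : S ⊆ G '' K ∪ Z) (hZ : IsClosed Z)
    (huZ : G u ∉ Z) (hinj : ∀ v ∈ K, G v = G u → v = u) : map G (𝓝 u) = 𝓝[S] (G u) := by
  refine le_antisymm (tendsto_nhdsWithin_iff.2 ⟨hG.continuousAt, hS⟩) ?_
  intro W hW
  obtain ⟨V, hVW, hV, huV⟩ := mem_nhds_iff.1 (mem_map.1 hW)
  have hc : IsClosed (G '' (K \ V) ∪ Z) := ((hK.diff hV).image hG).isClosed.union hZ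
  have hmem : G u ∈ (G '' (K \ V) ∪ Z)ᶜ := by
    rintro (⟨v, ⟨hvK, hvV⟩, hv⟩ | h)
    · exact hvV (hinj v hvK hv ▸ huV)
    · exact huZ h
  filter_upwards [mem_nhdsWithin_of_mem_nhds (hc.isOpen_compl.mem_nhds hmem),
    self_mem_nhdsWithin] with y hy hyS
  rcases hcover hyS with ⟨v, hvK, rfl⟩ | h
  · by_cases hvV : v ∈ V
    · exact hVW hvV
    · exact absurd (Or.inl ⟨v, ⟨hvK, hvV⟩, rfl⟩) hy
  · exact absurd (Or.inr h) hy

variable {S : Set (Euc n)} {G : Euc m → Euc n} {A : Euc m →L[ℝ] Euc n} {u : Euc m}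

theorem exists_leftInverse (hA : Function.Injective A) :
    ∃ L : Euc n →L[ℝ] Euc m, ∀ w, L (A w) = w := by
  refine ⟨Ring.inverse (ContinuousLinearMap.adjoint A ∘L A) ∘L ContinuousLinearMap.adjoint A,
    fun w => ?_⟩
  exact DFunLike.congr_fun (Ring.inverse_mul_cancel _ (isUnit_adjoint_comp_self hA)) w

theorem IsLocalParam.eventually_mem (h : IsLocalParam S G A u) : ∀ᶠ v in 𝓝 u, G v ∈ S := by
  have : S ∈ map G (𝓝 u) := by rw [h.map_nhds]; exact self_mem_nhdsWithin
  exact this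

theorem IsLocalParam.isBigO_sub_rev (h : IsLocalParam S G A u) :
    (fun v => v - u) =O[𝓝 u] fun v => G v - G u := by
  obtain ⟨C, -, hC⟩ := A.toLinearMap.exists_antilipschitzWith (LinearMap.ker_eq_bot.2 h.injective)
  have h1 : (fun v => v - u) =O[𝓝 u] fun v => A (v - u) :=
    Asymptotics.IsBigO.of_bound C (Eventually.of_forall fun v => by
      simpa [dist_eq_norm] using hC.le_mul_dist (v - u) 0)
  have h2 : (fun v => G v - G u - A (v - u)) =o[𝓝 u] fun v => A (v - u) :=
    h.hasFDerivAt.isLittleO.trans_isBigO h1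
  have h3 := h2.right_isBigO_add
  simp only [sub_add_cancel] at h3
  exact h1.trans h3

/-- Functions on `S` that are differentiable in the parameters are differentiable within `S`. -/
theorem IsLocalParam.hasFDerivWithinAt {F : Type} [NormedAddCommGroup F] [NormedSpace ℝ F]
    (h : IsLocalParam S G A u) {f : Euc n → F} {fh : Euc m → F} {f' : Euc m →L[ℝ] F}
    (hf : HasFDerivAt fh f' u) (hfh : ∀ᶠ v in 𝓝 u, f (G v) = fh v) {L : Euc n →L[ℝ] Euc m}
    (hL : ∀ w, L (A w) = w) : HasFDerivWithinAt f (f' ∘L L) S (G u) := by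
  rw [hasFDerivWithinAt_iff_isLittleO, ← h.map_nhds, Asymptotics.isLittleO_map]
  have hu : f (G u) = fh u := hfh.self_of_nhds
  have h1 : (fun v => fh v - fh u - f' (v - u)) =o[𝓝 u] fun v => v - u := hf.isLittleO
  have h2 : (fun v => f' (L (G v - G u - A (v - u)))) =o[𝓝 u] fun v => v - u :=
    ((f' ∘L L).isBigO_comp _ _).trans_isLittleO h.hasFDerivAt.isLittleO
  refine ((h1.sub h2).trans_isBigO h.isBigO_sub_rev).congr' ?_ EventuallyEq.rfl
  filter_upwards [hfh] with v hv
  simp only [Function.comp_apply, hv, hu, ContinuousLinearMap.comp_apply, map_sub, hL]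
  abel

theorem IsLocalParam.tangentSpaceAt_eq (h : IsLocalParam S G A u) :
    tangentSpaceAt S (G u) = A.toLinearMap.range := by
  refine le_antisymm (Submodule.span_le.2 fun v hv => ?_) ?_
  · obtain ⟨L, hL⟩ := exists_leftInverse h.injective
    have h1 : HasFDerivWithinAt (fun x => x) (A ∘L L) S (G u) :=
      h.hasFDerivWithinAt (f := fun x => x) h.hasFDerivAt (Eventually.of_forall fun _ => rfl) hL
    have h2 := h1.unique_on (hasFDerivWithinAt_id _ _) hv
    exact ⟨L v, h2⟩
  · rintro _ ⟨w, rfl⟩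
    refine Submodule.subset_span ?_
    have h1 := h.hasFDerivAt.hasFDerivWithinAt (s := G ⁻¹' S) |>.mapsTo_tangent_cone
    rw [tangentConeAt_of_mem_nhds (s := G ⁻¹' S) h.eventually_mem] at h1
    exact tangentConeAt_mono (image_preimage_subset _ _) (h1 (mem_univ w))

theorem IsLocalParam.tgrad_eq (h : IsLocalParam S G A u) {f : Euc n → ℝ} {fh : Euc m → ℝ}
    {f' : Euc m →L[ℝ] ℝ} (hf : HasFDerivAt fh f' u) (hfh : ∀ᶠ v in 𝓝 u, f (G v) = fh v) :
    tgrad S f (G u) = A (gradCoeff A f') := by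
  obtain ⟨L, hL⟩ := exists_leftInverse h.injective
  have h1 := (h.hasFDerivWithinAt hf hfh hL).differentiableWithinAt.hasFDerivWithinAt
  have h2 : HasFDerivAt (f ∘ G) _ u := h1.comp_hasFDerivAt u h.hasFDerivAt h.eventually_mem
  have h3 := h2.unique (hf.congr_of_eventuallyEq hfh)
  set D := fderivWithin ℝ f S (G u)
  refine Submodule.eq_starProjection_of_mem_of_inner_eq_zero
    (by rw [h.tangentSpaceAt_eq]; exact ⟨_, rfl⟩) fun y hy => ?_
  rw [h.tangentSpaceAt_eq] at hy
  obtain ⟨w, rfl⟩ := hy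
  have h4 : D (A w) = f' w := DFunLike.congr_fun h3 w
  change inner ℝ (_ - A (gradCoeff A f')) (A w) = 0
  rw [inner_sub_left, inner_gradCoeff h.injective, InnerProductSpace.toDual_symm_apply, h4,
    sub_self]

theorem IsLocalParam.tderiv_eq (h : IsLocalParam S G A u) {W : Euc n → Euc n}
    {Wh : Euc m → Euc n} {B : Euc m →L[ℝ] Euc n} (hW : HasFDerivAt Wh B u)
    (hWh : ∀ᶠ v in 𝓝 u, W (G v) = Wh v) (i j : Fin n) :
    tderiv S W (G u) i j = A (gradCoeff A (EuclideanSpace.proj j ∘L B)) i := by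
  have h1 : HasFDerivAt (fun v => Wh v j) (EuclideanSpace.proj j ∘L B) u :=
    (EuclideanSpace.proj (𝕜 := ℝ) j).hasFDerivAt.comp u hW
  rw [tderiv, h.tgrad_eq h1 (hWh.mono fun v hv => by rw [hv])]

theorem IsLocalParam.tdiv_eq (h : IsLocalParam S G A u) {W : Euc n → Euc n}
    {Wh : Euc m → Euc n} {B : Euc m →L[ℝ] Euc n} (hW : HasFDerivAt Wh B u)
    (hWh : ∀ᶠ v in 𝓝 u, W (G v) = Wh v) : tdiv S W (G u) = paramDiv A B := by
  simp only [tdiv, h.tderiv_eq hW hWh]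
  rfl

theorem IsLocalParam.velocityTensor_eq (h : IsLocalParam S G A u) {W : Euc n → Euc n}
    {Wh : Euc m → Euc n} {B : Euc m →L[ℝ] Euc n} (hW : HasFDerivAt Wh B u)
    (hWh : ∀ᶠ v in 𝓝 u, W (G v) = Wh v) (a b : Euc m) :
    ∑ i, ∑ j, velocityTensor S W (G u) i j * A a j * A b i = paramTensor A B a b := by
  have key : ∀ a b, ∑ i, ∑ j, tderiv S W (G u) i j * A a j * A b i = inner ℝ (B b) (A a) := by
    intro a b
    simp only [h.tderiv_eq hW hWh]
    rw [Finset.sum_comm, inner_euc]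
    refine Finset.sum_congr rfl fun j _ => ?_
    have h1 : (B b) j = inner ℝ (A (gradCoeff A (EuclideanSpace.proj j ∘L B))) (A b) := by
      rw [inner_gradCoeff h.injective]; rfl
    rw [h1, inner_euc, Finset.sum_mul]
    exact Finset.sum_congr rfl fun i _ => by ring
  have key' : ∑ i, ∑ j, tderiv S W (G u) j i * A a j * A b i = inner ℝ (B a) (A b) := by
    rw [← key b a, Finset.sum_comm]
    exact Finset.sum_congr rfl fun i _ => Finset.sum_congr rfl fun j _ => by ring
  have hd : ∑ i, ∑ j, (if i = j then tdiv S W (G u) else 0) * A a j * A b i =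
      paramDiv A B * inner ℝ (A a) (A b) := by
    rw [h.tdiv_eq hW hWh, inner_euc, Finset.mul_sum]
    refine Finset.sum_congr rfl fun i _ => ?_
    simp [ite_mul, mul_assoc]
  have hsplit : ∑ i, ∑ j, velocityTensor S W (G u) i j * A a j * A b i =
      ∑ i, ∑ j, (if i = j then tdiv S W (G u) else 0) * A a j * A b i -
        (∑ i, ∑ j, tderiv S W (G u) i j * A a j * A b i +
          ∑ i, ∑ j, tderiv S W (G u) j i * A a j * A b i) := by
    simp only [← Finset.sum_add_distrib, ← Finset.sum_sub_distrib]
    refine Finset.sum_congr rfl fun i _ => Finset.sum_congr rfl fun j _ => ?_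
    simp only [velocityTensor, Matrix.of_apply]
    ring
  rw [hsplit, hd, key, key', paramTensor, real_inner_comm (A a) (B b)]
  ring

end LocalParam

/-! ### The surface measures of two parametrised pieces -/

section Lipschitz

theorem euclideanHausdorffMeasure_image_le {X Y Z : Type} [MetricSpace Y] [MeasurableSpace Y]
    [BorelSpace Y] [MetricSpace Z] [MeasurableSpace Z] [BorelSpace Z] (d : ℕ) {A : Set X}
    {g : X → Y} {h : X → Z} {c : ℝ} (hc : 0 ≤ c)
    (hgh : ∀ x ∈ A, ∀ y ∈ A, dist (h x) (h y) ≤ c * dist (g x) (g y)) :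
    μHE[d] (h '' A) ≤ ENNReal.ofReal (c ^ d) * μHE[d] (g '' A) := by
  rcases A.eq_empty_or_nonempty with rfl | ⟨x₀, hx₀⟩
  · simp
  have : Nonempty X := ⟨x₀⟩
  let φ : Y → Z := fun y => h (Function.invFunOn g A y)
  have hinv : ∀ x ∈ A, Function.invFunOn g A (g x) ∈ A ∧ g (Function.invFunOn g A (g x)) = g x :=
    fun x hx => ⟨Function.invFunOn_mem ⟨x, hx, rfl⟩, Function.invFunOn_eq ⟨x, hx, rfl⟩⟩
  have himg : φ '' (g '' A) = h '' A := by
    rw [image_image]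
    refine image_congr fun x hx => ?_
    have := hgh _ (hinv x hx).1 x hx
    rw [(hinv x hx).2, dist_self, mul_zero] at this
    exact dist_le_zero.1 this
  have hlip : LipschitzOnWith c.toNNReal φ (g '' A) := by
    refine LipschitzOnWith.of_dist_le_mul ?_
    rintro _ ⟨x, hx, rfl⟩ _ ⟨y, hy, rfl⟩
    have := hgh _ (hinv x hx).1 _ (hinv y hy).1
    rwa [(hinv x hx).2, (hinv y hy).2, ← Real.coe_toNNReal c hc] at this
  have key := hlip.hausdorffMeasure_image_le (d := d) (by positivity)
  rw [himg] at key
  have hcc : (c.toNNReal : ENNReal) ^ (d : ℝ) = ENNReal.ofReal (c ^ d) := by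
    rw [ENNReal.rpow_natCast, ENNReal.ofReal_pow hc]
    rfl
  rw [hcc] at key
  rw [Measure.euclideanHausdorffMeasure_def, Measure.euclideanHausdorffMeasure_def,
    Measure.smul_apply, Measure.smul_apply, ENNReal.smul_def, smul_eq_mul, ENNReal.smul_def,
    smul_eq_mul, ← mul_assoc, mul_comm (ENNReal.ofReal _), mul_assoc]
  gcongr

/-- A local comparison of two measures on a compact space is a global one. -/
theorem measure_le_smul_of_locally {X : Type} [TopologicalSpace X] [CompactSpace X]
    [MeasurableSpace X] [OpensMeasurableSpace X] {μ ν : Measure X} {c : ENNReal}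
    (h : ∀ x : X, ∃ N ∈ 𝓝 x, ∀ A ⊆ N, ν A ≤ c * μ A) : ν ≤ c • μ := by
  have key : ∃ s : Set X, MeasurableSet s ∧ univ ⊆ s ∧
      ∀ A ⊆ s, MeasurableSet A → ν A ≤ c * μ A := by
    refine isCompact_univ.induction_on (p := fun r => ∃ s : Set X, MeasurableSet s ∧ r ⊆ s ∧
      ∀ A ⊆ s, MeasurableSet A → ν A ≤ c * μ A) ?_ ?_ ?_ ?_
    · refine ⟨∅, MeasurableSet.empty, subset_rfl, fun A hA _ => ?_⟩
      rw [subset_empty_iff.1 hA]; simp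
    · rintro r r' hr ⟨s, hs, hrs, h⟩
      exact ⟨s, hs, hr.trans hrs, h⟩
    · rintro r r' ⟨s, hs, hrs, h⟩ ⟨s', hs', hrs', h'⟩
      refine ⟨s ∪ s', hs.union hs', union_subset_union hrs hrs', fun A hA hAm => ?_⟩
      rw [← measure_inter_add_sdiff A hs, ← measure_inter_add_sdiff (μ := μ) A hs, mul_add]
      refine add_le_add (h _ inter_subset_right (hAm.inter hs)) (h' _ ?_ (hAm.diff hs))
      rintro x ⟨hxA, hxs⟩
      exact (hA hxA).resolve_left hxs
    · intro x _
      obtain ⟨N, hN, hle⟩ := h x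
      refine ⟨interior N, nhdsWithin_le_nhds (interior_mem_nhds.2 hN), interior N,
        isOpen_interior.measurableSet, subset_rfl, fun A hA _ => hle A (hA.trans interior_subset)⟩
  obtain ⟨s, -, hs, h⟩ := key
  refine Measure.le_iff.2 fun A hA => ?_
  rw [Measure.smul_apply, smul_eq_mul]
  exact h A ((subset_univ A).trans hs) hA

/-- If the metric of `H` is dominated by that of `G` at a point, then distances are, locally. -/
theorem exists_nhds_dist_le_mul_dist {X Y Z : Type} [NormedAddCommGroup X] [NormedSpace ℝ X]
    [FiniteDimensional ℝ X] [NormedAddCommGroup Y] [NormedSpace ℝ Y] [NormedAddCommGroup Z]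
    [NormedSpace ℝ Z] {G : X → Y} {H : X → Z} {A : X →L[ℝ] Y} {B : X →L[ℝ] Z} {u : X}
    (hG : HasStrictFDerivAt G A u) (hH : HasStrictFDerivAt H B u) (hA : Function.Injective A)
    {c c' : ℝ} (hc : 0 ≤ c) (hcc' : c < c') (hle : ∀ w, ‖B w‖ ≤ c * ‖A w‖) :
    ∃ N ∈ 𝓝 u, ∀ v ∈ N, ∀ w ∈ N, dist (H v) (H w) ≤ c' * dist (G v) (G w) := by
  obtain ⟨κ, -, hκ⟩ := A.toLinearMap.exists_antilipschitzWith (LinearMap.ker_eq_bot.2 hA)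
  have hκ' : ∀ w, ‖w‖ ≤ κ * ‖A w‖ := fun w => by
    simpa [dist_eq_norm] using hκ.le_mul_dist w 0
  -- with this choice the linearisation errors use up half of the norm and half of `c' - c`
  obtain ⟨τ, hτ, hτ1, hτ2⟩ : ∃ τ : ℝ, 0 < τ ∧ κ * τ ≤ 1 / 2 ∧ 2 * κ * (c + 1) * τ ≤ c' - c := by
    refine ⟨min (1 / (2 * (κ + 1))) ((c' - c) / (2 * (κ + 1) * (c + 1))),
      lt_min (by positivity) (div_pos (by linarith) (by positivity)), ?_, ?_⟩
    · calc (κ : ℝ) * min _ _ ≤ (κ + 1) * (1 / (2 * (κ + 1))) := by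
            gcongr
            · linarith
            · exact min_le_left _ _
        _ = 1 / 2 := by field_simp
    · calc 2 * (κ : ℝ) * (c + 1) * min _ _
          ≤ 2 * (κ + 1) * (c + 1) * ((c' - c) / (2 * (κ + 1) * (c + 1))) := by
            gcongr
            · linarith
            · exact min_le_right _ _
        _ = c' - c := by field_simp
  have h1 := hG.isLittleO.bound hτ
  have h2 := hH.isLittleO.bound hτ
  rw [nhds_prod_eq] at h1 h2
  obtain ⟨N, hN, hNs⟩ := (eventually_prod_self_iff' (r := fun q =>
    ‖G q.1 - G q.2 - A (q.1 - q.2)‖ ≤ τ * ‖q.1 - q.2‖ ∧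
      ‖H q.1 - H q.2 - B (q.1 - q.2)‖ ≤ τ * ‖q.1 - q.2‖)).1 (h1.and h2)
  refine ⟨N, hN, fun v hv w hw => ?_⟩
  obtain ⟨e1, e2⟩ : ‖G v - G w - A (v - w)‖ ≤ τ * ‖v - w‖ ∧ ‖H v - H w - B (v - w)‖ ≤ τ * ‖v - w‖ :=
    hNs v hv w hw
  rw [dist_eq_norm, dist_eq_norm]
  have e3 : ‖A (v - w)‖ ≤ ‖G v - G w‖ + τ * ‖v - w‖ := by
    have := norm_sub_norm_le (A (v - w)) (G v - G w)
    rw [norm_sub_rev (A (v - w))] at this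
    linarith
  have e4 : ‖H v - H w‖ ≤ ‖B (v - w)‖ + τ * ‖v - w‖ := by
    have := norm_sub_norm_le (H v - H w) (B (v - w))
    linarith
  have e5 := hκ' (v - w)
  have e6 := hle (v - w)
  have e7 : ‖v - w‖ ≤ 2 * κ * ‖G v - G w‖ := by
    have : κ * ‖A (v - w)‖ ≤ κ * (‖G v - G w‖ + τ * ‖v - w‖) := by gcongr
    nlinarith [mul_le_mul_of_nonneg_right hτ1 (norm_nonneg (v - w))]
  have e8 : c * ‖A (v - w)‖ ≤ c * (‖G v - G w‖ + τ * ‖v - w‖) := by gcongr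
  have e9 : (c + 1) * τ * ‖v - w‖ ≤ (c + 1) * τ * (2 * κ * ‖G v - G w‖) := by gcongr
  have e10 := mul_le_mul_of_nonneg_right hτ2 (norm_nonneg (G v - G w))
  nlinarith

end Lipschitz

section Piece

variable {m n n' : ℕ}

/-- The surface measure of the piece parametrised by `G` over `K`, transported to `K`. -/
def pieceMeasure (K : Set (Euc m)) (G : Euc m → Euc n) : Measure K :=
  Measure.comap (K.domRestrict G) μHE[m]

variable {K : Set (Euc m)} {G : Euc m → Euc n} {H : Euc m → Euc n'}

theorem measurableEmbedding_domRestrict (hK : IsCompact K) (hG : Continuous G) (hinj : InjOn G K) :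
    MeasurableEmbedding (K.domRestrict G) := by
  have : CompactSpace K := isCompact_iff_compactSpace.1 hK
  exact ((hG.comp continuous_subtype_val).isClosedEmbedding
    (injOn_iff_injective.1 hinj)).measurableEmbedding

theorem pieceMeasure_apply (hK : IsCompact K) (hG : Continuous G) (hinj : InjOn G K) (A : Set K) :
    pieceMeasure K G A = μHE[m] (G '' (Subtype.val '' A)) := by
  rw [pieceMeasure, (measurableEmbedding_domRestrict hK hG hinj).comap_apply, image_image]
  rfl

theorem pieceMeasure_le (hK : IsCompact K) (hG : Continuous G) (hGinj : InjOn G K)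
    (hH : Continuous H) (hHinj : InjOn H K) {c : ℝ} (hc : 0 ≤ c)
    (h : ∀ u ∈ K, ∃ N ∈ 𝓝 u, ∀ v ∈ N, ∀ w ∈ N, dist (H v) (H w) ≤ c * dist (G v) (G w)) :
    pieceMeasure K H ≤ ENNReal.ofReal (c ^ m) • pieceMeasure K G := by
  have : CompactSpace K := isCompact_iff_compactSpace.1 hK
  refine measure_le_smul_of_locally fun x => ?_
  obtain ⟨N, hN, hle⟩ := h x x.2
  refine ⟨Subtype.val ⁻¹' N, continuous_subtype_val.continuousAt hN, fun A hA => ?_⟩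
  rw [pieceMeasure_apply hK hG hGinj, pieceMeasure_apply hK hH hHinj]
  refine euclideanHausdorffMeasure_image_le m hc ?_
  rintro _ ⟨x, hx, rfl⟩ _ ⟨y, hy, rfl⟩
  exact hle _ (hA hx) _ (hA hy)

theorem exists_pieceMeasure_le_volume (hK : IsCompact K) (hG : ContDiff ℝ ∞ G)
    (hinj : InjOn G K) : ∃ c : ℝ, pieceMeasure K G ≤ ENNReal.ofReal c • pieceMeasure K id := by
  have hd : ContDiff ℝ ∞ (fderiv ℝ G) := hG.fderiv_right (m := ∞) (by simp)
  obtain ⟨C, hC⟩ := hK.exists_bound_of_continuousOn hd.continuous.continuousOn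
  refine ⟨(max C 0 + 1) ^ m, pieceMeasure_le hK continuous_id (injOn_id K) hG.continuous hinj
    (add_nonneg (le_max_right _ _) zero_le_one) fun u hu => ?_⟩
  refine exists_nhds_dist_le_mul_dist (G := id) (c := max C 0) (hasStrictFDerivAt_id u)
    (hG.contDiffAt.hasStrictFDerivAt (by simp)) (fun _ _ h => h) (le_max_right _ _) (by simp)
    fun w => ?_
  refine ((fderiv ℝ G u).le_opNorm w).trans ?_
  exact mul_le_mul_of_nonneg_right ((hC u hu).trans (le_max_left _ _)) (norm_nonneg w)

theorem pieceMeasure_id_apply (hK : IsCompact K) (A : Set K) :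
    pieceMeasure K id A = volume (Subtype.val '' A) := by
  rw [pieceMeasure_apply hK continuous_id (injOn_id K), image_id,
    EuclideanSpace.euclideanHausdorffMeasure_eq_volume]

theorem isFiniteMeasure_pieceMeasure (hK : IsCompact K) (hG : ContDiff ℝ ∞ G) (hinj : InjOn G K) :
    IsFiniteMeasure (pieceMeasure K G) := by
  obtain ⟨c, hc⟩ := exists_pieceMeasure_le_volume hK hG hinj
  refine ⟨(hc univ).trans_lt ?_⟩
  rw [Measure.smul_apply, pieceMeasure_id_apply hK, smul_eq_mul]
  refine ENNReal.mul_lt_top ENNReal.ofReal_lt_top ?_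
  exact (measure_mono (by simp)).trans_lt hK.measure_lt_top

/-- The boundary of a convex parameter domain does not contribute to the surface measure. -/
theorem ae_mem_interior (hK : IsCompact K) (hconv : Convex ℝ K) (hG : ContDiff ℝ ∞ G)
    (hinj : InjOn G K) : ∀ᵐ x : K ∂pieceMeasure K G, (x : Euc m) ∈ interior K := by
  obtain ⟨c, hc⟩ := exists_pieceMeasure_le_volume hK hG hinj
  refine nonpos_iff_eq_zero.1 ((hc _).trans ?_)
  rw [Measure.smul_apply, pieceMeasure_id_apply hK]
  have : (volume : Measure (Euc m)) (Subtype.val '' {x : K | (x : Euc m) ∈ interior K}ᶜ) = 0 := by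
    refine measure_mono_null ?_ (hconv.addHaar_frontier volume)
    rintro _ ⟨x, hx, rfl⟩
    exact ⟨subset_closure x.2, hx⟩
  exact (by rw [this]; simp : _ = (0 : ENNReal)).le

theorem measure_image_diff_interior (hK : IsCompact K) (hconv : Convex ℝ K) (hG : ContDiff ℝ ∞ G)
    (hinj : InjOn G K) : μHE[m] (G '' (K \ interior K)) = 0 := by
  have h := ae_mem_interior hK hconv hG hinj
  rw [ae_iff, pieceMeasure_apply hK hG.continuous hinj] at h
  refine measure_mono_null (image_mono ?_) h
  rintro x ⟨hx, hx'⟩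
  exact ⟨⟨x, hx⟩, hx', rfl⟩

/-- Integration over a parametrised piece. -/
theorem integrableOn_image_and_integral_eq {F : Type} [NormedAddCommGroup F] [NormedSpace ℝ F]
    (hK : IsCompact K) (hconv : Convex ℝ K) (hG : ContDiff ℝ ∞ G) (hinj : InjOn G K)
    {f : Euc n → F} {φ : Euc m → F} (hφ : ContinuousOn φ K) (h : ∀ u ∈ interior K, f (G u) = φ u) :
    IntegrableOn f (G '' K) μHE[m] ∧ Integrable (fun x : K => φ x) (pieceMeasure K G) ∧
      ∫ x in G '' K, f x ∂μHE[m] = ∫ x : K, φ x ∂pieceMeasure K G := by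
  have : CompactSpace K := isCompact_iff_compactSpace.1 hK
  have := isFiniteMeasure_pieceMeasure hK hG hinj
  have hemb := measurableEmbedding_domRestrict hK hG.continuous hinj
  have hr : range (K.domRestrict G) = G '' K := by ext; simp
  have hmap : Measure.map (K.domRestrict G) (pieceMeasure K G) = μHE[m].restrict (G '' K) := by
    rw [pieceMeasure, hemb.map_comap, hr]
  have hcont : Continuous fun x : K => φ x := continuousOn_iff_continuous_domRestrict.1 hφ
  have hint : Integrable (fun x : K => φ x) (pieceMeasure K G) :=
    hcont.integrable_of_hasCompactSupport (HasCompactSupport.of_compactSpace _)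
  have hae : (f ∘ K.domRestrict G) =ᵐ[pieceMeasure K G] fun x : K => φ x := by
    filter_upwards [ae_mem_interior hK hconv hG hinj] with x hx using h x hx
  refine ⟨?_, hint, ?_⟩
  · rw [IntegrableOn, ← hmap, hemb.integrable_map_iff]
    exact hint.congr hae.symm
  · rw [← hmap, hemb.integral_map]
    exact integral_congr_ae hae

end Piece

section Comparison

theorem abs_integral_sub_le_of_nonneg {X : Type} [MeasurableSpace X] {μ ν : Measure X}
    [IsFiniteMeasure μ] [IsFiniteMeasure ν] {δ : ℝ} (hδ : 0 ≤ δ)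
    (hμν : μ ≤ ENNReal.ofReal (1 + δ) • ν) (hνμ : ν ≤ ENNReal.ofReal (1 + δ) • μ) {f : X → ℝ}
    (hf : Integrable f μ) (hf' : Integrable f ν) (h0 : 0 ≤ f) :
    |∫ x, f x ∂μ - ∫ x, f x ∂ν| ≤ δ * (1 + δ) * ∫ x, f x ∂μ := by
  have hone : ENNReal.ofReal (1 + δ) ≠ ⊤ := ENNReal.ofReal_ne_top
  have h1 := integral_mono_measure hμν (Eventually.of_forall h0) (hf'.smul_measure hone)
  have h2 := integral_mono_measure hνμ (Eventually.of_forall h0) (hf.smul_measure hone)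
  rw [integral_smul_measure, ENNReal.toReal_ofReal (by positivity), smul_eq_mul] at h1 h2
  have h3 : 0 ≤ ∫ x, f x ∂μ := integral_nonneg h0
  have h4 : δ * ∫ x, f x ∂ν ≤ δ * ((1 + δ) * ∫ x, f x ∂μ) := by gcongr
  have h5 : 0 ≤ δ * (δ * ∫ x, f x ∂μ) := by positivity
  rw [abs_le]
  constructor <;> nlinarith

/-- Comparison of two integrals with close integrands and close measures. -/
theorem abs_integral_sub_integral_le {X : Type} [MeasurableSpace X] {μ ν : Measure X}
    [IsFiniteMeasure μ] [IsFiniteMeasure ν] {δ ε C : ℝ} (hδ : 0 ≤ δ)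
    (hμν : μ ≤ ENNReal.ofReal (1 + δ) • ν) (hνμ : ν ≤ ENNReal.ofReal (1 + δ) • μ)
    {f f' ψ : X → ℝ} (hf : Integrable f μ) (hf' : Integrable f' μ) (hf'ν : Integrable f' ν)
    (hψ : Integrable ψ μ) (hff' : ∀ᵐ x ∂μ, |f x - f' x| ≤ ε * ψ x)
    (hfψ : ∀ᵐ x ∂μ, |f' x| ≤ C * ψ x) :
    |∫ x, f x ∂μ - ∫ x, f' x ∂ν| ≤ (ε + C * (δ * (1 + δ))) * ∫ x, ψ x ∂μ := by
  have h1 : |∫ x, f x ∂μ - ∫ x, f' x ∂μ| ≤ ε * ∫ x, ψ x ∂μ := by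
    rw [← integral_sub hf hf', ← integral_const_mul]
    exact abs_integral_le_integral_abs.trans
      (integral_mono_ae (hf.sub hf').abs (hψ.const_mul ε) hff')
  have hp := abs_integral_sub_le_of_nonneg hδ hμν hνμ hf'.pos_part hf'ν.pos_part
    fun x => le_max_right _ _
  have hn := abs_integral_sub_le_of_nonneg hδ hμν hνμ hf'.neg_part hf'ν.neg_part
    fun x => le_max_right _ _
  have e : ∀ x, f' x = max (f' x) 0 - max (-f' x) 0 := fun x => by
    rcases le_total 0 (f' x) with h | h
    · rw [max_eq_left h, max_eq_right (by linarith), sub_zero]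
    · rw [max_eq_right h, max_eq_left (by linarith)]; ring
  have eμ : ∫ x, f' x ∂μ = ∫ x, max (f' x) 0 ∂μ - ∫ x, max (-f' x) 0 ∂μ := by
    rw [← integral_sub hf'.pos_part hf'.neg_part]; exact integral_congr_ae (.of_forall e)
  have eν : ∫ x, f' x ∂ν = ∫ x, max (f' x) 0 ∂ν - ∫ x, max (-f' x) 0 ∂ν := by
    rw [← integral_sub hf'ν.pos_part hf'ν.neg_part]; exact integral_congr_ae (.of_forall e)
  have eabs : ∫ x, max (f' x) 0 ∂μ + ∫ x, max (-f' x) 0 ∂μ ≤ C * ∫ x, ψ x ∂μ := by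
    rw [← integral_add hf'.pos_part hf'.neg_part, ← integral_const_mul]
    refine integral_mono_ae (hf'.pos_part.add hf'.neg_part) (hψ.const_mul C) ?_
    filter_upwards [hfψ] with x hx
    refine le_trans (le_of_eq ?_) hx
    rcases le_total 0 (f' x) with h | h
    · simp [h, abs_of_nonneg h]
    · simp [h, abs_of_nonpos h]
  have h2 : |∫ x, f' x ∂μ - ∫ x, f' x ∂ν| ≤ δ * (1 + δ) * (C * ∫ x, ψ x ∂μ) := by
    have := mul_le_mul_of_nonneg_left eabs (by positivity : 0 ≤ δ * (1 + δ))
    rw [eμ, eν]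
    rw [abs_le] at hp hn ⊢
    constructor <;> linarith [hp.1, hp.2, hn.1, hn.2]
  rw [abs_le] at h1 h2 ⊢
  constructor <;> linarith [h1.1, h1.2, h2.1, h2.2]

end Comparison

/-! ### Comparison of the forms on one element -/

section PiecePair

variable {m : ℕ}

/-- A piece `G(K)` of the surface `S` and a piece `H(K)` of the surface `S'`, moving with the
velocities `W` and `W'`, whose metrics and their rates of change are close to each other with the
relative error `ε`. The functions `Gt` and `Ht` are the velocities in the parameter domain. -/
structure IsPiecePair (K : Set (Euc m)) (ε C : ℝ) (S S' : Set (Euc (m + 1)))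
    (G H Gt Ht : Euc m → Euc (m + 1)) (W W' : Euc (m + 1) → Euc (m + 1)) : Prop where
  isCompact : IsCompact K
  convex : Convex ℝ K
  contDiff : ContDiff ℝ ∞ G
  contDiff' : ContDiff ℝ ∞ H
  contDiff_velocity : ContDiff ℝ ∞ Gt
  contDiff_velocity' : ContDiff ℝ ∞ Ht
  injOn : InjOn G K
  injOn' : InjOn H K
  pos : 0 < ε
  le_half : ε ≤ 1 / 2
  nonneg : 0 ≤ C
  metric_le : ∀ u ∈ K, ∀ w w', |inner ℝ (fderiv ℝ H u w) (fderiv ℝ H u w') -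
    inner ℝ (fderiv ℝ G u w) (fderiv ℝ G u w')| ≤ ε * ‖fderiv ℝ G u w‖ * ‖fderiv ℝ G u w'‖
  metricRate_le : ∀ u ∈ K, ∀ w w',
    |(inner ℝ (fderiv ℝ Ht u w) (fderiv ℝ H u w') + inner ℝ (fderiv ℝ H u w) (fderiv ℝ Ht u w')) -
      (inner ℝ (fderiv ℝ Gt u w) (fderiv ℝ G u w') + inner ℝ (fderiv ℝ G u w) (fderiv ℝ Gt u w'))| ≤
        ε * ‖fderiv ℝ G u w‖ * ‖fderiv ℝ G u w'‖
  velocity_le : ∀ u ∈ K, ∀ w, ‖fderiv ℝ Gt u w‖ ≤ C * ‖fderiv ℝ G u w‖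
  injective : ∀ u ∈ K, Function.Injective (fderiv ℝ G u)
  injective' : ∀ u ∈ K, Function.Injective (fderiv ℝ H u)
  map_nhds : ∀ u ∈ interior K, map G (𝓝 u) = 𝓝[S] (G u)
  map_nhds' : ∀ u ∈ interior K, map H (𝓝 u) = 𝓝[S'] (H u)
  velocity_eq : ∀ u ∈ interior K, W (G u) = Gt u
  velocity_eq' : ∀ u ∈ interior K, W' (H u) = Ht u

theorem continuousOn_gradCoeff {K : Set (Euc m)} {G : Euc m → Euc (m + 1)} {l : Euc m → Euc m →L[ℝ] ℝ}
    (hG : ContDiff ℝ ∞ G) (hl : Continuous l) (hinj : ∀ u ∈ K, Function.Injective (fderiv ℝ G u)) :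
    ContinuousOn (fun u => gradCoeff (fderiv ℝ G u) (l u)) K := by
  have h1 : Continuous (fderiv ℝ G) := (hG.fderiv_right (m := ∞) (by simp)).continuous
  intro u hu
  exact ((continuousAt_gradCoeff (hinj u hu) (l u)).comp (f := fun u => (fderiv ℝ G u, l u))
    (h1.prodMk hl).continuousAt).continuousWithinAt

theorem continuousOn_grad {K : Set (Euc m)} {G : Euc m → Euc (m + 1)} {l : Euc m → Euc m →L[ℝ] ℝ}
    (hG : ContDiff ℝ ∞ G) (hl : Continuous l) (hinj : ∀ u ∈ K, Function.Injective (fderiv ℝ G u)) :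
    ContinuousOn (fun u => fderiv ℝ G u (gradCoeff (fderiv ℝ G u) (l u))) K :=
  (hG.fderiv_right (m := ∞) (by simp)).continuous.continuousOn.clm_apply
    (continuousOn_gradCoeff hG hl hinj)

theorem continuousOn_paramDiv {K : Set (Euc m)} {G Gt : Euc m → Euc (m + 1)}
    (hG : ContDiff ℝ ∞ G) (hGt : ContDiff ℝ ∞ Gt)
    (hinj : ∀ u ∈ K, Function.Injective (fderiv ℝ G u)) :
    ContinuousOn (fun u => paramDiv (fderiv ℝ G u) (fderiv ℝ Gt u)) K := by
  have h1 : Continuous (fderiv ℝ Gt) := (hGt.fderiv_right (m := ∞) (by simp)).continuous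
  refine continuousOn_finsetSum _ fun i _ => ?_
  exact (EuclideanSpace.proj (𝕜 := ℝ) i).continuous.comp_continuousOn
    (continuousOn_grad (l := fun u => EuclideanSpace.proj i ∘L fderiv ℝ Gt u) hG
      (continuous_const.clm_comp h1) hinj)

theorem continuousOn_paramTensor {K : Set (Euc m)} {G Gt : Euc m → Euc (m + 1)}
    {l l' : Euc m → Euc m →L[ℝ] ℝ} (hG : ContDiff ℝ ∞ G) (hGt : ContDiff ℝ ∞ Gt)
    (hl : Continuous l) (hl' : Continuous l')
    (hinj : ∀ u ∈ K, Function.Injective (fderiv ℝ G u)) :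
    ContinuousOn (fun u => paramTensor (fderiv ℝ G u) (fderiv ℝ Gt u)
      (gradCoeff (fderiv ℝ G u) (l u)) (gradCoeff (fderiv ℝ G u) (l' u))) K := by
  have h1 := (hGt.fderiv_right (m := ∞) (by simp)).continuous.continuousOn (s := K)
  have hB := h1.clm_apply (continuousOn_gradCoeff hG hl hinj)
  have hB' := h1.clm_apply (continuousOn_gradCoeff hG hl' hinj)
  have hA := continuousOn_grad hG hl hinj
  have hA' := continuousOn_grad hG hl' hinj
  exact ((continuousOn_paramDiv hG hGt hinj).mul (hA.inner hA')).sub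
    ((hB.inner hA').add (hA.inner hB'))

theorem one_add_pow_le {x : ℝ} (hx0 : 0 ≤ x) (hx1 : x ≤ 1) (n : ℕ) :
    (1 + x) ^ n ≤ 1 + (2 ^ n - 1) * x := by
  induction n with
  | zero => simp
  | succ n ih =>
    have h1 : (0 : ℝ) ≤ 2 ^ n - 1 := sub_nonneg.2 (one_le_pow₀ (by norm_num))
    calc (1 + x) ^ (n + 1) = (1 + x) ^ n * (1 + x) := pow_succ _ _
      _ ≤ (1 + (2 ^ n - 1) * x) * (1 + x) := by gcongr
      _ ≤ 1 + (2 ^ (n + 1) - 1) * x := by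
        rw [pow_succ]
        nlinarith [mul_nonneg (mul_nonneg h1 hx0) (sub_nonneg.2 hx1)]

variable {K : Set (Euc m)} {ε C : ℝ} {S S' : Set (Euc (m + 1))}
  {G H Gt Ht : Euc m → Euc (m + 1)} {W W' : Euc (m + 1) → Euc (m + 1)}

theorem IsPiecePair.isLocalParam (h : IsPiecePair K ε C S S' G H Gt Ht W W') {u : Euc m}
    (hu : u ∈ interior K) : IsLocalParam S G (fderiv ℝ G u) u :=
  ⟨(h.contDiff.differentiable (by simp) u).hasFDerivAt, h.injective u (interior_subset hu),
    h.map_nhds u hu⟩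

theorem IsPiecePair.isLocalParam' (h : IsPiecePair K ε C S S' G H Gt Ht W W') {u : Euc m}
    (hu : u ∈ interior K) : IsLocalParam S' H (fderiv ℝ H u) u :=
  ⟨(h.contDiff'.differentiable (by simp) u).hasFDerivAt, h.injective' u (interior_subset hu),
    h.map_nhds' u hu⟩

/-- The surface measures differ by a factor `1 + O(ε)`. -/
theorem IsPiecePair.pieceMeasure_le (h : IsPiecePair K ε C S S' G H Gt Ht W W') :
    pieceMeasure K H ≤ ENNReal.ofReal (1 + 2 ^ m * (2 * ε)) • pieceMeasure K G ∧
      pieceMeasure K G ≤ ENNReal.ofReal (1 + 2 ^ m * (2 * ε)) • pieceMeasure K H := by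
  have hε := h.pos
  have hε' := h.le_half
  have hle : ENNReal.ofReal ((1 + 2 * ε) ^ m) ≤ ENNReal.ofReal (1 + 2 ^ m * (2 * ε)) :=
    ENNReal.ofReal_le_ofReal ((one_add_pow_le (by positivity) (by linarith) m).trans
      (by nlinarith))
  have hmono : ∀ μ : Measure K, ENNReal.ofReal ((1 + 2 * ε) ^ m) • μ ≤
      ENNReal.ofReal (1 + 2 ^ m * (2 * ε)) • μ := fun μ => by gcongr
  have hsq : ∀ u ∈ K, ∀ w, ‖fderiv ℝ H u w‖ ≤ (1 + ε) * ‖fderiv ℝ G u w‖ ∧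
      ‖fderiv ℝ G u w‖ ≤ (1 + ε) * ‖fderiv ℝ H u w‖ := by
    intro u hu w
    have h1 := h.metric_le u hu w w
    rw [real_inner_self_eq_norm_sq, real_inner_self_eq_norm_sq, abs_le] at h1
    set a := ‖fderiv ℝ G u w‖
    set b := ‖fderiv ℝ H u w‖
    have ha : 0 ≤ a := norm_nonneg _
    have hb : 0 ≤ b := norm_nonneg _
    constructor
    · refine abs_le_of_sq_le_sq' ?_ (by positivity) |>.2
      nlinarith [mul_nonneg hε.le (sq_nonneg a), mul_nonneg (sq_nonneg ε) (sq_nonneg a)]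
    · refine abs_le_of_sq_le_sq' ?_ (by positivity) |>.2
      have h3 : (1 - ε) * a ^ 2 ≤ b ^ 2 := by nlinarith
      have h4 : (1 + ε) ^ 2 * ((1 - ε) * a ^ 2) ≤ (1 + ε) ^ 2 * b ^ 2 := by gcongr
      have h5 : 1 ≤ (1 + ε) ^ 2 * (1 - ε) := by nlinarith [mul_pos hε hε]
      nlinarith [sq_nonneg a]
  constructor
  · refine (SurfaceFEM.pieceMeasure_le (c := 1 + 2 * ε) h.isCompact h.contDiff.continuous h.injOn
      h.contDiff'.continuous h.injOn' (by positivity) fun u hu => ?_).trans (hmono _)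
    exact exists_nhds_dist_le_mul_dist (h.contDiff.contDiffAt.hasStrictFDerivAt (by simp))
      (h.contDiff'.contDiffAt.hasStrictFDerivAt (by simp)) (h.injective u hu)
      (c := 1 + ε) (by positivity) (by linarith) fun w => (hsq u hu w).1
  · refine (SurfaceFEM.pieceMeasure_le (c := 1 + 2 * ε) h.isCompact h.contDiff'.continuous h.injOn'
      h.contDiff.continuous h.injOn (by positivity) fun u hu => ?_).trans (hmono _)
    exact exists_nhds_dist_le_mul_dist (h.contDiff'.contDiffAt.hasStrictFDerivAt (by simp))
      (h.contDiff.contDiffAt.hasStrictFDerivAt (by simp)) (h.injective' u hu)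
      (c := 1 + ε) (by positivity) (by linarith) fun w => (hsq u hu w).2

/-- Functions on `S` and `S'` that are close in the parameters have close integrals. -/
theorem IsPiecePair.abs_setIntegral_sub_le (h : IsPiecePair K ε C S S' G H Gt Ht W W')
    {f f' ψ : Euc (m + 1) → ℝ} {φ φ' χ : Euc m → ℝ} (hφ : ContinuousOn φ K)
    (hφ' : ContinuousOn φ' K) (hχ : ContinuousOn χ K) (hf : ∀ u ∈ interior K, f (G u) = φ u)
    (hf' : ∀ u ∈ interior K, f' (H u) = φ' u) (hψ : ∀ u ∈ interior K, ψ (G u) = χ u)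
    {c₁ c₂ : ℝ} (h₁ : ∀ u ∈ K, |φ u - φ' u| ≤ c₁ * ε * χ u)
    (h₂ : ∀ u ∈ K, |φ u| ≤ c₂ * χ u) :
    IntegrableOn f (G '' K) μHE[m] ∧ IntegrableOn ψ (G '' K) μHE[m] ∧
    |∫ x in G '' K, f x ∂μHE[m] - ∫ x in H '' K, f' x ∂μHE[m]| ≤
      (c₁ + (c₁ + c₂) * (2 ^ (m + 1) * (1 + 2 ^ m))) * ε * ∫ x in G '' K, ψ x ∂μHE[m] := by
  have hε := h.pos
  have hε' := h.le_half
  have hμ := isFiniteMeasure_pieceMeasure h.isCompact h.contDiff h.injOn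
  have hν := isFiniteMeasure_pieceMeasure h.isCompact h.contDiff' h.injOn'
  obtain ⟨i1, i2, i3⟩ := integrableOn_image_and_integral_eq h.isCompact h.convex h.contDiff h.injOn
    hφ hf
  obtain ⟨-, j2, j3⟩ := integrableOn_image_and_integral_eq h.isCompact h.convex h.contDiff' h.injOn'
    hφ' hf'
  obtain ⟨k1, k2, k3⟩ := integrableOn_image_and_integral_eq h.isCompact h.convex h.contDiff h.injOn
    hχ hψ
  have hcpt : CompactSpace K := isCompact_iff_compactSpace.1 h.isCompact
  have j2' : Integrable (fun x : K => φ' x) (pieceMeasure K G) :=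
    (continuousOn_iff_continuous_domRestrict.1 hφ').integrable_of_hasCompactSupport
      (HasCompactSupport.of_compactSpace _)
  refine ⟨i1, k1, ?_⟩
  rw [i3, j3, k3]
  have hχ0 : ∀ u ∈ K, 0 ≤ (c₁ + c₂) * χ u := by
    intro u hu
    have h1 := (abs_nonneg _).trans (h₁ u hu)
    have h2 := (abs_nonneg _).trans (h₂ u hu)
    have : 0 ≤ c₁ * χ u := by
      rw [mul_right_comm] at h1
      exact nonneg_of_mul_nonneg_left h1 hε
    linarith
  have hφ'χ : ∀ u ∈ K, |φ' u| ≤ (c₁ + c₂) * χ u := by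
    intro u hu
    have h1 := h₁ u hu
    have h2 := h₂ u hu
    have h3 : |φ' u| ≤ |φ u| + |φ u - φ' u| := by
      have := abs_sub (φ u) (φ u - φ' u)
      rwa [sub_sub_cancel] at this
    have h4 : c₁ * ε * χ u ≤ c₁ * χ u := by
      have : 0 ≤ c₁ * χ u := by
        have h1 := (abs_nonneg _).trans (h₁ u hu)
        rw [mul_right_comm] at h1
        exact nonneg_of_mul_nonneg_left h1 hε
      nlinarith
    linarith
  obtain ⟨m1, m2⟩ := h.pieceMeasure_le
  refine (abs_integral_sub_integral_le (by positivity) m2 m1 i2 j2' j2 k2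
    (Eventually.of_forall fun x => h₁ x x.2) (Eventually.of_forall fun x => hφ'χ x x.2)).trans ?_
  have h5 : 2 ^ m * (2 * ε) * (1 + 2 ^ m * (2 * ε)) ≤ 2 ^ (m + 1) * (1 + 2 ^ m) * ε := by
    have : (2 : ℝ) ^ m * (2 * ε) ≤ 2 ^ m := by
      have : (0 : ℝ) < 2 ^ m := by positivity
      nlinarith
    calc (2 : ℝ) ^ m * (2 * ε) * (1 + 2 ^ m * (2 * ε)) ≤ 2 ^ m * (2 * ε) * (1 + 2 ^ m) := by gcongr
      _ = _ := by ring
  have h6 : 0 ≤ (c₁ + c₂) * ∫ x : K, χ x ∂pieceMeasure K G := by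
    rw [← integral_const_mul]
    exact integral_nonneg fun x => hχ0 x x.2
  have h7 := mul_le_mul_of_nonneg_left h5 h6
  linarith

/-- Here and in the estimates for the other forms, the functions `zl`, `φl` on `S` and `z`, `φ` on
`S'` have the common representatives `zh`, `φh` in the parameters, as a function and its lift do. -/
theorem IsPiecePair.abs_massForm_sub_le (h : IsPiecePair K ε C S S' G H Gt Ht W W')
    {zl z φl φ : Euc (m + 1) → ℝ} {zh φh : Euc m → ℝ} (hzh : ContDiff ℝ ∞ zh)
    (hφh : ContDiff ℝ ∞ φh) (hzl : ∀ u ∈ K, zl (G u) = zh u) (hz : ∀ u ∈ K, z (H u) = zh u)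
    (hφl : ∀ u ∈ K, φl (G u) = φh u) (hφ : ∀ u ∈ K, φ (H u) = φh u) :
    IntegrableOn (fun x => zl x * φl x) (G '' K) μHE[m] ∧
    IntegrableOn (fun x => |zl x| * |φl x|) (G '' K) μHE[m] ∧
    |∫ x in G '' K, zl x * φl x ∂μHE[m] - ∫ x in H '' K, z x * φ x ∂μHE[m]| ≤
      (0 + (0 + 1) * (2 ^ (m + 1) * (1 + 2 ^ m))) * ε *
        ∫ x in G '' K, |zl x| * |φl x| ∂μHE[m] := by
  have hi := interior_subset (s := K)
  refine h.abs_setIntegral_sub_le (φ := fun u => zh u * φh u) (φ' := fun u => zh u * φh u)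
    (χ := fun u => |zh u| * |φh u|) (hzh.continuous.mul hφh.continuous).continuousOn
    (hzh.continuous.mul hφh.continuous).continuousOn
    (hzh.continuous.abs.mul hφh.continuous.abs).continuousOn
    (fun u hu => by rw [hzl u (hi hu), hφl u (hi hu)])
    (fun u hu => by rw [hz u (hi hu), hφ u (hi hu)])
    (fun u hu => by rw [hzl u (hi hu), hφl u (hi hu)]) (fun u _ => by simp) (fun u _ => ?_)
  rw [abs_mul, one_mul]

theorem IsPiecePair.tdiv_eq (h : IsPiecePair K ε C S S' G H Gt Ht W W') {u : Euc m}
    (hu : u ∈ interior K) :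
    tdiv S W (G u) = paramDiv (fderiv ℝ G u) (fderiv ℝ Gt u) ∧
      tdiv S' W' (H u) = paramDiv (fderiv ℝ H u) (fderiv ℝ Ht u) := by
  have hmem := isOpen_interior.mem_nhds hu
  exact ⟨(h.isLocalParam hu).tdiv_eq
      (h.contDiff_velocity.differentiable (by simp) u).hasFDerivAt
      (eventually_of_mem hmem h.velocity_eq),
    (h.isLocalParam' hu).tdiv_eq (h.contDiff_velocity'.differentiable (by simp) u).hasFDerivAt
      (eventually_of_mem hmem h.velocity_eq')⟩

theorem IsPiecePair.abs_divForm_sub_le (h : IsPiecePair K ε C S S' G H Gt Ht W W')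
    {zl z φl φ : Euc (m + 1) → ℝ} {zh φh : Euc m → ℝ} (hzh : ContDiff ℝ ∞ zh)
    (hφh : ContDiff ℝ ∞ φh) (hzl : ∀ u ∈ K, zl (G u) = zh u) (hz : ∀ u ∈ K, z (H u) = zh u)
    (hφl : ∀ u ∈ K, φl (G u) = φh u) (hφ : ∀ u ∈ K, φ (H u) = φh u) :
    IntegrableOn (fun x => tdiv S W x * zl x * φl x) (G '' K) μHE[m] ∧
    IntegrableOn (fun x => |zl x| * |φl x|) (G '' K) μHE[m] ∧
    |∫ x in G '' K, tdiv S W x * zl x * φl x ∂μHE[m] -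
        ∫ x in H '' K, tdiv S' W' x * z x * φ x ∂μHE[m]| ≤
      (m * (1 + 2 * C) + (m * (1 + 2 * C) + m * C) * (2 ^ (m + 1) * (1 + 2 ^ m))) * ε *
        ∫ x in G '' K, |zl x| * |φl x| ∂μHE[m] := by
  have hi := interior_subset (s := K)
  have hz' := hzh.continuous.continuousOn (s := K)
  have hφ' := hφh.continuous.continuousOn (s := K)
  refine h.abs_setIntegral_sub_le
    (φ := fun u => paramDiv (fderiv ℝ G u) (fderiv ℝ Gt u) * zh u * φh u)
    (φ' := fun u => paramDiv (fderiv ℝ H u) (fderiv ℝ Ht u) * zh u * φh u)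
    (χ := fun u => |zh u| * |φh u|)
    (((continuousOn_paramDiv h.contDiff h.contDiff_velocity h.injective).mul hz').mul hφ')
    (((continuousOn_paramDiv h.contDiff' h.contDiff_velocity' h.injective').mul hz').mul hφ')
    (hz'.abs.mul hφ'.abs)
    (fun u hu => by rw [hzl u (hi hu), hφl u (hi hu), (h.tdiv_eq hu).1])
    (fun u hu => by rw [hz u (hi hu), hφ u (hi hu), (h.tdiv_eq hu).2])
    (fun u hu => by rw [hzl u (hi hu), hφl u (hi hu)]) (fun u hu => ?_) (fun u hu => ?_)
  · rw [← sub_mul, ← sub_mul, abs_mul, abs_mul, mul_assoc]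
    refine mul_le_mul_of_nonneg_right ?_ (by positivity)
    refine (abs_paramDiv_sub_le (h.injective u hu) (h.injective' u hu) h.pos.le h.le_half h.nonneg
      (h.metric_le u hu) (h.metricRate_le u hu) (h.velocity_le u hu)).trans_eq ?_
    rw [finrank_euclideanSpace_fin]; ring
  · rw [abs_mul, abs_mul, mul_assoc]
    refine mul_le_mul_of_nonneg_right ?_ (by positivity)
    refine (abs_paramDiv_le (h.injective u hu) (h.velocity_le u hu)).trans_eq ?_
    rw [finrank_euclideanSpace_fin]

theorem IsPiecePair.tgrad_eq (h : IsPiecePair K ε C S S' G H Gt Ht W W')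
    {zl : Euc (m + 1) → ℝ} {zh : Euc m → ℝ} (hzh : ContDiff ℝ ∞ zh)
    (hzl : ∀ u ∈ K, zl (G u) = zh u) {u : Euc m} (hu : u ∈ interior K) :
    tgrad S zl (G u) = fderiv ℝ G u (gradCoeff (fderiv ℝ G u) (fderiv ℝ zh u)) :=
  (h.isLocalParam hu).tgrad_eq (hzh.differentiable (by simp) u).hasFDerivAt
    (eventually_of_mem (isOpen_interior.mem_nhds hu) fun v hv => hzl v (interior_subset hv))

theorem IsPiecePair.tgrad_eq' (h : IsPiecePair K ε C S S' G H Gt Ht W W')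
    {z : Euc (m + 1) → ℝ} {zh : Euc m → ℝ} (hzh : ContDiff ℝ ∞ zh)
    (hz : ∀ u ∈ K, z (H u) = zh u) {u : Euc m} (hu : u ∈ interior K) :
    tgrad S' z (H u) = fderiv ℝ H u (gradCoeff (fderiv ℝ H u) (fderiv ℝ zh u)) :=
  (h.isLocalParam' hu).tgrad_eq (hzh.differentiable (by simp) u).hasFDerivAt
    (eventually_of_mem (isOpen_interior.mem_nhds hu) fun v hv => hz v (interior_subset hv))

theorem IsPiecePair.abs_stiffnessForm_sub_le (h : IsPiecePair K ε C S S' G H Gt Ht W W')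
    {zl z φl φ : Euc (m + 1) → ℝ} {zh φh : Euc m → ℝ} (hzh : ContDiff ℝ ∞ zh)
    (hφh : ContDiff ℝ ∞ φh) (hzl : ∀ u ∈ K, zl (G u) = zh u) (hz : ∀ u ∈ K, z (H u) = zh u)
    (hφl : ∀ u ∈ K, φl (G u) = φh u) (hφ : ∀ u ∈ K, φ (H u) = φh u) :
    IntegrableOn (fun x => inner ℝ (tgrad S zl x) (tgrad S φl x)) (G '' K) μHE[m] ∧
    IntegrableOn (fun x => ‖tgrad S zl x‖ * ‖tgrad S φl x‖) (G '' K) μHE[m] ∧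
    |∫ x in G '' K, inner ℝ (tgrad S zl x) (tgrad S φl x) ∂μHE[m] -
        ∫ x in H '' K, inner ℝ (tgrad S' z x) (tgrad S' φ x) ∂μHE[m]| ≤
      (2 + (2 + 1) * (2 ^ (m + 1) * (1 + 2 ^ m))) * ε *
        ∫ x in G '' K, ‖tgrad S zl x‖ * ‖tgrad S φl x‖ ∂μHE[m] := by
  have hz1 := (hzh.fderiv_right (m := ∞) (by simp)).continuous
  have hφ1 := (hφh.fderiv_right (m := ∞) (by simp)).continuous
  have cz := continuousOn_grad h.contDiff hz1 h.injective
  have cφ := continuousOn_grad h.contDiff hφ1 h.injective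
  have cχ : ContinuousOn (fun u => ‖fderiv ℝ G u (gradCoeff (fderiv ℝ G u) (fderiv ℝ zh u))‖ *
    ‖fderiv ℝ G u (gradCoeff (fderiv ℝ G u) (fderiv ℝ φh u))‖) K := cz.norm.mul cφ.norm
  refine h.abs_setIntegral_sub_le
    (cz.inner cφ) ((continuousOn_grad h.contDiff' hz1 h.injective').inner
      (continuousOn_grad h.contDiff' hφ1 h.injective')) cχ
    (fun u hu => by rw [h.tgrad_eq hzh hzl hu, h.tgrad_eq hφh hφl hu])
    (fun u hu => by rw [h.tgrad_eq' hzh hz hu, h.tgrad_eq' hφh hφ hu])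
    (fun u hu => by rw [h.tgrad_eq hzh hzl hu, h.tgrad_eq hφh hφl hu])
    (fun u hu => ?_) (fun u hu => ?_)
  · exact (abs_inner_gradCoeff_sub_le (h.injective u hu) (h.injective' u hu) h.pos.le h.le_half
      (h.metric_le u hu) _ _).trans_eq (by ring)
  · rw [one_mul]
    exact abs_real_inner_le_norm _ _

theorem IsPiecePair.abs_tensorForm_sub_le (h : IsPiecePair K ε C S S' G H Gt Ht W W')
    {zl z φl φ : Euc (m + 1) → ℝ} {zh φh : Euc m → ℝ} (hzh : ContDiff ℝ ∞ zh)
    (hφh : ContDiff ℝ ∞ φh) (hzl : ∀ u ∈ K, zl (G u) = zh u) (hz : ∀ u ∈ K, z (H u) = zh u)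
    (hφl : ∀ u ∈ K, φl (G u) = φh u) (hφ : ∀ u ∈ K, φ (H u) = φh u) :
    IntegrableOn (fun x => ∑ i, ∑ j, velocityTensor S W x i j * tgrad S zl x j * tgrad S φl x i)
      (G '' K) μHE[m] ∧
    IntegrableOn (fun x => ‖tgrad S zl x‖ * ‖tgrad S φl x‖) (G '' K) μHE[m] ∧
    |∫ x in G '' K, (∑ i, ∑ j, velocityTensor S W x i j * tgrad S zl x j * tgrad S φl x i)
        ∂μHE[m] -
      ∫ x in H '' K, (∑ i, ∑ j, velocityTensor S' W' x i j * tgrad S' z x j * tgrad S' φ x i)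
        ∂μHE[m]| ≤
      ((2 * m * (1 + 3 * C) + 12 * C + 4) + ((2 * m * (1 + 3 * C) + 12 * C + 4) +
        (m * C + 2 * C)) * (2 ^ (m + 1) * (1 + 2 ^ m))) * ε *
        ∫ x in G '' K, ‖tgrad S zl x‖ * ‖tgrad S φl x‖ ∂μHE[m] := by
  have hz1 := (hzh.fderiv_right (m := ∞) (by simp)).continuous
  have hφ1 := (hφh.fderiv_right (m := ∞) (by simp)).continuous
  have cz := continuousOn_grad h.contDiff hz1 h.injective
  have cφ := continuousOn_grad h.contDiff hφ1 h.injective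
  have cχ : ContinuousOn (fun u => ‖fderiv ℝ G u (gradCoeff (fderiv ℝ G u) (fderiv ℝ zh u))‖ *
    ‖fderiv ℝ G u (gradCoeff (fderiv ℝ G u) (fderiv ℝ φh u))‖) K := cz.norm.mul cφ.norm
  refine h.abs_setIntegral_sub_le
    (continuousOn_paramTensor h.contDiff h.contDiff_velocity hz1 hφ1 h.injective)
    (continuousOn_paramTensor h.contDiff' h.contDiff_velocity' hz1 hφ1 h.injective')
    cχ
    (fun u hu => ?_) (fun u hu => ?_)
    (fun u hu => by rw [h.tgrad_eq hzh hzl hu, h.tgrad_eq hφh hφl hu])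
    (fun u hu => ?_) (fun u hu => ?_)
  · rw [h.tgrad_eq hzh hzl hu, h.tgrad_eq hφh hφl hu]
    exact (h.isLocalParam hu).velocityTensor_eq
      (h.contDiff_velocity.differentiable (by simp) u).hasFDerivAt
      (eventually_of_mem (isOpen_interior.mem_nhds hu) h.velocity_eq) _ _
  · rw [h.tgrad_eq' hzh hz hu, h.tgrad_eq' hφh hφ hu]
    exact (h.isLocalParam' hu).velocityTensor_eq
      (h.contDiff_velocity'.differentiable (by simp) u).hasFDerivAt
      (eventually_of_mem (isOpen_interior.mem_nhds hu) h.velocity_eq') _ _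
  · have := abs_paramTensor_sub_le (h.injective u hu) (h.injective' u hu) h.pos.le h.le_half
      h.nonneg (h.metric_le u hu) (h.metricRate_le u hu) (h.velocity_le u hu)
      (fderiv ℝ zh u) (fderiv ℝ φh u)
    rw [finrank_euclideanSpace_fin] at this
    exact this.trans_eq (by ring)
  · have := abs_paramTensor_le (h.injective u hu) h.nonneg (h.velocity_le u hu)
      (gradCoeff (fderiv ℝ G u) (fderiv ℝ zh u)) (gradCoeff (fderiv ℝ G u) (fderiv ℝ φh u))
    rw [finrank_euclideanSpace_fin] at this
    exact this.trans_eq (by ring)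

/-- The lifts and their tangential gradients are bounded on each piece. -/
theorem IsPiecePair.integrableOn_sq (h : IsPiecePair K ε C S S' G H Gt Ht W W')
    {zl : Euc (m + 1) → ℝ} {zh : Euc m → ℝ} (hzh : ContDiff ℝ ∞ zh)
    (hzl : ∀ u ∈ K, zl (G u) = zh u) :
    IntegrableOn zl (G '' K) μHE[m] ∧ IntegrableOn (fun x => ‖zl x‖ ^ 2) (G '' K) μHE[m] ∧
    IntegrableOn (tgrad S zl) (G '' K) μHE[m] ∧
    IntegrableOn (fun x => ‖tgrad S zl x‖ ^ 2) (G '' K) μHE[m] := by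
  have hz1 := (hzh.fderiv_right (m := ∞) (by simp)).continuous
  have cz := continuousOn_grad h.contDiff hz1 h.injective
  have key : ∀ {F : Type} [NormedAddCommGroup F] [NormedSpace ℝ F] {f : Euc (m + 1) → F}
      {φ : Euc m → F}, ContinuousOn φ K → (∀ u ∈ interior K, f (G u) = φ u) →
      IntegrableOn f (G '' K) μHE[m] := fun hφ hf =>
    (integrableOn_image_and_integral_eq h.isCompact h.convex h.contDiff h.injOn hφ hf).1
  have hz := hzh.continuous.continuousOn (s := K)
  have hzl' : ∀ u ∈ interior K, zl (G u) = zh u := fun u hu => hzl u (interior_subset hu)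
  exact ⟨key hz hzl', key (hz.norm.pow 2) fun u hu => by rw [hzl' u hu]; rfl,
    key cz fun u hu => h.tgrad_eq hzh hzl hu,
    key (cz.norm.pow 2) fun u hu => by rw [h.tgrad_eq hzh hzl hu]; rfl⟩

end PiecePair

/-! ### The reference simplex and the data of the elements of a mesh -/

section RefSimplex

variable {m : ℕ}

/-- The reference simplex, in terms of the last `m` barycentric coordinates. -/
def refSimplex (m : ℕ) : Set (Euc m) := bary ⁻¹' stdSimplex ℝ (Fin (m + 1))

theorem bary_injective : Function.Injective (bary (m := m)) := fun u v h => by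
  ext i
  exact congrFun h i.succ

theorem exists_bary_eq {l : Fin (m + 1) → ℝ} (hl : ∑ i, l i = 1) : ∃ u : Euc m, bary u = l := by
  refine ⟨WithLp.toLp 2 fun i => l i.succ, funext fun i => ?_⟩
  refine Fin.cases ?_ (fun i => rfl) i
  rw [Fin.sum_univ_succ] at hl
  simp only [bary, Fin.cons_zero]
  linarith

theorem bary_image_refSimplex : bary '' refSimplex m = stdSimplex ℝ (Fin (m + 1)) := by
  refine Subset.antisymm (image_preimage_subset _ _) fun l hl => ?_
  obtain ⟨u, rfl⟩ := exists_bary_eq hl.2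
  exact ⟨u, hl, rfl⟩

theorem coord_mem_of_mem_refSimplex {u : Euc m} (hu : u ∈ refSimplex m) (i : Fin m) :
    0 ≤ u i ∧ u i ≤ 1 := by
  have h := (mem_Icc_of_mem_stdSimplex hu i.succ)
  exact h

/-- The estimates on the open ball of radius `2` hold near every point of the reference simplex. -/
theorem refSimplex_subset_ball : refSimplex m ⊆ Metric.ball 0 2 := by
  intro u hu
  rw [mem_ball_zero_iff]
  have h1 : ∑ i, u i ≤ 1 := by
    have h := hu.1 0
    simp only [bary, Fin.cons_zero] at h
    linarith
  have h2 : ‖u‖ ^ 2 ≤ 1 := by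
    rw [EuclideanSpace.norm_sq_eq]
    refine le_trans (Finset.sum_le_sum fun i _ => ?_) h1
    obtain ⟨h3, h4⟩ := coord_mem_of_mem_refSimplex hu i
    rw [Real.norm_eq_abs, abs_of_nonneg h3]
    nlinarith
  nlinarith [norm_nonneg u]

theorem isCompact_refSimplex : IsCompact (refSimplex m) :=
  Metric.isCompact_of_isClosed_isBounded
    ((isClosed_stdSimplex ℝ (Fin (m + 1))).preimage contDiff_bary.continuous)
    (Metric.isBounded_ball.subset refSimplex_subset_ball)

theorem bary_convex_comb (u v : Euc m) {a b : ℝ} (hab : a + b = 1) :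
    bary (a • u + b • v) = a • bary u + b • bary v := by
  funext i
  refine Fin.cases ?_ (fun i => ?_) i
  · simp [bary, Finset.sum_add_distrib, ← Finset.mul_sum]
    linear_combination (1 : ℝ) * hab.symm
  · simp [bary]

theorem convex_refSimplex : Convex ℝ (refSimplex m) := by
  intro u hu v hv a b ha hb hab
  change bary (a • u + b • v) ∈ stdSimplex ℝ (Fin (m + 1))
  rw [bary_convex_comb u v hab]
  exact convex_stdSimplex ℝ _ hu hv ha hb hab

theorem bary_pos_of_mem_interior {u : Euc m} (hu : u ∈ interior (refSimplex m)) (i : Fin (m + 1)) :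
    0 < bary u i := by
  refine (((interior_subset hu) : u ∈ refSimplex m).1 i).lt_of_ne fun h0 => ?_
  obtain ⟨c, hc⟩ : ∃ c : Euc m, bary c = fun _ => ((m : ℝ) + 1)⁻¹ :=
    exists_bary_eq (by simp; field_simp)
  -- moving away from the barycentre makes the vanishing coordinate negative
  have hcont : Continuous fun s : ℝ => (1 + s) • u + (-s) • c := by fun_prop
  have hev := hcont.continuousAt.eventually (isOpen_interior.mem_nhds
    (show (1 + (0 : ℝ)) • u + (-(0 : ℝ)) • c ∈ interior (refSimplex m) by simpa using hu))
  obtain ⟨s, hs, hs0⟩ := ((hev.filter_mono nhdsWithin_le_nhds).and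
    (self_mem_nhdsWithin : Ioi (0 : ℝ) ∈ 𝓝[>] 0)).exists
  have h1 := (interior_subset hs : _ ∈ refSimplex m).1 i
  rw [bary_convex_comb _ _ (by ring), hc] at h1
  simp only [Pi.add_apply, Pi.smul_apply, smul_eq_mul, ← h0] at h1
  have : 0 < s * ((m : ℝ) + 1)⁻¹ := mul_pos hs0 (by positivity)
  linarith

theorem div_mem_stdSimplex {k : ℕ} (hk : k ≠ 0) {α : Fin (m + 1) → ℕ}
    (hα : α ∈ Finset.piAntidiag Finset.univ k) :
    (fun i => (α i : ℝ) / k) ∈ stdSimplex ℝ (Fin (m + 1)) := by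
  have hk' : (k : ℝ) ≠ 0 := Nat.cast_ne_zero.2 hk
  refine ⟨fun i => by positivity, ?_⟩
  rw [← Finset.sum_div, div_eq_one_iff_eq hk']
  exact_mod_cast (Finset.mem_piAntidiag.1 hα).1

end RefSimplex

section MeshData

variable {m : ℕ} {T : ℝ} (M : FlatMesh m) {Γ : EvolvingSurface m T} {k : ℕ}

/-- The data of the element `e`: its diameter, its first vertex and the scaled offsets of all its
vertices. -/
def meshData (e : Fin M.card) : SimplexData m :=
  (Metric.diam (range (M.vert e)), M.vert e 0,
    fun i => (Metric.diam (range (M.vert e)))⁻¹ • (M.vert e i - M.vert e 0))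

variable {M}

theorem dist_vert_le_diam (e : Fin M.card) (i j : Fin (m + 1)) :
    dist (M.vert e i) (M.vert e j) ≤ Metric.diam (range (M.vert e)) :=
  Metric.dist_le_diam_of_mem (finite_range _).isBounded (mem_range_self i) (mem_range_self j)

theorem diam_pos (hm : 1 ≤ m) {e : Fin M.card} (h : AffineIndependent ℝ (M.vert e)) :
    0 < Metric.diam (range (M.vert e)) := by
  refine lt_of_lt_of_le (dist_pos.2 (h.injective.ne ?_)) (dist_vert_le_diam e 0 (Fin.last m))
  exact fun h0 => by
    have := congrArg Fin.val h0
    simp at this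
    omega

theorem meshData_point (e : Fin M.card) (hpos : 0 < Metric.diam (range (M.vert e)))
    {l : Fin (m + 1) → ℝ} (hl : ∑ i, l i = 1) :
    (meshData M e).2.1 + (meshData M e).1 • ∑ i, l i • (meshData M e).2.2 i = M.point e l := by
  simp only [meshData, FlatMesh.point, Finset.smul_sum]
  have : ∀ i, Metric.diam (range (M.vert e)) • l i • (Metric.diam (range (M.vert e)))⁻¹ •
      (M.vert e i - M.vert e 0) = l i • M.vert e i - l i • M.vert e 0 := by
    intro i
    rw [smul_comm _ (l i), smul_smul _ _ (_ - _), mul_inv_cancel₀ hpos.ne', one_smul, smul_sub]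
  simp only [this, Finset.sum_sub_distrib, ← Finset.sum_smul, hl, one_smul]
  abel

theorem smul_offsetLin_meshData (e : Fin M.card) (hpos : 0 < Metric.diam (range (M.vert e)))
    (w : Euc m) : (meshData M e).1 • offsetLin (meshData M e).2.2 w =
      ∑ i, baryLin w i • M.vert e i := by
  have h0 : ∑ i, baryLin w i = 0 := by simp [baryLin, Fin.sum_univ_succ]
  simp only [meshData, offsetLin, Finset.smul_sum]
  have : ∀ i, Metric.diam (range (M.vert e)) • baryLin w i • (Metric.diam (range (M.vert e)))⁻¹ •
      (M.vert e i - M.vert e 0) = baryLin w i • M.vert e i - baryLin w i • M.vert e 0 := by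
    intro i
    rw [smul_comm _ (baryLin w i), smul_smul _ _ (_ - _), mul_inv_cancel₀ hpos.ne', one_smul,
      smul_sub]
  simp only [this, Finset.sum_sub_distrib, ← Finset.sum_smul, h0, zero_smul, sub_zero]

theorem norm_meshData_le (e : Fin M.card) (hpos : 0 < Metric.diam (range (M.vert e))) :
    ‖(meshData M e).2.2‖ ≤ 1 := by
  refine (pi_norm_le_iff_of_nonneg zero_le_one).2 fun i => ?_
  simp only [meshData]
  rw [norm_smul, norm_inv, Real.norm_eq_abs, abs_of_pos hpos, ← dist_eq_norm,
    inv_mul_le_iff₀ hpos, mul_one]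
  exact dist_vert_le_diam e i 0

/-- The convex hull of finitely many points consists of their convex combinations. -/
theorem convexHull_range_eq_image {n : ℕ} (v : Fin (m + 1) → Euc n) :
    convexHull ℝ (range v) = (fun l => ∑ i, l i • v i) '' stdSimplex ℝ (Fin (m + 1)) := by
  have h : (fun l : Fin (m + 1) → ℝ => ∑ i, l i • v i) = Fintype.linearCombination ℝ v := by
    ext1 l; rw [Fintype.linearCombination_apply]
  rw [h, ← convexHull_rangle_single_eq_stdSimplex, LinearMap.image_convexHull, ← range_comp]
  congr 2
  ext1 i
  simp

/-- Barycentric coordinates with respect to affinely independent points are unique. -/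
theorem eq_of_sum_smul_eq {v : Fin (m + 1) → Euc (m + 1)} (hv : AffineIndependent ℝ v)
    {l l' : Fin (m + 1) → ℝ} (hl : ∑ i, l i = ∑ i, l' i)
    (h : ∑ i, l i • v i = ∑ i, l' i • v i) : l = l' := by
  rw [affineIndependent_iff] at hv
  have h2 := hv Finset.univ (fun i => l i - l' i) (by simp [Finset.sum_sub_distrib, hl])
    (by simp [sub_smul, Finset.sum_sub_distrib, h])
  exact funext fun i => sub_eq_zero.1 (h2 i (Finset.mem_univ i))

/-- Shape regularity bounds the affine parametrisation of a simplex from below. -/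
theorem norm_le_mul_norm_offsetLin {σ : ℝ} (hσ : 0 < σ) {e : Fin M.card}
    (haff : AffineIndependent ℝ (M.vert e)) (hpos : 0 < Metric.diam (range (M.vert e)))
    (hreg : ∃ z ∈ affineSpan ℝ (range (M.vert e)), ∀ x ∈ affineSpan ℝ (range (M.vert e)),
      σ * dist x z ≤ Metric.diam (range (M.vert e)) → x ∈ convexHull ℝ (range (M.vert e)))
    (w : Euc m) : ((m + 1) * σ)⁻¹ * ‖w‖ ≤ ‖offsetLin (meshData M e).2.2 w‖ := by
  obtain ⟨z, hz, hball⟩ := hreg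
  set d := Metric.diam (range (M.vert e))
  set V : Euc (m + 1) := ∑ i, baryLin w i • M.vert e i with hVdef
  have h0 : ∑ i, baryLin w i = 0 := by simp [baryLin, Fin.sum_univ_succ]
  have hVn : d * ‖offsetLin (meshData M e).2.2 w‖ = ‖V‖ := by
    rw [hVdef, ← smul_offsetLin_meshData e hpos w, norm_smul, Real.norm_eq_abs,
      abs_of_pos (show 0 < (meshData M e).1 from hpos)]
    rfl
  have hcoord : ∀ x ∈ convexHull ℝ (range (M.vert e)), ∃ l ∈ stdSimplex ℝ (Fin (m + 1)),
      ∑ i, l i • M.vert e i = x := by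
    intro x hx
    rwa [convexHull_range_eq_image] at hx
  obtain ⟨l, hl, hlz⟩ := hcoord z (hball z hz (by simpa using hpos.le))
  have key : ∀ s : ℝ, σ * (|s| * ‖V‖) ≤ d → ∀ i, |s| * |baryLin w i| ≤ 1 := by
    intro s hs i
    have hmem : z + s • V ∈ affineSpan ℝ (range (M.vert e)) := by
      rw [show z + s • V = s • V +ᵥ z from add_comm _ _]
      refine AffineSubspace.vadd_mem_of_mem_direction (Submodule.smul_mem _ s ?_) hz
      have hV : V = ∑ i, baryLin w i • (M.vert e i - M.vert e 0) := by
        simp only [smul_sub, Finset.sum_sub_distrib, ← Finset.sum_smul, h0, zero_smul, sub_zero,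
          hVdef]
      rw [hV]
      exact Submodule.sum_mem _ fun i _ => Submodule.smul_mem _ _
        (AffineSubspace.vsub_mem_direction (mem_affineSpan ℝ (mem_range_self i))
          (mem_affineSpan ℝ (mem_range_self 0)))
    obtain ⟨l', hl', hlz'⟩ := hcoord (z + s • V) (hball _ hmem (by
      rwa [dist_eq_norm, add_sub_cancel_left, norm_smul, Real.norm_eq_abs]))
    have e1 : l' = fun i => l i + s * baryLin w i := by
      refine eq_of_sum_smul_eq haff ?_ ?_
      · rw [Finset.sum_add_distrib, ← Finset.mul_sum, h0, hl.2, hl'.2]; simp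
      · rw [hlz']
        simp only [add_smul, mul_smul, Finset.sum_add_distrib, ← Finset.smul_sum, hlz, hVdef]
    have h1 := mem_Icc_of_mem_stdSimplex hl i
    have h2 := mem_Icc_of_mem_stdSimplex hl' i
    rw [e1] at h2
    rw [← abs_mul, abs_le]
    constructor <;> linarith [h1.1, h1.2, h2.1, h2.2]
  have hbound : ∀ i, |baryLin w i| ≤ σ * ‖offsetLin (meshData M e).2.2 w‖ := by
    intro i
    rcases (norm_nonneg V).eq_or_lt with hV | hV
    · by_contra hneg
      push Not at hneg
      have hb : 0 < |baryLin w i| := lt_of_le_of_lt (by positivity) hneg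
      have := key (2 / |baryLin w i|) (by rw [← hV]; simpa using hpos.le) i
      rw [abs_of_pos (by positivity), div_mul_cancel₀ _ hb.ne'] at this
      linarith
    · have := key (d / (σ * ‖V‖)) (by
        rw [abs_of_pos (by positivity)]; exact (by field_simp : _ = d).le) i
      rw [abs_of_pos (by positivity), div_mul_eq_mul_div, div_le_one (by positivity), ← hVn] at this
      have h3 : d * |baryLin w i| ≤ d * (σ * ‖offsetLin (meshData M e).2.2 w‖) := by linarith
      exact le_of_mul_le_mul_left h3 hpos
  have hw : ‖w‖ ≤ (m + 1) * (σ * ‖offsetLin (meshData M e).2.2 w‖) := by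
    have h1 : ‖w‖ ≤ ∑ i, |w i| := by
      have h2 : w = ∑ i, w i • EuclideanSpace.single i (1 : ℝ) := by
        ext j; simp [Pi.single_apply]
      calc ‖w‖ = ‖∑ i, w i • EuclideanSpace.single i (1 : ℝ)‖ := by rw [← h2]
        _ ≤ _ := norm_sum_le_of_le _ fun i _ => by simp [norm_smul]
    refine h1.trans ?_
    have h2 : ∑ i : Fin m, |w i| ≤ ∑ _i : Fin m, σ * ‖offsetLin (meshData M e).2.2 w‖ :=
      Finset.sum_le_sum fun i _ => hbound i.succ
    refine h2.trans ?_
    simp only [Finset.sum_const, Finset.card_univ, Fintype.card_fin, nsmul_eq_mul]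
    gcongr
    linarith
  rw [inv_mul_le_iff₀ (by positivity)]
  linarith

end MeshData

/-! ### The elements of an admissible mesh and their lifts -/

section Derivatives

variable {m : ℕ} {V : Type} [NormedAddCommGroup V] [NormedSpace ℝ V] {f : ElementSpace m → V}

theorem hasDerivAt_time (hf : ContDiff ℝ ∞ f) (π : SimplexData m) (t : ℝ) (u : Euc m) :
    HasDerivAt (fun s : ℝ => f (π, (s, u))) (dirDeriv timeDir f (π, (t, u))) t := by
  have h : HasDerivAt (fun s : ℝ => ((π, (s, u)) : ElementSpace m)) (0, (1, 0)) t :=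
    (hasDerivAt_const t π).prodMk ((hasDerivAt_id t).prodMk (hasDerivAt_const t u))
  exact (hf.differentiable (by simp) (π, (t, u))).hasFDerivAt.comp_hasDerivAt t h

theorem contDiff_slice (hf : ContDiff ℝ ∞ f) (π : SimplexData m) (t : ℝ) :
    ContDiff ℝ ∞ fun u : Euc m => f (π, (t, u)) :=
  hf.comp (contDiff_const.prodMk (contDiff_const.prodMk contDiff_id))

theorem fderiv_slice (hf : ContDiff ℝ ∞ f) (π : SimplexData m) (t : ℝ) (u w : Euc m) :
    fderiv ℝ (fun u : Euc m => f (π, (t, u))) u w = dirDeriv (spaceDir w) f (π, (t, u)) := by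
  have h : HasFDerivAt (fun u : Euc m => ((π, (t, u)) : ElementSpace m))
      ((0 : Euc m →L[ℝ] SimplexData m).prod
        ((0 : Euc m →L[ℝ] ℝ).prod (ContinuousLinearMap.id ℝ (Euc m)))) u :=
    (hasFDerivAt_const π u).prodMk ((hasFDerivAt_const t u).prodMk (hasFDerivAt_id u))
  have h2 := (hf.differentiable (by simp) (π, (t, u))).hasFDerivAt.comp u h
  rw [show fderiv ℝ (fun u : Euc m => f (π, (t, u))) u = _ from h2.fderiv]
  rfl

end Derivatives

section Nodes

variable {m : ℕ} {T : ℝ} {M : FlatMesh m} {Γ : EvolvingSurface m T} {k : ℕ} {σ : ℝ}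

/-- The nodal property of the Lagrange basis at the vertices. -/
theorem lagrange_single (i : Fin (m + 1)) {α : Fin (m + 1) → ℕ}
    (hα : α ∈ Finset.piAntidiag Finset.univ k) :
    lagrange k α (Pi.single i 1) = if α = Pi.single i k then 1 else 0 := by
  have hsum : ∑ j, α j = k := (Finset.mem_piAntidiag.1 hα).1
  rw [lagrange_eq_prod_realChoose]
  split_ifs with h
  · refine Finset.prod_eq_one fun j _ => ?_
    rcases eq_or_ne j i with rfl | hj
    · simpa [h] using realChoose_natCast_self k
    · simp [h, hj, realChoose_zero_right]
  · obtain ⟨j, hj, hαj⟩ : ∃ j, j ≠ i ∧ α j ≠ 0 := by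
      by_contra hcon
      push Not at hcon
      refine h (funext fun j => ?_)
      rcases eq_or_ne j i with rfl | hj
      · rw [Pi.single_eq_same, ← hsum, Finset.sum_eq_single j (fun j' _ h' => hcon j' h')
          (by simp)]
      · rw [hcon j hj, Pi.single_eq_of_ne hj]
    refine Finset.prod_eq_zero (Finset.mem_univ j) ?_
    have := realChoose_natCast_of_lt (n := 0) (Nat.pos_of_ne_zero hαj)
    simpa [hj] using this

theorem param_single (hk : k ≠ 0) (t : ℝ) (e : Fin M.card) (i : Fin (m + 1))
    (h : M.vert e i ∈ Γ.initial) :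
    M.param Γ k t e (Pi.single i 1) = Γ.flow t (M.vert e i) := by
  have hmem : Pi.single i k ∈ Finset.piAntidiag (Finset.univ : Finset (Fin (m + 1))) k := by
    simp [Finset.mem_piAntidiag]
  rw [FlatMesh.param, FlatMesh.localInterp, Finset.sum_eq_single_of_mem _ hmem]
  · rw [lagrange_single i hmem, if_pos rfl, one_smul, id, FlatMesh.node]
    have : M.point e (fun j => ((Pi.single i k : Fin (m + 1) → ℕ) j : ℝ) / k) = M.vert e i := by
      rw [FlatMesh.point, Finset.sum_eq_single i]
      · rw [Pi.single_eq_same, div_self (Nat.cast_ne_zero.2 hk), one_smul]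
      · intro j _ hj
        simp [hj]
      · simp
    rw [this, closestPoint_eq_self Γ.isCompact_initial h]
  · intro α hα hne
    rw [lagrange_single i hα, if_neg hne, zero_smul]

theorem continuous_localInterp {F : Type*} [NormedAddCommGroup F] [NormedSpace ℝ F] (t : ℝ)
    (w : Euc (m + 1) → F) (e : Fin M.card) : Continuous (M.localInterp Γ k t w e) :=
  continuous_finsetSum _ fun α _ => (contDiff_lagrange k α).continuous.smul continuous_const

/-- The vertices of a flat simplex lie on its curved element at time `0`, so that the diameter of the
element bounds the size. -/
theorem FlatMesh.Admissible.isRegularData (hM : M.Admissible Γ k σ) (hm : 1 ≤ m) (hk : k ≠ 0)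
    (hσ : 0 < σ) (e : Fin M.card) {η₀ : ℝ} (h : Metric.diam (M.element Γ k 0 e) ≤ η₀) :
    IsRegularData Γ η₀ ((m + 1) * σ)⁻¹ (meshData M e) := by
  have hpos := diam_pos hm (hM.affineIndependent e)
  have hsub : range (M.vert e) ⊆ M.element Γ k 0 e := by
    rintro _ ⟨i, rfl⟩
    refine ⟨_, single_mem_stdSimplex ℝ i, ?_⟩
    rw [param_single hk 0 e i (hM.vert_mem e i), Γ.flow_zero _ (hM.vert_mem e i)]
  have hbdd : Bornology.IsBounded (M.element Γ k 0 e) :=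
    ((isCompact_stdSimplex ℝ (Fin (m + 1))).image (continuous_localInterp 0 id e)).isBounded
  refine ⟨hpos, (Metric.diam_mono hsub hbdd).trans h, hM.vert_mem e 0, norm_meshData_le e hpos,
    fun i => ?_, norm_le_mul_norm_offsetLin hσ (hM.affineIndependent e) hpos (hM.shapeRegular e)⟩
  have h1 := meshData_point e hpos (l := Pi.single i 1) (by simp)
  have h2 : M.point e (Pi.single i 1) = M.vert e i := by
    simp [FlatMesh.point, Pi.single_apply]
  have h3 : ∑ j, (Pi.single i 1 : Fin (m + 1) → ℝ) j • (meshData M e).2.2 j =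
      (meshData M e).2.2 i := by simp [Pi.single_apply]
  rw [h3, h2] at h1
  rw [h1]
  exact hM.vert_mem e i

/-- Different elements of a conforming mesh have disjoint interiors. -/
theorem FlatMesh.Admissible.eq_of_point_eq (hM : M.Admissible Γ k σ) {e e' : Fin M.card}
    {l l' : Fin (m + 1) → ℝ} (hl : l ∈ stdSimplex ℝ (Fin (m + 1))) (hpos : ∀ i, 0 < l i)
    (hl' : l' ∈ stdSimplex ℝ (Fin (m + 1))) (h : M.point e l = M.point e' l') :
    e = e' ∧ l = l' := by
  have hx : M.point e l ∈ convexHull ℝ (range (M.vert e) ∩ range (M.vert e')) := by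
    rw [← hM.conforming e e', convexHull_range_eq_image, convexHull_range_eq_image]
    exact ⟨⟨l, hl, rfl⟩, ⟨l', hl', h.symm⟩⟩
  have hsub : range (M.vert e) ⊆ range (M.vert e') := by
    rintro _ ⟨i, rfl⟩
    by_contra hi
    -- otherwise the point would lie in the face opposite to the vertex
    let A : Set (Fin (m + 1) → ℝ) := stdSimplex ℝ (Fin (m + 1)) ∩ {c | c i = 0}
    have hA : Convex ℝ A := (convex_stdSimplex ℝ _).inter
      (convex_hyperplane (LinearMap.proj i : (Fin (m + 1) → ℝ) →ₗ[ℝ] ℝ).isLinear 0)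
    have hle : convexHull ℝ (range (M.vert e) ∩ range (M.vert e')) ⊆
        Fintype.linearCombination ℝ (M.vert e) '' A := by
      refine convexHull_min ?_ (hA.linear_image _)
      rintro _ ⟨⟨j, rfl⟩, hj⟩
      have hji : i ≠ j := by rintro rfl; exact hi hj
      exact ⟨Pi.single j 1, ⟨single_mem_stdSimplex ℝ j, by simp [hji]⟩, by simp⟩
    obtain ⟨c, ⟨hc, hci⟩, hcx⟩ := hle hx
    rw [Fintype.linearCombination_apply] at hcx
    have := eq_of_sum_smul_eq (hM.affineIndependent e) (hc.2.trans hl.2.symm) hcx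
    exact (hpos i).ne' (this ▸ hci)
  have hcard : ∀ e, (range (M.vert e)).ncard = m + 1 := fun e => by
    rw [← image_univ, ncard_image_of_injective _ (hM.affineIndependent e).injective]
    simp
  have hee : e = e' := hM.injective
    (eq_of_subset_of_ncard_le hsub (by rw [hcard, hcard]) (finite_range _))
  subst hee
  exact ⟨rfl, eq_of_sum_smul_eq (hM.affineIndependent e) (hl.2.trans hl'.2.symm) h⟩

end Nodes

section Elements

variable {m : ℕ} {T : ℝ} {M : FlatMesh m} {Γ : EvolvingSurface m T} {k : ℕ} {σ δ C : ℝ}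
  {p : ℝ × Euc (m + 1) → Euc (m + 1)} {P : ElementSpace m → Euc (m + 1)}

/-- On the element with the data `π`, the map `P` is the projection of `elementMap` to the surface,
and close to it. -/
structure IsProjectedElement (Γ : EvolvingSurface m T) (p : ℝ × Euc (m + 1) → Euc (m + 1)) (δ : ℝ)
    (k : ℕ) (C : ℝ) (P : ElementSpace m → Euc (m + 1)) (π : SimplexData m) : Prop where
  dist_base : ∀ u ∈ Metric.ball (0 : Euc m) 2, dist (π.2.1 + π.1 • offset π.2.2 u) π.2.1 < δ
  mem : ∀ u ∈ Metric.ball (0 : Euc m) 2, ∀ t ∈ Icc 0 T, P (π, (t, u)) ∈ Γ.surface t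
  proj_eq : ∀ u ∈ Metric.ball (0 : Euc m) 2, ∀ t ∈ Icc 0 T,
    Γ.proj t (elementMap Γ p k (π, (t, u))) = P (π, (t, u))
  dist_lt : ∀ u ∈ Metric.ball (0 : Euc m) 2, ∀ t ∈ Icc 0 T,
    dist (elementMap Γ p k (π, (t, u))) (P (π, (t, u))) < δ
  isClosePair : ∀ u ∈ Metric.ball (0 : Euc m) 2, ∀ t ∈ Icc 0 T,
    IsClosePair C (C * π.1 ^ (k + 1)) (elementMap Γ p k) P (π, (t, u))

/-- At the nodes the closest point is given by its smooth extension `p`. -/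
theorem closestPoint_node (hT : 0 ≤ T) (hp : IsProjection Γ δ p) (hk : k ≠ 0) {e : Fin M.card}
    (hpos : 0 < Metric.diam (range (M.vert e))) (hv : M.vert e 0 ∈ Γ.initial)
    (h : IsProjectedElement Γ p δ k C P (meshData M e)) {α : Fin (m + 1) → ℕ}
    (hα : α ∈ Finset.piAntidiag Finset.univ k) :
    closestPoint Γ.initial (M.point e fun i => (α i : ℝ) / k) =
      p (0, (meshData M e).2.1 + (meshData M e).1 • ∑ i, ((α i : ℝ) / k) • (meshData M e).2.2 i) ∧
    closestPoint Γ.initial (M.point e fun i => (α i : ℝ) / k) ∈ Γ.initial := by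
  have hl := div_mem_stdSimplex hk hα
  obtain ⟨u, hu⟩ := exists_bary_eq hl.2
  have hu1 : u ∈ refSimplex m := by rw [refSimplex, mem_preimage, hu]; exact hl
  have h1 := h.dist_base u (refSimplex_subset_ball hu1)
  rw [offset, hu] at h1
  rw [← meshData_point e hpos hl.2]
  obtain ⟨h2, h3⟩ := hp.initial hT hv h1
  exact ⟨h2, h2 ▸ h3⟩

theorem param_bary (hT : 0 ≤ T) (hp : IsProjection Γ δ p) (hk : k ≠ 0) {e : Fin M.card}
    (hpos : 0 < Metric.diam (range (M.vert e))) (hv : M.vert e 0 ∈ Γ.initial)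
    (h : IsProjectedElement Γ p δ k C P (meshData M e)) (t : ℝ) (u : Euc m) :
    M.param Γ k t e (bary u) = elementMap Γ p k (meshData M e, (t, u)) := by
  refine Finset.sum_congr rfl fun α hα => ?_
  rw [id, FlatMesh.node, transport, (closestPoint_node hT hp hk hpos hv h hα).1]

/-- The discrete velocity is the velocity of the parametrisation, as the nodes move with `v`. -/
theorem localInterp_velocity (hT : 0 < T) (hp : IsProjection Γ δ p) (hk : k ≠ 0) {e : Fin M.card}
    (hpos : 0 < Metric.diam (range (M.vert e))) (hv : M.vert e 0 ∈ Γ.initial)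
    (h : IsProjectedElement Γ p δ k C P (meshData M e)) {t : ℝ} (ht : t ∈ Icc 0 T) (u : Euc m) :
    M.localInterp Γ k t (Γ.velocity t) e (bary u) =
      dirDeriv timeDir (elementMap Γ p k) (meshData M e, (t, u)) := by
  have h1 : HasDerivWithinAt (fun s => M.param Γ k s e (bary u))
      (M.localInterp Γ k t (Γ.velocity t) e (bary u)) (Icc 0 T) t := by
    refine HasDerivWithinAt.fun_sum fun α hα => ?_
    exact (Γ.hasDerivWithinAt_flow t ht _
      (closestPoint_node hT.le hp hk hpos hv h hα).2).const_smul (lagrange k α (bary u))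
  have e1 : (fun s => M.param Γ k s e (bary u)) =
      fun s => elementMap Γ p k (meshData M e, (s, u)) :=
    funext fun s => param_bary hT.le hp hk hpos hv h s u
  rw [e1] at h1
  exact (uniqueDiffOn_Icc hT t ht).eq_deriv _ h1
    (hasDerivAt_time (contDiff_elementMap Γ hp.1 k) _ t u).hasDerivWithinAt

/-- The material derivative of the projection of a moving point. -/
theorem material_velocity_eq (hT : 0 < T) (hp : IsProjection Γ δ p) (hP : ContDiff ℝ ∞ P)
    {π : SimplexData m} (h : IsProjectedElement Γ p δ k C P π) {t : ℝ} (ht : t ∈ Icc 0 T)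
    {u : Euc m} (hu : u ∈ Metric.ball (0 : Euc m) 2) :
    derivWithin (fun s => Γ.proj s (elementMap Γ p k (π, (t, u)))) (Icc 0 T) t +
      fderiv ℝ (Γ.proj t) (elementMap Γ p k (π, (t, u)))
        (dirDeriv timeDir (elementMap Γ p k) (π, (t, u))) = dirDeriv timeDir P (π, (t, u)) := by
  set F := elementMap Γ p k with hFdef
  set x := F (π, (t, u)) with hx
  have hud := uniqueDiffOn_Icc hT t ht
  have hdp := (hp.1.differentiable (by simp) (t, x)).hasFDerivAt
  have h1 : derivWithin (fun s => Γ.proj s x) (Icc 0 T) t = fderiv ℝ p (t, x) (1, 0) := by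
    have h2 : HasDerivAt (fun s : ℝ => p (s, x)) (fderiv ℝ p (t, x) (1, 0)) t :=
      hdp.comp_hasDerivAt t ((hasDerivAt_id t).prodMk (hasDerivAt_const t x))
    refine (h2.hasDerivWithinAt.congr_of_eventuallyEq_of_mem ?_ ht).derivWithin hud
    have h3 : ContinuousAt (fun s : ℝ => dist x (P (π, (s, u)))) t :=
      continuousAt_const.dist (hasDerivAt_time hP π t u).continuousAt
    filter_upwards [self_mem_nhdsWithin,
      nhdsWithin_le_nhds (h3.eventually (gt_mem_nhds (h.dist_lt u hu t ht)))] with s hs hs'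
    exact hp.2 s hs x _ (h.mem u hu s hs) hs'
  have h2 : fderiv ℝ (Γ.proj t) x (dirDeriv timeDir F (π, (t, u))) =
      fderiv ℝ p (t, x) (0, dirDeriv timeDir F (π, (t, u))) := by
    have h3 : Γ.proj t =ᶠ[𝓝 x] fun y => p (t, y) := by
      have h4 : ContinuousAt (fun y => dist y (P (π, (t, u)))) x := by fun_prop
      filter_upwards [h4.eventually (gt_mem_nhds (h.dist_lt u hu t ht))] with y hy
      exact hp.2 t ht y _ (h.mem u hu t ht) hy
    rw [h3.fderiv_eq]
    have h5 : HasFDerivAt (fun y : Euc (m + 1) => (t, y))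
        ((0 : Euc (m + 1) →L[ℝ] ℝ).prod (ContinuousLinearMap.id ℝ (Euc (m + 1)))) x :=
      (hasFDerivAt_const t x).prodMk (hasFDerivAt_id x)
    rw [show fderiv ℝ (fun y => p (t, y)) x = _ from (hdp.comp x h5).fderiv]
    rfl
  have h3 : HasDerivAt (fun s : ℝ => p (s, F (π, (s, u))))
      (fderiv ℝ p (t, x) (1, dirDeriv timeDir F (π, (t, u)))) t :=
    hdp.comp_hasDerivAt t ((hasDerivAt_id t).prodMk
      (hasDerivAt_time (contDiff_elementMap Γ hp.1 k) π t u))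
  have h4 : ∀ s ∈ Icc 0 T, P (π, (s, u)) = p (s, F (π, (s, u))) := fun s hs =>
    (h.proj_eq u hu s hs).symm.trans (hp.2 s hs _ _ (h.mem u hu s hs) (h.dist_lt u hu s hs))
  rw [h1, h2, ← map_add, Prod.mk_add_mk, add_zero, zero_add]
  exact (hud.eq_deriv _ (hasDerivAt_time hP π t u).hasDerivWithinAt
    (h3.hasDerivWithinAt.congr h4 (h4 t ht))).symm

end Elements

/-! ### Fine meshes -/

section ResolvedMesh

variable {m : ℕ} {T : ℝ} {M : FlatMesh m} {Γ : EvolvingSurface m T} {k : ℕ} {σ δ C : ℝ}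
  {p : ℝ × Euc (m + 1) → Euc (m + 1)} {P : ElementSpace m → Euc (m + 1)}

/-- An admissible mesh which is so fine that the map `P` parametrises the lifts of its elements. -/
structure IsResolvedMesh (M : FlatMesh m) (Γ : EvolvingSurface m T) (k : ℕ) (σ : ℝ)
    (p : ℝ × Euc (m + 1) → Euc (m + 1)) (δ C : ℝ) (P : ElementSpace m → Euc (m + 1)) : Prop where
  admissible : M.Admissible Γ k σ
  time_pos : 0 < T
  degree_ne_zero : k ≠ 0
  isProjection : IsProjection Γ δ p
  contDiff : ContDiff ℝ ∞ P
  diam_pos : ∀ e, 0 < Metric.diam (range (M.vert e))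
  isProjectedElement : ∀ e, IsProjectedElement Γ p δ k C P (meshData M e)

namespace IsResolvedMesh

theorem param_bary (h : IsResolvedMesh M Γ k σ p δ C P) (e : Fin M.card) (t : ℝ) (u : Euc m) :
    M.param Γ k t e (bary u) = elementMap Γ p k (meshData M e, (t, u)) :=
  SurfaceFEM.param_bary h.time_pos.le h.isProjection h.degree_ne_zero (h.diam_pos e)
    (h.admissible.vert_mem e 0) (h.isProjectedElement e) t u

theorem element_eq (h : IsResolvedMesh M Γ k σ p δ C P) (e : Fin M.card) (t : ℝ) :
    M.element Γ k t e = (fun u => elementMap Γ p k (meshData M e, (t, u))) '' refSimplex m := by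
  rw [FlatMesh.element, ← bary_image_refSimplex, image_image]
  exact image_congr fun u _ => h.param_bary e t u

theorem proj_eq (h : IsResolvedMesh M Γ k σ p δ C P) {t : ℝ} (ht : t ∈ Icc 0 T)
    (e : Fin M.card) {u : Euc m} (hu : u ∈ refSimplex m) :
    Γ.proj t (elementMap Γ p k (meshData M e, (t, u))) = P (meshData M e, (t, u)) :=
  (h.isProjectedElement e).proj_eq u (refSimplex_subset_ball hu) t ht

theorem mem_discreteSurface (h : IsResolvedMesh M Γ k σ p δ C P) (t : ℝ) (e : Fin M.card)
    {u : Euc m} (hu : u ∈ refSimplex m) :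
    elementMap Γ p k (meshData M e, (t, u)) ∈ M.discreteSurface Γ k t := by
  refine mem_iUnion.2 ⟨e, ?_⟩
  rw [h.element_eq]
  exact mem_image_of_mem _ hu

theorem elementMap_eq_of_lift_eq (h : IsResolvedMesh M Γ k σ p δ C P) {t : ℝ} (ht : t ∈ Icc 0 T)
    {e e' : Fin M.card} {u u' : Euc m} (hu : u ∈ refSimplex m)
    (hu' : u' ∈ refSimplex m) (heq : P (meshData M e, (t, u)) = P (meshData M e', (t, u'))) :
    elementMap Γ p k (meshData M e, (t, u)) = elementMap Γ p k (meshData M e', (t, u')) := by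
  refine (h.admissible.bijOn_proj t ht).injOn (h.mem_discreteSurface t e hu)
    (h.mem_discreteSurface t e' hu') ?_
  rw [h.proj_eq ht e hu, h.proj_eq ht e' hu', heq]

theorem eq_of_elementMap_eq (h : IsResolvedMesh M Γ k σ p δ C P) {t : ℝ} (ht : t ∈ Icc 0 T)
    {e e' : Fin M.card} {u u' : Euc m} (hu : u ∈ interior (refSimplex m))
    (hu' : u' ∈ refSimplex m) (heq : elementMap Γ p k (meshData M e, (t, u)) =
      elementMap Γ p k (meshData M e', (t, u'))) : e = e' ∧ u = u' := by
  rw [← h.param_bary, ← h.param_bary] at heq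
  have h1 := h.admissible.param_injective t ht e e' _
    (interior_subset hu : u ∈ refSimplex m) _ hu' heq
  obtain ⟨h2, h3⟩ := h.admissible.eq_of_point_eq
    (interior_subset hu : u ∈ refSimplex m) (bary_pos_of_mem_interior hu)
    hu' h1
  exact ⟨h2, bary_injective h3⟩

theorem eq_of_lift_eq (h : IsResolvedMesh M Γ k σ p δ C P) {t : ℝ} (ht : t ∈ Icc 0 T)
    {e e' : Fin M.card} {u u' : Euc m} (hu : u ∈ interior (refSimplex m))
    (hu' : u' ∈ refSimplex m) (heq : P (meshData M e, (t, u)) = P (meshData M e', (t, u'))) :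
    e = e' ∧ u = u' :=
  h.eq_of_elementMap_eq ht hu hu' (h.elementMap_eq_of_lift_eq ht (interior_subset hu) hu' heq)

theorem injOn_elementMap (h : IsResolvedMesh M Γ k σ p δ C P) {t : ℝ} (ht : t ∈ Icc 0 T)
    (e : Fin M.card) :
    InjOn (fun u => elementMap Γ p k (meshData M e, (t, u))) (refSimplex m) := by
  intro u hu u' hu' heq
  simp only [← h.param_bary] at heq
  have h1 := h.admissible.param_injective t ht e e _ hu _ hu' heq
  exact bary_injective (eq_of_sum_smul_eq (h.admissible.affineIndependent e)
    (hu.2.trans hu'.2.symm) h1)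

theorem injOn_lift (h : IsResolvedMesh M Γ k σ p δ C P) {t : ℝ} (ht : t ∈ Icc 0 T)
    (e : Fin M.card) :
    InjOn (fun u => P (meshData M e, (t, u))) (refSimplex m) := fun _ hu _ hu' heq =>
  h.injOn_elementMap ht e hu hu' (h.elementMap_eq_of_lift_eq ht hu hu' heq)

/-- The lifts of the elements cover the surface. -/
theorem surface_eq (h : IsResolvedMesh M Γ k σ p δ C P) {t : ℝ} (ht : t ∈ Icc 0 T) :
    Γ.surface t = ⋃ e, (fun u => P (meshData M e, (t, u))) '' refSimplex m := by
  rw [← (h.admissible.bijOn_proj t ht).image_eq, FlatMesh.discreteSurface, image_iUnion]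
  refine iUnion_congr fun e => ?_
  rw [h.element_eq, image_image]
  exact image_congr fun u hu => h.proj_eq ht e hu

theorem projInv_lift (h : IsResolvedMesh M Γ k σ p δ C P) {t : ℝ} (ht : t ∈ Icc 0 T)
    (e : Fin M.card) {u : Euc m} (hu : u ∈ refSimplex m) :
    M.projInv Γ k t (P (meshData M e, (t, u))) = elementMap Γ p k (meshData M e, (t, u)) := by
  rw [← h.proj_eq ht e hu]
  exact (h.admissible.bijOn_proj t ht).injOn.leftInvOn_invFunOn (h.mem_discreteSurface t e hu)

/-- Near an interior point of a lifted element the surface consists of that element alone. -/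
theorem map_nhds_lift (h : IsResolvedMesh M Γ k σ p δ C P) {t : ℝ} (ht : t ∈ Icc 0 T)
    (e : Fin M.card) {u : Euc m} (hu : u ∈ interior (refSimplex m)) :
    map (fun u => P (meshData M e, (t, u))) (𝓝 u) = 𝓝[Γ.surface t] P (meshData M e, (t, u)) := by
  have hc : ∀ e, Continuous fun u => P (meshData M e, (t, u)) := fun e =>
    (contDiff_slice h.contDiff (meshData M e) t).continuous
  refine map_nhds_eq_of_isCompact (K := refSimplex m) (Z := ⋃ e' ∈ {e' | e' ≠ e},
    (fun u => P (meshData M e', (t, u))) '' refSimplex m) isCompact_refSimplex (hc e) ?_ ?_ ?_ ?_ ?_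
  · filter_upwards [Metric.isOpen_ball.mem_nhds (refSimplex_subset_ball (interior_subset hu))]
      with v hv
    exact (h.isProjectedElement e).mem v hv t ht
  · rw [h.surface_eq ht]
    refine iUnion_subset fun e' => ?_
    rcases eq_or_ne e' e with rfl | hne
    · exact subset_union_left
    · exact (subset_biUnion_of_mem (u := fun e' => (fun u => P (meshData M e', (t, u))) ''
        refSimplex m) (show e' ∈ {e' | e' ≠ e} from hne)).trans subset_union_right
  · exact (toFinite _).isClosed_biUnion fun e' _ =>
      (isCompact_refSimplex.image (hc e')).isClosed
  · intro hmem
    obtain ⟨e', he', u', hu', heq⟩ := mem_iUnion₂.1 hmem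
    exact he' (h.eq_of_lift_eq ht hu hu' heq.symm).1.symm
  · intro v hv heq
    exact (h.eq_of_lift_eq ht hu hv heq.symm).2.symm

theorem map_nhds_elementMap (h : IsResolvedMesh M Γ k σ p δ C P) {t : ℝ} (ht : t ∈ Icc 0 T)
    (e : Fin M.card) {u : Euc m} (hu : u ∈ interior (refSimplex m)) :
    map (fun u => elementMap Γ p k (meshData M e, (t, u))) (𝓝 u) =
      𝓝[M.element Γ k t e] elementMap Γ p k (meshData M e, (t, u)) := by
  refine map_nhds_eq_of_isCompact (K := refSimplex m) (Z := ∅) isCompact_refSimplex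
    (contDiff_slice (contDiff_elementMap Γ h.isProjection.1 k) (meshData M e) t).continuous
    ?_ ?_ isClosed_empty (notMem_empty _) ?_
  · filter_upwards [isOpen_interior.mem_nhds hu] with v hv
    rw [h.element_eq]
    exact mem_image_of_mem _ (interior_subset hv)
  · rw [h.element_eq, union_empty]
  · intro v hv heq
    exact h.injOn_elementMap ht e hv (interior_subset hu) heq

theorem discreteVelocity_elementMap (h : IsResolvedMesh M Γ k σ p δ C P) {t : ℝ} (ht : t ∈ Icc 0 T)
    (e : Fin M.card) {u : Euc m}
    (hu : u ∈ interior (refSimplex m)) :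
    M.discreteVelocity Γ k t (elementMap Γ p k (meshData M e, (t, u))) =
      dirDeriv timeDir (elementMap Γ p k) (meshData M e, (t, u)) := by
  have hex : ∃ q : Fin M.card × (Fin (m + 1) → ℝ), q.2 ∈ stdSimplex ℝ (Fin (m + 1)) ∧
      M.param Γ k t q.1 q.2 = elementMap Γ p k (meshData M e, (t, u)) :=
    ⟨(e, bary u), (interior_subset hu : u ∈ refSimplex m), h.param_bary e t u⟩
  rw [FlatMesh.discreteVelocity, dif_pos hex]
  obtain ⟨h1, h2⟩ := hex.choose_spec
  generalize hex.choose = q at h1 h2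
  obtain ⟨e', l⟩ := q
  rw [← h.param_bary] at h2
  have h3 := h.admissible.param_injective t ht e e' _
    (interior_subset hu : u ∈ refSimplex m) _ h1 h2.symm
  obtain ⟨rfl, rfl⟩ := h.admissible.eq_of_point_eq
    (interior_subset hu : u ∈ refSimplex m)
    (bary_pos_of_mem_interior hu) h1 h3
  exact localInterp_velocity h.time_pos h.isProjection h.degree_ne_zero (h.diam_pos _)
    (h.admissible.vert_mem _ 0) (h.isProjectedElement _) ht u

theorem liftedVelocity_lift (h : IsResolvedMesh M Γ k σ p δ C P) {t : ℝ} (ht : t ∈ Icc 0 T)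
    (e : Fin M.card) {u : Euc m} (hu : u ∈ interior (refSimplex m)) :
    M.liftedVelocity Γ k t (P (meshData M e, (t, u))) =
      dirDeriv timeDir P (meshData M e, (t, u)) := by
  rw [FlatMesh.liftedVelocity, h.projInv_lift ht e (interior_subset hu),
    h.discreteVelocity_elementMap ht e hu]
  exact material_velocity_eq h.time_pos h.isProjection h.contDiff (h.isProjectedElement e) ht
    (refSimplex_subset_ball (interior_subset hu))

/-- Every element of a resolved mesh and its lift form a pair of close pieces. -/
theorem isPiecePair (h : IsResolvedMesh M Γ k σ p δ C P) {t : ℝ} (ht : t ∈ Icc 0 T)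
    (hC : 0 < C) {ε : ℝ} (hε : ε ≤ 1 / 2) (e : Fin M.card)
    (hle : C * (meshData M e).1 ^ (k + 1) ≤ ε) :
    IsPiecePair (refSimplex m) ε C (Γ.surface t) (M.element Γ k t e)
      (fun u => P (meshData M e, (t, u))) (fun u => elementMap Γ p k (meshData M e, (t, u)))
      (fun u => dirDeriv timeDir P (meshData M e, (t, u)))
      (fun u => dirDeriv timeDir (elementMap Γ p k) (meshData M e, (t, u)))
      (M.liftedVelocity Γ k t) (M.discreteVelocity Γ k t) := by
  have hF := contDiff_elementMap Γ h.isProjection.1 k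
  have hpos : 0 < (meshData M e).1 := h.diam_pos e
  have hpair : ∀ u ∈ refSimplex m, _ := fun u hu =>
    (h.isProjectedElement e).isClosePair u (refSimplex_subset_ball hu) t ht
  have hinj : ∀ A : Euc m →L[ℝ] Euc (m + 1), (∀ w, w ≠ 0 → A w ≠ 0) → Function.Injective A :=
    fun A hA => (injective_iff_map_eq_zero A).2 fun w hw => by_contra fun h0 => hA w h0 hw
  refine ⟨isCompact_refSimplex, convex_refSimplex, contDiff_slice h.contDiff _ t,
    contDiff_slice hF _ t, contDiff_slice (contDiff_dirDeriv _ h.contDiff) _ t,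
    contDiff_slice (contDiff_dirDeriv _ hF) _ t, h.injOn_lift ht e, h.injOn_elementMap ht e,
    lt_of_lt_of_le (by positivity) hle, hε, hC.le, fun u hu w w' => ?_, fun u hu w w' => ?_,
    fun u hu w => ?_, fun u hu => hinj _ fun w hw => ?_, fun u hu => hinj _ fun w hw => ?_,
    fun u hu => h.map_nhds_lift ht e hu, fun u hu => h.map_nhds_elementMap ht e hu,
    fun u hu => h.liftedVelocity_lift ht e hu, fun u hu => h.discreteVelocity_elementMap ht e hu⟩
  · simp only [fderiv_slice hF, fderiv_slice h.contDiff]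
    exact ((hpair u hu).metric_le w w').trans (by gcongr)
  · simp only [fderiv_slice hF, fderiv_slice h.contDiff, fderiv_slice (contDiff_dirDeriv _ hF),
      fderiv_slice (contDiff_dirDeriv _ h.contDiff)]
    exact ((hpair u hu).metricRate_le w w').trans (by gcongr)
  · simp only [fderiv_slice h.contDiff, fderiv_slice (contDiff_dirDeriv _ h.contDiff)]
    exact (hpair u hu).velocity_le w
  · rw [fderiv_slice h.contDiff]
    exact (hpair u hu).ne_zero w hw
  · rw [fderiv_slice hF]
    exact (hpair u hu).ne_zero' w hw

end IsResolvedMesh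

/-- Fine admissible meshes are resolved. -/
theorem exists_isResolvedMesh (Γ : EvolvingSurface m T) (hT : 0 < T) (hm : 1 ≤ m) (hk : k ≠ 0)
    (hσ : 0 < σ) : ∃ h₀ > 0, ∃ C > 0, ∃ (p : ℝ × Euc (m + 1) → Euc (m + 1)) (δ : ℝ)
      (P : ElementSpace m → Euc (m + 1)), ∀ M : FlatMesh m, M.Admissible Γ k σ →
      ∀ h ≤ h₀, (∀ e, Metric.diam (M.element Γ k 0 e) ≤ h) →
        IsResolvedMesh M Γ k σ p δ C P ∧ ∀ e, (meshData M e).1 ≤ h := by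
  obtain ⟨δ, hδ, p, hp⟩ := exists_contDiff_closestPoint Γ
  obtain ⟨h₀, hh₀, C, hC, P, hP, H⟩ := exists_elementMap_isClosePair Γ hT hδ hp hk
    (c := ((m + 1) * σ)⁻¹) (by positivity)
  refine ⟨h₀, hh₀, C, hC, p, δ, P, fun M hM h hh hd => ?_⟩
  have hreg := fun e => hM.isRegularData hm hk hσ e (hd e)
  refine ⟨⟨hM, hT, hk, hp, hP, fun e => (hreg e).size_pos, fun e => ?_⟩,
    fun e => (hreg e).size_le⟩
  have H1 := H _ ((hreg e).mono hh)
  exact ⟨fun u hu => (H1 u hu).1, fun u hu t ht => ((H1 u hu).2 t ht).1,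
    fun u hu t ht => ((H1 u hu).2 t ht).2.1, fun u hu t ht => ((H1 u hu).2 t ht).2.2.1,
    fun u hu t ht => ((H1 u hu).2 t ht).2.2.2⟩

end ResolvedMesh

/-! ### Summation over the elements -/

section Summation

variable {m : ℕ}

theorem abs_integral_iUnion_sub_sum_le {X ι : Type} [MeasurableSpace X] {μ : Measure X} [Fintype ι]
    {A : ι → Set X} (hA : ∀ e, MeasurableSet (A e)) (hd : Pairwise fun e e' => μ (A e ∩ A e') = 0)
    {f ψ : X → ℝ} {b : ι → ℝ} {c : ℝ}
    (h : ∀ e, IntegrableOn f (A e) μ ∧ IntegrableOn ψ (A e) μ ∧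
      |∫ x in A e, f x ∂μ - b e| ≤ c * ∫ x in A e, ψ x ∂μ) :
    |∫ x in ⋃ e, A e, f x ∂μ - ∑ e, b e| ≤ c * ∫ x in ⋃ e, A e, ψ x ∂μ := by
  have key : ∀ g : X → ℝ, (∀ e, IntegrableOn g (A e) μ) →
      ∫ x in ⋃ e, A e, g x ∂μ = ∑ e, ∫ x in A e, g x ∂μ := by
    intro g hg
    rw [integral_iUnion_ae (fun e => (hA e).nullMeasurableSet) hd
      (integrableOn_finite_iUnion.2 hg), tsum_fintype]
  rw [key f fun e => (h e).1, key ψ fun e => (h e).2.1, ← Finset.sum_sub_distrib, Finset.mul_sum]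
  exact (Finset.abs_sum_le_sum_abs _ _).trans (Finset.sum_le_sum fun e _ => (h e).2.2)

theorem memLp_two_iUnion {X ι F : Type} [MeasurableSpace X] {μ : Measure X} [Finite ι]
    [NormedAddCommGroup F] {A : ι → Set X} {f : X → F}
    (h : ∀ e, IntegrableOn f (A e) μ ∧ IntegrableOn (fun x => ‖f x‖ ^ 2) (A e) μ) :
    MemLp f 2 (μ.restrict (⋃ e, A e)) :=
  (memLp_two_iff_integrable_sq_norm
    (aestronglyMeasurable_iUnion_iff.2 fun e => (h e).1.aestronglyMeasurable)).2
    (integrableOn_finite_iUnion.2 fun e => (h e).2)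

theorem integral_norm_mul_norm_le {F : Type} [NormedAddCommGroup F] {S : Set (Euc (m + 1))}
    {f g : Euc (m + 1) → F} (hf : MemLp f 2 (μHE[m].restrict S))
    (hg : MemLp g 2 (μHE[m].restrict S)) :
    ∫ x in S, ‖f x‖ * ‖g x‖ ∂μHE[m] ≤ normL2 S f * normL2 S g := by
  have := integral_mul_norm_le_Lp_mul_Lq (p := 2) (q := 2) Real.HolderConjugate.two_two
    (by simpa using hf) (by simpa using hg)
  simpa only [normL2, Real.sqrt_eq_rpow, Real.rpow_two] using this

end Summation

namespace IsResolvedMesh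

variable {m : ℕ} {T : ℝ} {M : FlatMesh m} {Γ : EvolvingSurface m T} {k : ℕ} {σ δ C : ℝ}
  {p : ℝ × Euc (m + 1) → Euc (m + 1)} {P : ElementSpace m → Euc (m + 1)}

/-- The lifts of different elements overlap in a null set. -/
theorem measure_lift_inter_eq_zero (h : IsResolvedMesh M Γ k σ p δ C P) {t : ℝ}
    (ht : t ∈ Icc 0 T) {e e' : Fin M.card} (hne : e ≠ e') :
    μHE[m] ((fun u => P (meshData M e, (t, u))) '' refSimplex m ∩
      (fun u => P (meshData M e', (t, u))) '' refSimplex m) = 0 := by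
  refine measure_mono_null ?_ (measure_image_diff_interior isCompact_refSimplex convex_refSimplex
    (contDiff_slice h.contDiff (meshData M e) t) (h.injOn_lift ht e))
  rintro _ ⟨⟨u, hu, rfl⟩, ⟨u', hu', heq⟩⟩
  exact ⟨u, ⟨hu, fun hui => hne (h.eq_of_lift_eq ht hui hu' heq.symm).1⟩, rfl⟩

theorem finiteElement_elementMap (h : IsResolvedMesh M Γ k σ p δ C P) {t : ℝ}
    {Z : Euc (m + 1) → ℝ} (hZ : M.IsFiniteElement Γ k t Z) (e : Fin M.card) {u : Euc m}
    (hu : u ∈ refSimplex m) :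
    Z (elementMap Γ p k (meshData M e, (t, u))) = M.localInterp Γ k t Z e (bary u) := by
  rw [← h.param_bary]
  exact hZ e _ hu

theorem lift_apply (h : IsResolvedMesh M Γ k σ p δ C P) {t : ℝ} (ht : t ∈ Icc 0 T)
    {Z : Euc (m + 1) → ℝ} (hZ : M.IsFiniteElement Γ k t Z) (e : Fin M.card) {u : Euc m}
    (hu : u ∈ refSimplex m) :
    M.lift Γ k t Z (P (meshData M e, (t, u))) = M.localInterp Γ k t Z e (bary u) := by
  rw [FlatMesh.lift, h.projInv_lift ht e hu, h.finiteElement_elementMap hZ e hu]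

theorem contDiff_localInterp_bary (t : ℝ) (Z : Euc (m + 1) → ℝ) (e : Fin M.card) :
    ContDiff ℝ ∞ fun u : Euc m => M.localInterp Γ k t Z e (bary u) :=
  ContDiff.sum fun α _ => ((contDiff_lagrange k α).comp contDiff_bary).smul contDiff_const

theorem memLp_lift (h : IsResolvedMesh M Γ k σ p δ C P) (hC : 0 < C) {ε : ℝ} (hε : ε ≤ 1 / 2)
    (hle : ∀ e, C * (meshData M e).1 ^ (k + 1) ≤ ε) {t : ℝ} (ht : t ∈ Icc 0 T)
    {Z : Euc (m + 1) → ℝ} (hZ : M.IsFiniteElement Γ k t Z) :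
    MemLp (M.lift Γ k t Z) 2 (μHE[m].restrict (Γ.surface t)) ∧
      MemLp (tgrad (Γ.surface t) (M.lift Γ k t Z)) 2 (μHE[m].restrict (Γ.surface t)) := by
  have key := fun e => (h.isPiecePair ht hC hε e (hle e)).integrableOn_sq
    (contDiff_localInterp_bary t Z e) fun u hu => h.lift_apply ht hZ e hu
  have hS : μHE[m].restrict (Γ.surface t) = μHE[m].restrict
      (⋃ e, (fun u => P (meshData M e, (t, u))) '' refSimplex m) := by rw [← h.surface_eq ht]
  rw [hS]
  constructor
  · exact memLp_two_iUnion fun e => ⟨(key e).1, (key e).2.1⟩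
  · exact memLp_two_iUnion fun e => ⟨(key e).2.2.1, (key e).2.2.2⟩

/-- Errors of the elements, measured in a product of two `L²` functions, add up to an error that is
bounded by the product of the `L²` norms. -/
theorem abs_integral_sub_sum_le (h : IsResolvedMesh M Γ k σ p δ C P) {t : ℝ} (ht : t ∈ Icc 0 T)
    {F : Type} [NormedAddCommGroup F] {v w : Euc (m + 1) → F}
    (hv : MemLp v 2 (μHE[m].restrict (Γ.surface t)))
    (hw : MemLp w 2 (μHE[m].restrict (Γ.surface t))) {f : Euc (m + 1) → ℝ} {b : Fin M.card → ℝ}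
    {c : ℝ} (hc : 0 ≤ c)
    (hb : ∀ e, IntegrableOn f ((fun u => P (meshData M e, (t, u))) '' refSimplex m) μHE[m] ∧
      IntegrableOn (fun x => ‖v x‖ * ‖w x‖)
        ((fun u => P (meshData M e, (t, u))) '' refSimplex m) μHE[m] ∧
      |∫ x in (fun u => P (meshData M e, (t, u))) '' refSimplex m, f x ∂μHE[m] - b e| ≤
        c * ∫ x in (fun u => P (meshData M e, (t, u))) '' refSimplex m, ‖v x‖ * ‖w x‖ ∂μHE[m]) :
    |∫ x in Γ.surface t, f x ∂μHE[m] - ∑ e, b e| ≤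
      c * normL2 (Γ.surface t) v * normL2 (Γ.surface t) w := by
  have h1 := abs_integral_iUnion_sub_sum_le (fun e => (isCompact_refSimplex.image
    (contDiff_slice h.contDiff (meshData M e) t).continuous).measurableSet)
    (fun e e' hne => h.measure_lift_inter_eq_zero ht hne) hb
  rw [← h.surface_eq ht] at h1
  rw [mul_assoc]
  exact h1.trans (mul_le_mul_of_nonneg_left (integral_norm_mul_norm_le hv hw) hc)

/-- The perturbation estimates, in terms of the relative error `ε` of the elements of the mesh. -/
theorem perturbation_le (h : IsResolvedMesh M Γ k σ p δ C P) (hC : 0 < C) {ε : ℝ} (hε0 : 0 ≤ ε)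
    (hε : ε ≤ 1 / 2) (hle : ∀ e, C * (meshData M e).1 ^ (k + 1) ≤ ε) {t : ℝ} (ht : t ∈ Icc 0 T)
    {Z φ : Euc (m + 1) → ℝ} (hZ : M.IsFiniteElement Γ k t Z) (hφ : M.IsFiniteElement Γ k t φ) :
    |massForm (Γ.surface t) (M.lift Γ k t Z) (M.lift Γ k t φ) - M.discreteMassForm Γ k t Z φ| ≤
      (0 + (0 + 1) * (2 ^ (m + 1) * (1 + 2 ^ m))) * ε * normL2 (Γ.surface t) (M.lift Γ k t Z) *
        normL2 (Γ.surface t) (M.lift Γ k t φ) ∧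
    |stiffnessForm (Γ.surface t) (M.lift Γ k t Z) (M.lift Γ k t φ) -
        M.discreteStiffnessForm Γ k t Z φ| ≤
      (2 + (2 + 1) * (2 ^ (m + 1) * (1 + 2 ^ m))) * ε *
        normL2 (Γ.surface t) (tgrad (Γ.surface t) (M.lift Γ k t Z)) *
        normL2 (Γ.surface t) (tgrad (Γ.surface t) (M.lift Γ k t φ)) ∧
    |divForm (Γ.surface t) (M.liftedVelocity Γ k t) (M.lift Γ k t Z) (M.lift Γ k t φ) -
        M.discreteDivForm Γ k t (M.discreteVelocity Γ k t) Z φ| ≤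
      (m * (1 + 2 * C) + (m * (1 + 2 * C) + m * C) * (2 ^ (m + 1) * (1 + 2 ^ m))) * ε *
        normL2 (Γ.surface t) (M.lift Γ k t Z) * normL2 (Γ.surface t) (M.lift Γ k t φ) ∧
    |tensorForm (Γ.surface t) (M.liftedVelocity Γ k t) (M.lift Γ k t Z) (M.lift Γ k t φ) -
        M.discreteTensorForm Γ k t (M.discreteVelocity Γ k t) Z φ| ≤
      ((2 * m * (1 + 3 * C) + 12 * C + 4) + ((2 * m * (1 + 3 * C) + 12 * C + 4) +
          (m * C + 2 * C)) * (2 ^ (m + 1) * (1 + 2 ^ m))) * ε *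
        normL2 (Γ.surface t) (tgrad (Γ.surface t) (M.lift Γ k t Z)) *
        normL2 (Γ.surface t) (tgrad (Γ.surface t) (M.lift Γ k t φ)) := by
  obtain ⟨hZ1, hZ2⟩ := h.memLp_lift hC hε hle ht hZ
  obtain ⟨hφ1, hφ2⟩ := h.memLp_lift hC hε hle ht hφ
  have hp := fun e => h.isPiecePair ht hC hε e (hle e)
  have hZe := fun e => contDiff_localInterp_bary (M := M) (Γ := Γ) (k := k) t Z e
  have hφe := fun e => contDiff_localInterp_bary (M := M) (Γ := Γ) (k := k) t φ e
  refine ⟨h.abs_integral_sub_sum_le ht hZ1 hφ1 (by positivity) fun e => ?_,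
    h.abs_integral_sub_sum_le ht hZ2 hφ2 (by positivity) fun e => ?_,
    h.abs_integral_sub_sum_le ht hZ1 hφ1 (by positivity) fun e => ?_,
    h.abs_integral_sub_sum_le ht hZ2 hφ2 (by positivity) fun e => ?_⟩
  · have := (hp e).abs_massForm_sub_le (hZe e) (hφe e) (fun u hu => h.lift_apply ht hZ e hu)
      (fun u hu => h.finiteElement_elementMap hZ e hu) (fun u hu => h.lift_apply ht hφ e hu)
      (fun u hu => h.finiteElement_elementMap hφ e hu)
    rwa [← h.element_eq] at this
  · have := (hp e).abs_stiffnessForm_sub_le (hZe e) (hφe e) (fun u hu => h.lift_apply ht hZ e hu)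
      (fun u hu => h.finiteElement_elementMap hZ e hu) (fun u hu => h.lift_apply ht hφ e hu)
      (fun u hu => h.finiteElement_elementMap hφ e hu)
    rwa [← h.element_eq] at this
  · have := (hp e).abs_divForm_sub_le (hZe e) (hφe e) (fun u hu => h.lift_apply ht hZ e hu)
      (fun u hu => h.finiteElement_elementMap hZ e hu) (fun u hu => h.lift_apply ht hφ e hu)
      (fun u hu => h.finiteElement_elementMap hφ e hu)
    rwa [← h.element_eq] at this
  · have := (hp e).abs_tensorForm_sub_le (hZe e) (hφe e) (fun u hu => h.lift_apply ht hZ e hu)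
      (fun u hu => h.finiteElement_elementMap hZ e hu) (fun u hu => h.lift_apply ht hφ e hu)
      (fun u hu => h.finiteElement_elementMap hφ e hu)
    rwa [← h.element_eq] at this

end IsResolvedMesh

end SurfaceFEM

end

theorem mainTheorem6 (m k : ℕ) (hm1 : 1 ≤ m) (hm2 : m ≤ 2) (hk : 1 ≤ k) (T : ℝ) (hT : 0 < T)
    (Γ : SurfaceFEM.EvolvingSurface m T) (σ : ℝ) (hσ : 0 < σ) :
    ∃ c > 0, ∃ h₀ > 0, ∀ M : SurfaceFEM.FlatMesh m, M.Admissible Γ k σ →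
      ∀ h : ℝ, 0 < h → h ≤ h₀ →
      (∀ t ∈ Set.Icc 0 T, ∀ e, Metric.diam (M.element Γ k t e) ≤ h) →
      ∀ t ∈ Set.Icc 0 T, ∀ Z φ : Euc (m + 1) → ℝ,
        M.IsFiniteElement Γ k t Z → M.IsFiniteElement Γ k t φ →
        MeasureTheory.MemLp (M.lift Γ k t Z) 2 (μHE[m].restrict (Γ.surface t)) ∧
        MeasureTheory.MemLp (SurfaceFEM.tgrad (Γ.surface t) (M.lift Γ k t Z)) 2
          (μHE[m].restrict (Γ.surface t)) ∧
        |SurfaceFEM.massForm (Γ.surface t) (M.lift Γ k t Z) (M.lift Γ k t φ)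
            - M.discreteMassForm Γ k t Z φ|
          ≤ c * h ^ (k + 1) * SurfaceFEM.normL2 (Γ.surface t) (M.lift Γ k t Z)
            * SurfaceFEM.normL2 (Γ.surface t) (M.lift Γ k t φ) ∧
        |SurfaceFEM.stiffnessForm (Γ.surface t) (M.lift Γ k t Z) (M.lift Γ k t φ)
            - M.discreteStiffnessForm Γ k t Z φ|
          ≤ c * h ^ (k + 1)
            * SurfaceFEM.normL2 (Γ.surface t)
                (SurfaceFEM.tgrad (Γ.surface t) (M.lift Γ k t Z))
            * SurfaceFEM.normL2 (Γ.surface t)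
                (SurfaceFEM.tgrad (Γ.surface t) (M.lift Γ k t φ)) ∧
        |SurfaceFEM.divForm (Γ.surface t) (M.liftedVelocity Γ k t)
              (M.lift Γ k t Z) (M.lift Γ k t φ)
            - M.discreteDivForm Γ k t (M.discreteVelocity Γ k t) Z φ|
          ≤ c * h ^ (k + 1) * SurfaceFEM.normL2 (Γ.surface t) (M.lift Γ k t Z)
            * SurfaceFEM.normL2 (Γ.surface t) (M.lift Γ k t φ) ∧
        |SurfaceFEM.tensorForm (Γ.surface t) (M.liftedVelocity Γ k t)
              (M.lift Γ k t Z) (M.lift Γ k t φ)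
            - M.discreteTensorForm Γ k t (M.discreteVelocity Γ k t) Z φ|
          ≤ c * h ^ (k + 1)
            * SurfaceFEM.normL2 (Γ.surface t)
                (SurfaceFEM.tgrad (Γ.surface t) (M.lift Γ k t Z))
            * SurfaceFEM.normL2 (Γ.surface t)
                (SurfaceFEM.tgrad (Γ.surface t) (M.lift Γ k t φ)) := by
  obtain ⟨h₁, hh₁, C, hC, p, δ, P, H⟩ := SurfaceFEM.exists_isResolvedMesh Γ hT hm1
    (Nat.one_le_iff_ne_zero.1 hk) hσ
  let c₁ : ℝ := 0 + (0 + 1) * (2 ^ (m + 1) * (1 + 2 ^ m))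
  let c₂ : ℝ := 2 + (2 + 1) * (2 ^ (m + 1) * (1 + 2 ^ m))
  let c₃ : ℝ := m * (1 + 2 * C) + (m * (1 + 2 * C) + m * C) * (2 ^ (m + 1) * (1 + 2 ^ m))
  let c₄ : ℝ := (2 * m * (1 + 3 * C) + 12 * C + 4) + ((2 * m * (1 + 3 * C) + 12 * C + 4) +
    (m * C + 2 * C)) * (2 ^ (m + 1) * (1 + 2 ^ m))
  have hc₁ : 0 ≤ c₁ := by positivity
  have hc₂ : 0 < c₂ := by positivity
  have hc₃ : 0 ≤ c₃ := by positivity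
  have hc₄ : 0 ≤ c₄ := by positivity
  -- below `h₀` the elements are resolved, and their relative error `C * h ^ (k + 1)` is at most `1/2`
  refine ⟨(c₁ + c₂ + c₃ + c₄) * C, by positivity, min h₁ (min 1 (1 / (2 * C))),
    lt_min hh₁ (lt_min one_pos (by positivity)), fun M hM h hh hh₀ hd t ht Z φ hZ hφ => ?_⟩
  obtain ⟨hres, hsize⟩ := H M hM h (hh₀.trans (min_le_left _ _)) (hd 0 ⟨le_rfl, hT.le⟩)
  have hle : ∀ e, C * (SurfaceFEM.meshData M e).1 ^ (k + 1) ≤ C * h ^ (k + 1) := fun e => by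
    have : 0 ≤ (SurfaceFEM.meshData M e).1 := Metric.diam_nonneg
    gcongr
    exact hsize e
  have hε : C * h ^ (k + 1) ≤ 1 / 2 := by
    have hh1 : h ≤ 1 := hh₀.trans ((min_le_right _ _).trans (min_le_left _ _))
    have hh2 : h ≤ 1 / (2 * C) := hh₀.trans ((min_le_right _ _).trans (min_le_right _ _))
    calc C * h ^ (k + 1) ≤ C * h := by
          gcongr; exact pow_le_of_le_one hh.le hh1 (Nat.succ_ne_zero k)
      _ ≤ C * (1 / (2 * C)) := by gcongr
      _ = 1 / 2 := by field_simp
  have hn : ∀ (F : Type) [NormedAddCommGroup F] (f : Euc (m + 1) → F),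
      0 ≤ SurfaceFEM.normL2 (Γ.surface t) f := fun F _ f => Real.sqrt_nonneg _
  have key : ∀ {x a n₁ n₂ : ℝ}, a ≤ c₁ + c₂ + c₃ + c₄ → 0 ≤ n₁ → 0 ≤ n₂ →
      x ≤ a * (C * h ^ (k + 1)) * n₁ * n₂ →
        x ≤ (c₁ + c₂ + c₃ + c₄) * C * h ^ (k + 1) * n₁ * n₂ := by
    intro x a n₁ n₂ ha hn₁ hn₂ hx
    rw [mul_assoc _ C]
    exact hx.trans (by gcongr)
  obtain ⟨hZ1, hZ2⟩ := hres.memLp_lift hC hε hle ht hZ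
  obtain ⟨b₁, b₂, b₃, b₄⟩ := hres.perturbation_le hC (by positivity) hε hle ht hZ hφ
  exact ⟨hZ1, hZ2, key (a := c₁) (by linarith) (hn _ _) (hn _ _) b₁,
    key (a := c₂) (by linarith) (hn _ _) (hn _ _) b₂,
    key (a := c₃) (by linarith) (hn _ _) (hn _ _) b₃,
    key (a := c₄) (by linarith) (hn _ _) (hn _ _) b₄⟩
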